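/- **Theorem.** Let $d,m\ge 1$ be integers, $1<p<\infty$, $\alpha>0$, and let $\Omega\subset\mathbb R^d$ be a bounded open set. Let $\mathcal O(\Omega)$ be the class of open subsets of $\Omega$, and $\lambda=|\cdot|$ the Lebesgue measure. Let $\mathcal I(p,\alpha)$ be the set of functionals $F:W^{1,p}(\Omega;\mathbb R^m)\times\mathcal O(\Omega)\to[0,\infty]$ such that * (C0) $F(u;O)\ge\alpha\int_O|\nabla u|^p\,dx$ for all $O\in\mathcal O(\Omega)$ and all $u\in W^{1,p}(\Omega;\mathbb R^m)$ with $F(u;O)<\infty$; * (C1) for every $u\in W^{1,p}(\Omega;\mathbb R^m)$ the set function $F(u;\cdot)$ is the trace on $\mathcal O(\Omega)$ of a $[0,\infty]$-valued Borel measure on $\Omega$ that is absolutely continuous with respect to $\lambda$; * (C2) for all $O\in\mathcal O(\Omega)$ and $u,v\in W^{1,p}(\Omega;\mathbb R^m)$, if $u=v$ a.e. in $O$ then $F(u;O)=F(v;O)$. Let $\{F_\varepsilon\}_{\varepsilon\in]0,1]}\subset\mathcal I(p,\alpha)$. For $V\in\mathcal O(\Omega)$ and $w\in W^{1,p}(\Omega;\mathbb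 R^m)$ set $$m_\varepsilon(w;V)=\inf\{F_\varepsilon(v;V): v\in W^{1,p}(\Omega;\mathbb R^m),\ v=w\text{ a.e. in }\Omega\setminus V\},$$ $$m_-(w;V)=\liminf_{\varepsilon\to0}m_\varepsilon(w;V),\qquad m_+(w;V)=\limsup_{\varepsilon\to0}m_\varepsilon(w;V).$$ Let $Q_\rho(x)=x+\rho\,]-\tfrac12,\tfrac12[^d$ and define, for $x\in\Omega$, $v\in\mathbb R^m$ and $\xi\in\mathbb R^{m\times d}$, $$L_0(x,v,\xi)=\limsup_{\rho\to0}\frac{m_+(v+\xi(\cdot-x);Q_\rho(x))}{\rho^d}.$$ Assume the growth condition * (G1) there are $\beta>0$ and a finite nonnegative Borel measure $\nu$ on $\Omega$, absolutely continuous with respect to $\lambda$, such that for every nonempty $V\in\mathcal O(\Omega)$, every $w\in W^{1,p}(\Omega;\mathbb R^m)$ and every $\varepsilon\in]0,1]$ $$\frac{m_\varepsilon(w;V)}{|V|}\le\beta\Big(\frac{\nu(V)}{|V|}+\frac1{|V|}\int_V|w|^p\,dx+\frac1{|V|}\int_V|\nabla w|^p\,dx\Big).$$ Let $u\in W^{1,p}(\Omega;\mathbb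 R^m)$ and $O\in\mathcal O(\Omega)$, put $u_x=u(x)+\nabla u(x)(\cdot-x)$, and assume * (H0) for almost every $x\in O$ $$\liminf_{\rho\to0}\frac{m_-(u_x;Q_\rho(x))}{\rho^d}\ \ge\ \limsup_{\rho\to0}\frac{m_+(u_x;Q_\rho(x))}{\rho^d}.$$ Then $x\mapsto L_0(x,u(x),\nabla u(x))$ is Lebesgue measurable on $O$, and $\{F_\varepsilon(\cdot;O)\}_\varepsilon$ $\Gamma(L^p)$-converges at $u$ to $\int_O L_0(x,u(x),\nabla u(x))\,dx$, that is, $$\inf\Big\{\liminf_{\varepsilon\to0}F_\varepsilon(u_\varepsilon;O)\Big\}=\inf\Big\{\limsup_{\varepsilon\to0}F_\varepsilon(u_\varepsilon;O)\Big\}=\int_O L_0(x,u(x),\nabla u(x))\,dx,$$ where both infima run over all families $\{u_\varepsilon\}_\varepsilon\subset W^{1,p}(\Omega;\mathbb R^m)$ with $u_\varepsilon\to u$ in $L^p(\Omega;\mathbb R^m)$ as $\varepsilon\to0$. -/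

import Mathlib

open MeasureTheory Filter Topology Set
open scoped ENNReal ContDiff

noncomputable section

/-- `ℝⁿ` with its Euclidean norm. -/
abbrev Space (n : ℕ) : Type := EuclideanSpace ℝ (Fin n)

/-- `G` is the weak (distributional) gradient of `u` in `Ω`. An `m × d` matrix is read as a linear
map `ℝᵈ → ℝᵐ`; the identity is tested with all smooth scalar functions compactly supported
in `Ω` and in every direction `e`. -/
def HasWeakGradient {d m : ℕ} (Ω : Set (Space d)) (u : Space d → Space m)
    (G : Space d → Space d →L[ℝ] Space m) : Prop :=
  ∀ φ : Space d → ℝ, ContDiff ℝ ∞ φ → HasCompactSupport φ → tsupport φ ⊆ Ω →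
    ∀ e : Space d, ∫ x in Ω, (fderiv ℝ φ x e) • u x = - ∫ x in Ω, φ x • G x e

/-- The Sobolev space `W^{1,p}(Ω;ℝᵐ)`: an element of `Lᵖ(Ω;ℝᵐ)` together with its weak gradient
(which the function determines), an element of `Lᵖ`. -/
structure SobolevMap {d : ℕ} (Ω : Set (Space d)) (m : ℕ) (p : ℝ) where
  /-- the function -/
  val : Lp (Space m) (ENNReal.ofReal p) (volume.restrict Ω)
  /-- its weak gradient -/
  grad : Lp (Space d →L[ℝ] Space m) (ENNReal.ofReal p) (volume.restrict Ω)
  /-- the defining identity of the weak gradient -/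
  hasWeakGradient : HasWeakGradient Ω val grad

/-- The class `𝓘(p,α)` of `p`-coercive local functionals `F : W^{1,p}(Ω;ℝᵐ) × 𝒪(Ω) → [0,∞]`.
Only the values `F u O` with `O` an open subset of `Ω` matter. -/
structure CoerciveLocal {d m : ℕ} {Ω : Set (Space d)} {p : ℝ} (α : ℝ)
    (F : SobolevMap Ω m p → Set (Space d) → ℝ≥0∞) : Prop where
  /-- `p`-coercivity on the effective domain -/
  coercive : ∀ O : Set (Space d), IsOpen O → O ⊆ Ω → ∀ u : SobolevMap Ω m p, F u O < ⊤ →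
    ENNReal.ofReal α * ∫⁻ x in O, ‖u.grad x‖ₑ ^ p ≤ F u O
  /-- `F(u;·)` is the trace on the open subsets of `Ω` of a Borel measure, absolutely continuous
  with respect to the Lebesgue measure on `Ω` -/
  isMeasure : ∀ u : SobolevMap Ω m p, ∃ μ : Measure (Space d), μ ≪ volume.restrict Ω ∧
    ∀ O : Set (Space d), IsOpen O → O ⊆ Ω → F u O = μ O
  /-- locality -/
  isLocal : ∀ O : Set (Space d), IsOpen O → O ⊆ Ω → ∀ u v : SobolevMap Ω m p,
    (∀ᵐ x ∂volume.restrict O, u.val x = v.val x) → F u O = F v O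

/-- The Dirichlet infimum `m(w;V) = inf {F(v;V) : v ∈ W^{1,p}(Ω;ℝᵐ), v = w a.e. in Ω \ V}`. -/
def dirichletInf {d m : ℕ} {Ω : Set (Space d)} {p : ℝ}
    (F : SobolevMap Ω m p → Set (Space d) → ℝ≥0∞) (w : Space d → Space m)
    (V : Set (Space d)) : ℝ≥0∞ :=
  ⨅ (v : SobolevMap Ω m p) (_ : ∀ᵐ x ∂volume.restrict (Ω \ V), v.val x = w x), F v V

/-- `m₋(w;V) = liminf_{ε → 0} m_ε(w;V)`. -/
def dirichletLiminf {d m : ℕ} {Ω : Set (Space d)} {p : ℝ}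
    (F : ℝ → SobolevMap Ω m p → Set (Space d) → ℝ≥0∞) (w : Space d → Space m)
    (V : Set (Space d)) : ℝ≥0∞ :=
  liminf (fun ε => dirichletInf (F ε) w V) (𝓝[>] (0 : ℝ))

/-- `m₊(w;V) = limsup_{ε → 0} m_ε(w;V)`. -/
def dirichletLimsup {d m : ℕ} {Ω : Set (Space d)} {p : ℝ}
    (F : ℝ → SobolevMap Ω m p → Set (Space d) → ℝ≥0∞) (w : Space d → Space m)
    (V : Set (Space d)) : ℝ≥0∞ :=
  limsup (fun ε => dirichletInf (F ε) w V) (𝓝[>] (0 : ℝ))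

/-- The open cube `Q_ρ(x) = x + ρ ]-1/2,1/2[ᵈ`. -/
def openCube {d : ℕ} (x : Space d) (ρ : ℝ) : Set (Space d) :=
  {y | ∀ i, |y i - x i| < ρ / 2}

/-- The affine map `y ↦ v + ξ (y - x)`. -/
def affineAt {d m : ℕ} (x : Space d) (v : Space m) (ξ : Space d →L[ℝ] Space m) :
    Space d → Space m :=
  fun y => v + ξ (y - x)

/-- The limit integrand
`L₀(x,v,ξ) = limsup_{ρ → 0} m₊(v + ξ(· - x); Q_ρ(x)) / ρᵈ`. -/
def limitIntegrand {d m : ℕ} {Ω : Set (Space d)} {p : ℝ}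
    (F : ℝ → SobolevMap Ω m p → Set (Space d) → ℝ≥0∞)
    (x : Space d) (v : Space m) (ξ : Space d →L[ℝ] Space m) : ℝ≥0∞ :=
  limsup (fun ρ : ℝ => dirichletLimsup F (affineAt x v ξ) (openCube x ρ) / ENNReal.ofReal (ρ ^ d))
    (𝓝[>] (0 : ℝ))

/-- The local condition (H0) at `u` on `O`: for almost every `x ∈ O`, with
`u_x = u(x) + ∇u(x)(· - x)`,
`liminf_{ρ → 0} m₋(u_x;Q_ρ(x)) / ρᵈ ≥ limsup_{ρ → 0} m₊(u_x;Q_ρ(x)) / ρᵈ`. -/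
def LocalConditionH0 {d m : ℕ} {Ω : Set (Space d)} {p : ℝ}
    (F : ℝ → SobolevMap Ω m p → Set (Space d) → ℝ≥0∞)
    (u : SobolevMap Ω m p) (O : Set (Space d)) : Prop :=
  ∀ᵐ x ∂volume.restrict O,
    limsup (fun ρ : ℝ => dirichletLimsup F (affineAt x (u.val x) (u.grad x)) (openCube x ρ) /
        ENNReal.ofReal (ρ ^ d)) (𝓝[>] (0 : ℝ)) ≤
      liminf (fun ρ : ℝ => dirichletLiminf F (affineAt x (u.val x) (u.grad x)) (openCube x ρ) /
        ENNReal.ofReal (ρ ^ d)) (𝓝[>] (0 : ℝ))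

/-- The growth bound (G1): there are `β > 0` and a finite measure `ν ≪ λ` on `Ω` with
`m_ε(u;V)/|V| ≤ β (ν(V)/|V| + ⨍_V |u|ᵖ + ⨍_V |∇u|ᵖ)` for all open `V ⊆ Ω`, all
`u ∈ W^{1,p}(Ω;ℝᵐ)` and all `ε ∈ ]0,1]`. -/
def GrowthBoundG1 {d m : ℕ} {Ω : Set (Space d)} {p : ℝ}
    (F : ℝ → SobolevMap Ω m p → Set (Space d) → ℝ≥0∞) : Prop :=
  ∃ (β : ℝ) (ν : Measure (Space d)), 0 < β ∧ IsFiniteMeasure ν ∧ ν ≪ volume.restrict Ω ∧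
    ∀ V : Set (Space d), IsOpen V → V ⊆ Ω → ∀ u : SobolevMap Ω m p, ∀ ε ∈ Ioc (0 : ℝ) 1,
      dirichletInf (F ε) u.val V / volume V ≤
        ENNReal.ofReal β * (ν V / volume V + (⨍⁻ x in V, ‖u.val x‖ₑ ^ p ∂volume) +
          ⨍⁻ x in V, ‖u.grad x‖ₑ ^ p ∂volume)

/-- The families `(u_ε)` in `W^{1,p}(Ω;ℝᵐ)` that converge to `u` in `Lᵖ(Ω;ℝᵐ)` as `ε → 0`. -/
def approximatingFamilies {d m : ℕ} {Ω : Set (Space d)} {p : ℝ}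
    (u : Lp (Space m) (ENNReal.ofReal p) (volume.restrict Ω)) : Set (ℝ → SobolevMap Ω m p) :=
  {w | Tendsto (fun ε => eLpNorm (fun x => (w ε).val x - u x) (ENNReal.ofReal p)
    (volume.restrict Ω)) (𝓝[>] (0 : ℝ)) (𝓝 0)}

/-- The `Γ(Lᵖ)`-lower limit of `F_ε(·;O)` at `u`, as `ε → 0`. -/
def gammaLiminf {d m : ℕ} {Ω : Set (Space d)} {p : ℝ}
    (F : ℝ → SobolevMap Ω m p → Set (Space d) → ℝ≥0∞)
    (u : Lp (Space m) (ENNReal.ofReal p) (volume.restrict Ω)) (O : Set (Space d)) : ℝ≥0∞ :=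
  ⨅ w ∈ approximatingFamilies u, liminf (fun ε => F ε (w ε) O) (𝓝[>] (0 : ℝ))

/-- The `Γ(Lᵖ)`-upper limit of `F_ε(·;O)` at `u`, as `ε → 0`. -/
def gammaLimsup {d m : ℕ} {Ω : Set (Space d)} {p : ℝ}
    (F : ℝ → SobolevMap Ω m p → Set (Space d) → ℝ≥0∞)
    (u : Lp (Space m) (ENNReal.ofReal p) (volume.restrict Ω)) (O : Set (Space d)) : ℝ≥0∞ :=
  ⨅ w ∈ approximatingFamilies u, limsup (fun ε => F ε (w ε) O) (𝓝[>] (0 : ℝ))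

/-- `F_ε(·;O)` `Γ(Lᵖ)`-converges at `u ∈ W^{1,p}(Ω;ℝᵐ)` to the value `ℓ`. -/
def GammaConvergesAt {d m : ℕ} {Ω : Set (Space d)} {p : ℝ}
    (F : ℝ → SobolevMap Ω m p → Set (Space d) → ℝ≥0∞)
    (u : SobolevMap Ω m p) (O : Set (Space d)) (ℓ : ℝ≥0∞) : Prop :=
  gammaLiminf F u.val O = ℓ ∧ gammaLimsup F u.val O = ℓ

end

/-! ### Calculus of weak gradients: locality, sums, products, affine maps. -/

section WeakGradient

variable {d m : ℕ} {Ω : Set (Space d)}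

/-! The proof is a blow-up argument: every quantity is a set function on small cubes, and only its
density with respect to Lebesgue measure matters. The growth condition bounds the Dirichlet infima
and not the functionals themselves, so an interpolation between two maps is never inserted into `F
ε` directly: across a layer between two concentric cubes one pays the Dirichlet infimum of the
interpolation on that layer, which is at most a constant times its energy there
(`DirichletGrowth.transition_le`).

Let `E` be the finite measure `ν + (|u|ᵖ + |∇u|ᵖ) dx` (`energyMeasure`). Almost every point `x` is
regular: `E` has a finite density there, and the Taylor remainder of `u` on `Q_ρ(x)` is `o(ρ^(d+p))`
in the sense of integrals of `p`-th powers. The latter follows from mollification, a Taylor estimate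
uniform in the mollifier, and Fatou's lemma. A cut-off across the layer between `Q_(σρ)(x)` and
`Q_ρ(x)` has gradient of order `1/ρ`, which the remainder compensates, while the energy of the layer
is of order `(1 - σ^d) ρ^d`. Hence the Dirichlet infima of `u` and of `u_x` have the same densities,
up to a dilation by `σ` close to `1` (`IsRegularPoint.exists_dilation`). With (H0), `m₊(u; Q_ρ(x)) /
ρ^d` converges to `L₀(x, u(x), ∇u(x))`.

Lower bound. Let `W ε → u` in `Lᵖ`. The gradient of `W ε` need not be small on a given layer, so `W
ε` is joined to `u_x` across each of `K` disjoint layers of a geometric family of cubes. Coercivity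
bounds the total gradient cost of all layers by one multiple of the energy on `Q_ρ(x)`; averaging,
with `ε → 0`, `ρ → 0`, `σ → 1` and `K → ∞` in this order, gives `L₀` as a lower bound for the
density of the lower limit of the energies (`IsRegularPoint.liminf_dirichletLiminf_le`). A Vitali
covering integrates this inequality (`lintegral_le_liminf`).

Upper bound. The set `O` is covered up to a null set by disjoint small cubes on which `m₊(u; ·)` is
close to the integral of `L₀`. Almost minimizers with boundary datum `u` are glued together.
Coercivity bounds their gradients, and Poincaré's inequality on cubes of size below `η` makes the
result close to `u` in `Lᵖ` (`eventually_exists_recovery`). A diagonal selection yields a recovery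
family.

Measurability. The set function `b E - m₊(u; ·)` is increasing on cubes, by subadditivity. Its
regularization from larger radii is therefore semicontinuous in the centre, and it still has the
density `b dE/dx - L₀` (`aemeasurable_of_tendsto_dirichletLimsup_div`). -/

theorem integrable_smul_of_hasCompactSupport {E : Type*} [NormedAddCommGroup E] [NormedSpace ℝ E]
    {μ : Measure (Space d)} {c : Space d → ℝ} (hc : Continuous c) (hcs : HasCompactSupport c)
    {f : Space d → E} (hf : Integrable f μ) : Integrable (fun x => c x • f x) μ := by
  obtain ⟨C, hC⟩ := hc.bounded_above_of_compact_support hcs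
  exact hf.bdd_smul C hc.aestronglyMeasurable (ae_of_all _ hC)

theorem integrable_smul_clm_apply {μ : Measure (Space d)} {c : Space d → ℝ} (hc : Continuous c)
    (hcs : HasCompactSupport c) {G : Space d → Space d →L[ℝ] Space m} (hG : Integrable G μ)
    (e : Space d) : Integrable (fun x => c x • G x e) μ :=
  integrable_smul_of_hasCompactSupport hc hcs (hG.apply_continuousLinearMap e)

theorem continuous_fderiv_apply_const {φ : Space d → ℝ} (hφ : ContDiff ℝ ∞ φ) (e : Space d) :
    Continuous fun x => fderiv ℝ φ x e :=
  (hφ.continuous_fderiv (by simp)).clm_apply continuous_const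

theorem integrable_fderiv_smul {μ : Measure (Space d)} {φ : Space d → ℝ} (hφ : ContDiff ℝ ∞ φ)
    (hφs : HasCompactSupport φ) {f : Space d → Space m} (hf : Integrable f μ) (e : Space d) :
    Integrable (fun x => fderiv ℝ φ x e • f x) μ :=
  integrable_smul_of_hasCompactSupport (continuous_fderiv_apply_const hφ e)
    (hφs.fderiv_apply ℝ e) hf

theorem HasWeakGradient.congr_ae {f g : Space d → Space m} {G H : Space d → Space d →L[ℝ] Space m}
    (h : HasWeakGradient Ω f G) (hfg : f =ᵐ[volume.restrict Ω] g)
    (hGH : G =ᵐ[volume.restrict Ω] H) : HasWeakGradient Ω g H := by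
  intro φ hφ hφs hφΩ e
  have h1 := h φ hφ hφs hφΩ e
  rw [← integral_congr_ae (f := fun x => fderiv ℝ φ x e • f x)
      (g := fun x => fderiv ℝ φ x e • g x) (by filter_upwards [hfg] with x hx; simp only [hx]),
    ← integral_congr_ae (f := fun x => φ x • G x e)
      (g := fun x => φ x • H x e) (by filter_upwards [hGH] with x hx; simp only [hx])]
  exact h1

theorem HasWeakGradient.mono {Ω' : Set (Space d)} (hΩ : IsOpen Ω) (hΩ' : Ω' ⊆ Ω)
    {f : Space d → Space m} {G : Space d → Space d →L[ℝ] Space m}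
    (h : HasWeakGradient Ω f G) : HasWeakGradient Ω' f G := by
  intro φ hφ hφs hφΩ e
  have h1 := h φ hφ hφs (hφΩ.trans hΩ') e
  rw [setIntegral_eq_of_subset_of_forall_sdiff_eq_zero hΩ.measurableSet hΩ',
    setIntegral_eq_of_subset_of_forall_sdiff_eq_zero hΩ.measurableSet hΩ'] at h1
  · exact h1
  · intro x hx
    rw [image_eq_zero_of_notMem_tsupport fun hh => hx.2 (hφΩ hh), zero_smul]
  · intro x hx
    rw [image_eq_zero_of_notMem_tsupport (f := fun x => fderiv ℝ φ x e)
      fun hh => hx.2 (hφΩ (tsupport_fderiv_apply_subset ℝ e hh)), zero_smul]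

theorem HasWeakGradient.add {f g : Space d → Space m} {G H : Space d → Space d →L[ℝ] Space m}
    (hf : HasWeakGradient Ω f G) (hg : HasWeakGradient Ω g H)
    (hfi : IntegrableOn f Ω) (hGi : IntegrableOn G Ω)
    (hgi : IntegrableOn g Ω) (hHi : IntegrableOn H Ω) :
    HasWeakGradient Ω (fun x => f x + g x) (fun x => G x + H x) := by
  intro φ hφ hφs hφΩ e
  simp only [smul_add, add_apply]
  rw [integral_add (integrable_fderiv_smul hφ hφs hfi e) (integrable_fderiv_smul hφ hφs hgi e),
    integral_add (integrable_smul_clm_apply hφ.continuous hφs hGi e)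
      (integrable_smul_clm_apply hφ.continuous hφs hHi e), hf φ hφ hφs hφΩ e, hg φ hφ hφs hφΩ e]
  abel

theorem HasWeakGradient.neg {f : Space d → Space m} {G : Space d → Space d →L[ℝ] Space m}
    (hf : HasWeakGradient Ω f G) : HasWeakGradient Ω (fun x => - f x) (fun x => - G x) := by
  intro φ hφ hφs hφΩ e
  simp only [smul_neg, neg_apply, integral_neg, hf φ hφ hφs hφΩ e]

theorem HasWeakGradient.sub {f g : Space d → Space m} {G H : Space d → Space d →L[ℝ] Space m}
    (hf : HasWeakGradient Ω f G) (hg : HasWeakGradient Ω g H)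
    (hfi : IntegrableOn f Ω) (hGi : IntegrableOn G Ω)
    (hgi : IntegrableOn g Ω) (hHi : IntegrableOn H Ω) :
    HasWeakGradient Ω (fun x => f x - g x) (fun x => G x - H x) := by
  simpa only [sub_eq_add_neg] using hf.add hg.neg hfi hGi hgi.neg hHi.neg

/-- The product `φ * χ` is again a test function; the Leibniz rule for it splits the defining
identity into the two terms required. -/
theorem HasWeakGradient.smul {f : Space d → Space m} {G : Space d → Space d →L[ℝ] Space m}
    (hf : HasWeakGradient Ω f G) (hfi : IntegrableOn f Ω) (hGi : IntegrableOn G Ω)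
    {χ : Space d → ℝ} (hχ : ContDiff ℝ ∞ χ) :
    HasWeakGradient Ω (fun x => χ x • f x)
      (fun x => χ x • G x + (fderiv ℝ χ x).smulRight (f x)) := by
  intro φ hφ hφs hφΩ e
  have hprod : ContDiff ℝ ∞ fun x => φ x * χ x := hφ.mul hχ
  have hprods : HasCompactSupport fun x => φ x * χ x := hφs.mul_right
  have hts : tsupport (fun x => φ x * χ x) ⊆ Ω := (tsupport_mul_subset_left).trans hφΩ
  have key := hf _ hprod hprods hts e
  have hd : ∀ x, fderiv ℝ (fun x => φ x * χ x) x e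
      = φ x * fderiv ℝ χ x e + χ x * fderiv ℝ φ x e := by
    intro x
    rw [fderiv_fun_mul (hφ.differentiable (by simp) x) (hχ.differentiable (by simp) x)]
    simp
  have hI1 : Integrable (fun x => (φ x * fderiv ℝ χ x e) • f x) (volume.restrict Ω) :=
    integrable_smul_of_hasCompactSupport
      (hφ.continuous.mul (continuous_fderiv_apply_const hχ e)) hφs.mul_right hfi
  have hI2 : Integrable (fun x => (χ x * fderiv ℝ φ x e) • f x) (volume.restrict Ω) :=
    integrable_smul_of_hasCompactSupport
      (hχ.continuous.mul (continuous_fderiv_apply_const hφ e)) (hφs.fderiv_apply ℝ e).mul_left hfi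
  have hI3 : Integrable (fun x => (φ x * χ x) • G x e) (volume.restrict Ω) :=
    integrable_smul_clm_apply hprod.continuous hprods hGi e
  simp only [hd, add_smul] at key
  rw [integral_add hI1 hI2] at key
  have e1 : ∫ x in Ω, fderiv ℝ φ x e • χ x • f x = ∫ x in Ω, (χ x * fderiv ℝ φ x e) • f x := by
    congr 1; ext1 x; rw [smul_smul, mul_comm]
  have e2 : ∫ x in Ω, φ x • (χ x • G x + (fderiv ℝ χ x).smulRight (f x)) e
      = (∫ x in Ω, (φ x * χ x) • G x e) + ∫ x in Ω, (φ x * fderiv ℝ χ x e) • f x := by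
    rw [← integral_add hI3 hI1]
    congr 1; ext1 x
    simp only [add_apply, smul_apply,
      ContinuousLinearMap.smulRight_apply, smul_add, smul_smul]
  rw [e1, e2, neg_add, ← key]
  abel

/-- On the whole space this is classical integration by parts; restriction to `Ω` is then free. -/
theorem hasWeakGradient_affineAt (x : Space d) (v : Space m)
    (ξ : Space d →L[ℝ] Space m) : HasWeakGradient Ω (affineAt x v ξ) (fun _ => ξ) := by
  suffices h : HasWeakGradient univ (affineAt x v ξ) (fun _ => ξ) from
    h.mono isOpen_univ (subset_univ _) 
  intro φ hφ hφs _ e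
  have hc : Continuous (affineAt x v ξ) := by unfold affineAt; fun_prop
  have hd : ∀ y, HasFDerivAt (affineAt x v ξ) ξ y := by
    intro y
    unfold affineAt
    have := (ξ.hasFDerivAt (x := y - x)).comp y ((hasFDerivAt_id y).sub_const x)
    simpa using this.const_add v
  have hfd : ∀ y, fderiv ℝ (affineAt x v ξ) y = ξ := fun y => (hd y).fderiv
  simp only [Measure.restrict_univ]
  have := integral_smul_fderiv_eq_neg_fderiv_smul_of_integrable (μ := (volume : Measure (Space d)))
    (f := φ) (g := affineAt x v ξ) (v := e)
    (((continuous_fderiv_apply_const hφ e).smul hc).integrable_of_hasCompactSupport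
      (hφs.fderiv_apply ℝ e).smul_right)
    (by
      simp only [hfd]
      exact (hφ.continuous.smul continuous_const).integrable_of_hasCompactSupport hφs.smul_right)
    ((hφ.continuous.smul hc).integrable_of_hasCompactSupport hφs.smul_right)
    (fun y _ => hφ.differentiable (by simp) y) (fun y _ => (hd y).differentiableAt)
  simp only [hfd] at this
  rw [this, neg_neg]

/-- A weak gradient vanishes almost everywhere on an open set on which the function vanishes. -/
theorem HasWeakGradient.ae_eq_zero (hΩ : IsOpen Ω) {f : Space d → Space m}
    {G : Space d → Space d →L[ℝ] Space m} (h : HasWeakGradient Ω f G) (hGi : IntegrableOn G Ω)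
    {V : Set (Space d)} (hV : IsOpen V) (hVΩ : V ⊆ Ω)
    (hf : ∀ᵐ x ∂volume.restrict V, f x = 0) : ∀ᵐ x ∂volume.restrict V, G x = 0 := by
  have hGV := h.mono hΩ hVΩ
  have hGiV : IntegrableOn G V := hGi.mono_set hVΩ
  have key : ∀ e : Space d, ∀ᵐ x ∂volume.restrict V, G x e = 0 := by
    intro e
    rw [ae_restrict_iff' hV.measurableSet]
    refine hV.ae_eq_zero_of_integral_contDiff_smul_eq_zero
      (f := fun x => G x e) ?_ fun φ hφ hφs hφV => ?_
    · exact (IntegrableOn.locallyIntegrableOn (hGiV.apply_continuousLinearMap e))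
    · have h1 := hGV φ hφ hφs hφV e
      have h2 : ∫ x in V, fderiv ℝ φ x e • f x = 0 := by
        rw [integral_congr_ae (g := fun _ => (0 : Space m))
          (by filter_upwards [hf] with x hx; simp [hx])]
        simp
      rw [h2, eq_comm, neg_eq_zero] at h1
      rw [← h1, eq_comm]
      refine setIntegral_eq_integral_of_forall_compl_eq_zero fun x hx => ?_
      rw [image_eq_zero_of_notMem_tsupport fun hh => hx (hφV hh), zero_smul]
  -- The exceptional null set depends on the direction; finitely many basis directions determine the
  -- linear map and allow a common one.
  have hall : ∀ᵐ x ∂volume.restrict V, ∀ i : Fin d, G x (EuclideanSpace.single i 1) = 0 :=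
    ae_all_iff.2 fun i => key _
  filter_upwards [hall] with x hx
  have : (G x).toLinearMap = 0 := by
    refine (EuclideanSpace.basisFun (Fin d) ℝ).toBasis.ext fun i => ?_
    simpa using hx i
  ext1 y
  exact congrArg (fun l => l y) this

end WeakGradient

/-! ### Construction, interpolation and gluing of Sobolev maps. -/

section SobolevMap

variable {d m : ℕ} {Ω : Set (Space d)} {p : ℝ}

theorem eLpNorm_ofReal_lt_top_iff {α E : Type*} [MeasurableSpace α] {μ : Measure α}
    [NormedAddCommGroup E] (hp : 1 < p) (f : α → E) :
    eLpNorm f (ENNReal.ofReal p) μ < ⊤ ↔ ∫⁻ x, ‖f x‖ₑ ^ p ∂μ < ⊤ := by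
  have := eLpNorm_lt_top_iff_lintegral_rpow_enorm_lt_top (f := f) (μ := μ)
    (p := ENNReal.ofReal p) (by simp; linarith) ENNReal.ofReal_ne_top
  rwa [ENNReal.toReal_ofReal (by linarith)] at this

theorem eLpNorm_ofReal_eq {α E : Type*} [MeasurableSpace α] {μ : Measure α}
    [NormedAddCommGroup E] (hp : 1 < p) (f : α → E) :
    eLpNorm f (ENNReal.ofReal p) μ = (∫⁻ x, ‖f x‖ₑ ^ p ∂μ) ^ (1 / p) := by
  have := eLpNorm_eq_lintegral_rpow_enorm_toReal (f := f) (μ := μ)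
    (p := ENNReal.ofReal p) (by simp; linarith) ENNReal.ofReal_ne_top
  rwa [ENNReal.toReal_ofReal (by linarith)] at this

theorem one_le_ofReal_of_lt (hp : 1 < p) : 1 ≤ ENNReal.ofReal p := by
  rw [← ENNReal.ofReal_one]; exact ENNReal.ofReal_le_ofReal hp.le

theorem memLp_fun_add {α E : Type*} [MeasurableSpace α] [NormedAddCommGroup E] {μ : Measure α}
    {P : ℝ≥0∞} {f g : α → E} (hf : MemLp f P μ) (hg : MemLp g P μ) :
    MemLp (fun x => f x + g x) P μ := hf.add hg

theorem memLp_fun_sub {α E : Type*} [MeasurableSpace α] [NormedAddCommGroup E] {μ : Measure α}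
    {P : ℝ≥0∞} {f g : α → E} (hf : MemLp f P μ) (hg : MemLp g P μ) :
    MemLp (fun x => f x - g x) P μ := hf.sub hg

theorem memLp_smul_of_hasCompactSupport {E : Type*} [NormedAddCommGroup E] [NormedSpace ℝ E]
    {μ : Measure (Space d)} {P : ℝ≥0∞} {c : Space d → ℝ} (hc : Continuous c)
    (hcs : HasCompactSupport c) {f : Space d → E} (hf : MemLp f P μ) :
    MemLp (fun x => c x • f x) P μ := by
  obtain ⟨C, hC⟩ := hc.bounded_above_of_compact_support hcs
  refine hf.of_le_mul (c := C) (hc.aestronglyMeasurable.smul hf.1) (ae_of_all _ fun x => ?_)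
  rw [norm_smul]
  gcongr
  exact hC x

theorem memLp_smulRight_of_hasCompactSupport {μ : Measure (Space d)} {P : ℝ≥0∞}
    {c : Space d → Space d →L[ℝ] ℝ} (hc : Continuous c)
    (hcs : HasCompactSupport c) {f : Space d → Space m} (hf : MemLp f P μ) :
    MemLp (fun x => (c x).smulRight (f x)) P μ := by
  obtain ⟨C, hC⟩ := hc.bounded_above_of_compact_support hcs
  refine hf.of_le_mul (c := C) ?_ (ae_of_all _ fun x => ?_)
  · exact (ContinuousLinearMap.smulRightL ℝ (Space d) (Space m)).aestronglyMeasurable_comp₂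
        (hc.aestronglyMeasurable (μ := μ)) hf.1
  · rw [ContinuousLinearMap.norm_smulRight_apply]
    gcongr
    exact hC x

namespace SobolevMap

theorem memLp_val (u : SobolevMap Ω m p) :
    MemLp u.val (ENNReal.ofReal p) (volume.restrict Ω) := Lp.memLp _

theorem memLp_grad (u : SobolevMap Ω m p) :
    MemLp u.grad (ENNReal.ofReal p) (volume.restrict Ω) := Lp.memLp _

theorem lintegral_val_lt_top (hp : 1 < p) (u : SobolevMap Ω m p) :
    ∫⁻ x in Ω, ‖u.val x‖ₑ ^ p < ⊤ := (eLpNorm_ofReal_lt_top_iff hp _).1 u.memLp_val.2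

theorem lintegral_grad_lt_top (hp : 1 < p) (u : SobolevMap Ω m p) :
    ∫⁻ x in Ω, ‖u.grad x‖ₑ ^ p < ⊤ := (eLpNorm_ofReal_lt_top_iff hp _).1 u.memLp_grad.2

theorem integrableOn_val [IsFiniteMeasure (volume.restrict Ω)] (hp : 1 < p)
    (u : SobolevMap Ω m p) : IntegrableOn u.val Ω :=
  u.memLp_val.integrable (one_le_ofReal_of_lt hp)

theorem integrableOn_grad [IsFiniteMeasure (volume.restrict Ω)] (hp : 1 < p)
    (u : SobolevMap Ω m p) : IntegrableOn u.grad Ω :=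
  u.memLp_grad.integrable (one_le_ofReal_of_lt hp)

/-- A function in `Lᵖ` with a weak gradient in `Lᵖ` is an element of `W^{1,p}`. -/
theorem exists_of_hasWeakGradient {f : Space d → Space m} {G : Space d → Space d →L[ℝ] Space m}
    (hf : MemLp f (ENNReal.ofReal p) (volume.restrict Ω))
    (hG : MemLp G (ENNReal.ofReal p) (volume.restrict Ω)) (h : HasWeakGradient Ω f G) :
    ∃ w : SobolevMap Ω m p, w.val =ᵐ[volume.restrict Ω] f ∧ w.grad =ᵐ[volume.restrict Ω] G :=
  ⟨⟨hf.toLp, hG.toLp, h.congr_ae hf.coeFn_toLp.symm hG.coeFn_toLp.symm⟩,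
    hf.coeFn_toLp, hG.coeFn_toLp⟩

theorem exists_affineAt (hΩ : IsOpen Ω) (hΩb : Bornology.IsBounded Ω) (x : Space d) (v : Space m)
    (ξ : Space d →L[ℝ] Space m) :
    ∃ w : SobolevMap Ω m p, w.val =ᵐ[volume.restrict Ω] affineAt x v ξ ∧
      w.grad =ᵐ[volume.restrict Ω] fun _ => ξ := by
  have : IsFiniteMeasure (volume.restrict Ω) := ⟨by simpa using hΩb.measure_lt_top⟩
  have hc : Continuous (affineAt x v ξ) := by unfold affineAt; fun_prop
  refine exists_of_hasWeakGradient ?_ (memLp_const _) (hasWeakGradient_affineAt x v ξ)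
  obtain ⟨C, hC⟩ := (hΩb.isCompact_closure).exists_bound_of_continuousOn hc.continuousOn
  refine MemLp.of_bound hc.aestronglyMeasurable C ?_
  filter_upwards [ae_restrict_mem hΩ.measurableSet] with y hy
  exact hC y (subset_closure hy)

/-- Interpolation `χ v₁ + (1 - χ) v₂` of Sobolev maps by a smooth function. -/
theorem exists_interpolate (hp : 1 < p) [IsFiniteMeasure (volume.restrict Ω)]
    (v₁ v₂ : SobolevMap Ω m p) {χ : Space d → ℝ} (hχ : ContDiff ℝ ∞ χ)
    (hχs : HasCompactSupport χ) :
    ∃ w : SobolevMap Ω m p,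
      (∀ᵐ x ∂volume.restrict Ω, w.val x = v₂.val x + χ x • (v₁.val x - v₂.val x)) ∧
      (∀ᵐ x ∂volume.restrict Ω, w.grad x = v₂.grad x + (χ x • (v₁.grad x - v₂.grad x) +
        (fderiv ℝ χ x).smulRight (v₁.val x - v₂.val x))) := by
  have hfc : Continuous (fderiv ℝ χ) := hχ.continuous_fderiv (by simp)
  have hdv : MemLp (fun x => v₁.val x - v₂.val x) (ENNReal.ofReal p) (volume.restrict Ω) :=
    memLp_fun_sub v₁.memLp_val v₂.memLp_val
  have hdg : MemLp (fun x => v₁.grad x - v₂.grad x) (ENNReal.ofReal p) (volume.restrict Ω) :=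
    memLp_fun_sub v₁.memLp_grad v₂.memLp_grad
  have hsv : MemLp (fun x => χ x • (v₁.val x - v₂.val x)) (ENNReal.ofReal p)
      (volume.restrict Ω) := memLp_smul_of_hasCompactSupport hχ.continuous hχs hdv
  have hsg : MemLp (fun x => χ x • (v₁.grad x - v₂.grad x)) (ENNReal.ofReal p)
      (volume.restrict Ω) := memLp_smul_of_hasCompactSupport hχ.continuous hχs hdg
  have hsr : MemLp (fun x => (fderiv ℝ χ x).smulRight (v₁.val x - v₂.val x)) (ENNReal.ofReal p)
      (volume.restrict Ω) := memLp_smulRight_of_hasCompactSupport hfc (hχs.fderiv ℝ) hdv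
  have h1 : (1 : ℝ≥0∞) ≤ ENNReal.ofReal p := one_le_ofReal_of_lt hp
  have hsum : MemLp (fun x => χ x • (v₁.grad x - v₂.grad x) +
      (fderiv ℝ χ x).smulRight (v₁.val x - v₂.val x)) (ENNReal.ofReal p) (volume.restrict Ω) :=
    memLp_fun_add hsg hsr
  have hw1 : HasWeakGradient Ω (fun x => v₁.val x - v₂.val x) (fun x => v₁.grad x - v₂.grad x) :=
    v₁.hasWeakGradient.sub v₂.hasWeakGradient (v₁.integrableOn_val hp) (v₁.integrableOn_grad hp)
      (v₂.integrableOn_val hp) (v₂.integrableOn_grad hp)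
  have hw2 := hw1.smul (hdv.integrable h1) (hdg.integrable h1) hχ
  have hw3 := v₂.hasWeakGradient.add hw2 (v₂.integrableOn_val hp) (v₂.integrableOn_grad hp)
      (hsv.integrable h1) (hsum.integrable h1)
  have hf1 : MemLp (fun x => v₂.val x + χ x • (v₁.val x - v₂.val x)) (ENNReal.ofReal p)
      (volume.restrict Ω) := memLp_fun_add v₂.memLp_val hsv
  have hf2 : MemLp (fun x => v₂.grad x + (χ x • (v₁.grad x - v₂.grad x) +
      (fderiv ℝ χ x).smulRight (v₁.val x - v₂.val x))) (ENNReal.ofReal p) (volume.restrict Ω) :=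
    memLp_fun_add v₂.memLp_grad hsum
  exact exists_of_hasWeakGradient hf1 hf2 hw3

/-- Competitors of a Dirichlet problem are constrained through their values only; this recovers the
constraint on their gradients on open sets. -/
theorem grad_ae_eq (hp : 1 < p) (hΩ : IsOpen Ω) [IsFiniteMeasure (volume.restrict Ω)]
    (v₁ v₂ : SobolevMap Ω m p) {V : Set (Space d)} (hV : IsOpen V) (hVΩ : V ⊆ Ω)
    (h : ∀ᵐ x ∂volume.restrict V, v₁.val x = v₂.val x) :
    ∀ᵐ x ∂volume.restrict V, v₁.grad x = v₂.grad x := by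
  have := (v₁.hasWeakGradient.sub v₂.hasWeakGradient (v₁.integrableOn_val hp)
    (v₁.integrableOn_grad hp) (v₂.integrableOn_val hp) (v₂.integrableOn_grad hp)).ae_eq_zero hΩ
    ((v₁.integrableOn_grad hp).sub (v₂.integrableOn_grad hp)) hV hVΩ
    (by filter_upwards [h] with x hx; simp [hx])
  filter_upwards [this] with x hx
  exact sub_eq_zero.1 hx

end SobolevMap

/-! ### Series of functions carried by disjoint sets. -/

section DisjointSum

variable {α ι E : Type*} [MeasurableSpace α] {μ : Measure α} [NormedAddCommGroup E]
  {Q : ι → Set α} {g : ι → α → E}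

omit [MeasurableSpace α] in
-- At each point at most one term is non-zero, so no summability has to be discussed.
theorem tsum_disjoint_indicator_of_mem (hd : Pairwise (Function.onFun Disjoint Q)) {i : ι} {x : α}
    (hx : x ∈ Q i) : ∑' j, (Q j).indicator (g j) x = g i x := by
  rw [tsum_eq_single i, indicator_of_mem hx]
  intro j hj
  exact indicator_of_notMem (fun h => disjoint_left.1 (hd hj) h hx) _

omit [MeasurableSpace α] in
theorem tsum_disjoint_indicator_of_notMem {x : α} (hx : x ∉ ⋃ i, Q i) :
    ∑' j, (Q j).indicator (g j) x = 0 := by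
  have : ∀ j, (Q j).indicator (g j) x = 0 :=
    fun j => indicator_of_notMem (fun h => hx (mem_iUnion_of_mem j h)) _
  simp [this]

theorem aestronglyMeasurable_tsum_indicator [Countable ι]
    (hd : Pairwise (Function.onFun Disjoint Q)) (hQ : ∀ i, MeasurableSet (Q i))
    (hg : ∀ i, AEStronglyMeasurable (g i) μ) :
    AEStronglyMeasurable (fun x => ∑' j, (Q j).indicator (g j) x) μ := by
  have h1 : AEStronglyMeasurable (fun x => ∑' j, (Q j).indicator (g j) x)
      (μ.restrict (⋃ i, Q i)) := by
    rw [aestronglyMeasurable_iUnion_iff]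
    intro i
    refine (hg i).restrict.congr ?_
    filter_upwards [ae_restrict_mem (hQ i)] with x hx
    exact (tsum_disjoint_indicator_of_mem hd hx).symm
  have h2 : AEStronglyMeasurable (fun x => ∑' j, (Q j).indicator (g j) x)
      (μ.restrict (⋃ i, Q i)ᶜ) := by
    refine (aestronglyMeasurable_const (b := (0 : E))).congr ?_
    filter_upwards [ae_restrict_mem (MeasurableSet.iUnion hQ).compl] with x hx
    exact (tsum_disjoint_indicator_of_notMem hx).symm
  have := aestronglyMeasurable_union_iff.2 ⟨h1, h2⟩
  rwa [union_compl_self, Measure.restrict_univ] at this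

theorem lintegral_enorm_tsum_indicator [Countable ι]
    (hd : Pairwise (Function.onFun Disjoint Q)) (hQ : ∀ i, MeasurableSet (Q i)) {p : ℝ}
    (hp : 0 < p) :
    ∫⁻ x, ‖∑' j, (Q j).indicator (g j) x‖ₑ ^ p ∂μ = ∑' i, ∫⁻ x in Q i, ‖g i x‖ₑ ^ p ∂μ := by
  have hsupp : Function.support (fun x => ‖∑' j, (Q j).indicator (g j) x‖ₑ ^ p) ⊆ ⋃ i, Q i := by
    intro x hx
    by_contra hn
    apply hx
    simp [tsum_disjoint_indicator_of_notMem hn, hp]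
  rw [← setLIntegral_eq_of_support_subset hsupp, lintegral_iUnion hQ hd]
  congr 1
  ext1 i
  refine setLIntegral_congr_fun (hQ i) fun x hx => ?_
  simp only [tsum_disjoint_indicator_of_mem hd hx]

theorem integral_smul_tsum_indicator [Countable ι] [NormedSpace ℝ E]
    (hd : Pairwise (Function.onFun Disjoint Q)) (hQ : ∀ i, MeasurableSet (Q i)) {c : α → ℝ}
    (hi : Integrable (fun x => c x • ∑' j, (Q j).indicator (g j) x) μ) :
    ∫ x, c x • ∑' j, (Q j).indicator (g j) x ∂μ = ∑' i, ∫ x in Q i, c x • g i x ∂μ := by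
  rw [← setIntegral_eq_integral_of_forall_compl_eq_zero (s := ⋃ i, Q i),
    integral_iUnion hQ hd hi.integrableOn]
  · congr 1
    ext1 i
    refine setIntegral_congr_fun (hQ i) fun x hx => ?_
    simp only [tsum_disjoint_indicator_of_mem hd hx]
  · intro x hx
    simp [tsum_disjoint_indicator_of_notMem hx]

end DisjointSum

/-- Countably many local modifications of a Sobolev map, on disjoint sets, can be made at once. -/
theorem SobolevMap.exists_glue {ι : Type*} [Countable ι] (hp : 1 < p)
    [IsFiniteMeasure (volume.restrict Ω)] (hΩ : MeasurableSet Ω) (u : SobolevMap Ω m p)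
    (v : ι → SobolevMap Ω m p)
    {Q : ι → Set (Space d)} (hd : Pairwise (Function.onFun Disjoint Q))
    (hQ : ∀ i, MeasurableSet (Q i)) (hQΩ : ∀ i, Q i ⊆ Ω)
    (hv : ∀ i, ∀ᵐ x ∂volume.restrict (Ω \ Q i), (v i).val x = u.val x)
    (hg : ∀ i, ∀ᵐ x ∂volume.restrict (Ω \ Q i), (v i).grad x = u.grad x)
    (hvs : ∑' i, ∫⁻ x in Q i, ‖(v i).val x - u.val x‖ₑ ^ p < ⊤)
    (hgs : ∑' i, ∫⁻ x in Q i, ‖(v i).grad x - u.grad x‖ₑ ^ p < ⊤) :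
    ∃ w : SobolevMap Ω m p, (∀ i, ∀ᵐ x ∂volume.restrict (Q i), w.val x = (v i).val x) ∧
      (∀ᵐ x ∂volume.restrict (Ω \ ⋃ i, Q i), w.val x = u.val x) ∧
      ∫⁻ x in Ω, ‖w.val x - u.val x‖ₑ ^ p = ∑' i, ∫⁻ x in Q i, ‖(v i).val x - u.val x‖ₑ ^ p := by
  have h1 : (1 : ℝ≥0∞) ≤ ENNReal.ofReal p := one_le_ofReal_of_lt hp
  -- The glued map is `u + D`: writing the corrections as one series makes the `Lᵖ` bounds sums over
  -- the pieces.
  set D : Space d → Space m :=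
    fun x => ∑' j, (Q j).indicator (fun x => (v j).val x - u.val x) x with hD
  set H : Space d → Space d →L[ℝ] Space m :=
    fun x => ∑' j, (Q j).indicator (fun x => (v j).grad x - u.grad x) x with hH
  have hres : ∀ i, (volume.restrict Ω).restrict (Q i) = volume.restrict (Q i) := fun i => by
    rw [Measure.restrict_restrict (hQ i), inter_eq_self_of_subset_left (hQΩ i)]
  have hDm : MemLp D (ENNReal.ofReal p) (volume.restrict Ω) := by
    refine ⟨aestronglyMeasurable_tsum_indicator hd hQ fun i =>
      (memLp_fun_sub (v i).memLp_val u.memLp_val).1, ?_⟩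
    rw [eLpNorm_ofReal_lt_top_iff hp, lintegral_enorm_tsum_indicator hd hQ (by linarith)]
    simpa only [hres] using hvs
  have hHm : MemLp H (ENNReal.ofReal p) (volume.restrict Ω) := by
    refine ⟨aestronglyMeasurable_tsum_indicator hd hQ fun i =>
      (memLp_fun_sub (v i).memLp_grad u.memLp_grad).1, ?_⟩
    rw [eLpNorm_ofReal_lt_top_iff hp, lintegral_enorm_tsum_indicator hd hQ (by linarith)]
    simpa only [hres] using hgs
  have hDi : IntegrableOn D Ω := hDm.integrable h1
  have hHi : IntegrableOn H Ω := hHm.integrable h1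
  -- Each `v i - u` is a Sobolev map on all of `Ω` vanishing off `Q i`, so its identity can be
  -- tested on `Q i` alone without boundary terms, and the identities are summed over `i`.
  have hw : HasWeakGradient Ω D H := by
    intro φ hφ hφs hφΩ e
    have hHe : ∀ x, H x e = ∑' j, (Q j).indicator (fun x => ((v j).grad x - u.grad x) e) x := by
      intro x
      by_cases hx : x ∈ ⋃ i, Q i
      · obtain ⟨i, hi⟩ := mem_iUnion.1 hx
        rw [hH, tsum_disjoint_indicator_of_mem hd hi]
        simp only [tsum_disjoint_indicator_of_mem hd hi]
      · rw [hH, tsum_disjoint_indicator_of_notMem hx]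
        simp only [tsum_disjoint_indicator_of_notMem hx, zero_apply]
    have hI1 := integrable_fderiv_smul hφ hφs hDi e
    have hI2 := integrable_smul_clm_apply hφ.continuous hφs hHi e
    simp only [hHe] at hI2 ⊢
    rw [integral_smul_tsum_indicator hd hQ hI1, integral_smul_tsum_indicator hd hQ hI2,
      ← tsum_neg]
    congr 1
    ext1 i
    rw [hres]
    have hwi := (v i).hasWeakGradient.sub u.hasWeakGradient ((v i).integrableOn_val hp)
      ((v i).integrableOn_grad hp) (u.integrableOn_val hp) (u.integrableOn_grad hp) φ hφ hφs hφΩ e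
    rw [setIntegral_eq_of_subset_of_ae_sdiff_eq_zero hΩ.nullMeasurableSet (hQΩ i),
      setIntegral_eq_of_subset_of_ae_sdiff_eq_zero hΩ.nullMeasurableSet (hQΩ i)] at hwi
    · exact hwi
    · have := (ae_restrict_iff' (hΩ.diff (hQ i))).1 (hg i)
      filter_upwards [this] with x hx hxm
      simp [hx hxm]
    · have := (ae_restrict_iff' (hΩ.diff (hQ i))).1 (hv i)
      filter_upwards [this] with x hx hxm
      simp [hx hxm]
  have hsv : MemLp (fun x => u.val x + D x) (ENNReal.ofReal p) (volume.restrict Ω) :=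
    memLp_fun_add u.memLp_val hDm
  have hsg : MemLp (fun x => u.grad x + H x) (ENNReal.ofReal p) (volume.restrict Ω) :=
    memLp_fun_add u.memLp_grad hHm
  obtain ⟨w, hwv, -⟩ := SobolevMap.exists_of_hasWeakGradient hsv hsg
    (u.hasWeakGradient.add hw (u.integrableOn_val hp) (u.integrableOn_grad hp) hDi hHi)
  refine ⟨w, fun i => ?_, ?_, ?_⟩
  · filter_upwards [ae_restrict_of_ae_restrict_of_subset (hQΩ i) hwv, ae_restrict_mem (hQ i)]
      with x hx hxi
    rw [hx, hD]
    simp only [tsum_disjoint_indicator_of_mem hd hxi]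
    abel
  · filter_upwards [ae_restrict_of_ae_restrict_of_subset sdiff_subset hwv,
      ae_restrict_mem (hΩ.diff (MeasurableSet.iUnion hQ))] with x hx hxi
    rw [hx, hD]
    simp only [tsum_disjoint_indicator_of_notMem hxi.2, add_zero]
  · rw [lintegral_congr_ae (g := fun x => ‖D x‖ₑ ^ p), hD,
      lintegral_enorm_tsum_indicator hd hQ (by linarith)]
    · simp only [hres]
    · filter_upwards [hwv] with x hx
      rw [hx, add_sub_cancel_left]

end SobolevMap

/-! ### Mollification: Jensen and Young inequalities, and commutation with weak gradients. -/

section Mollification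

open scoped Convolution
open ContinuousLinearMap (lsmul)

/-- Jensen's inequality for the power function and a finite measure. -/
theorem lintegral_rpow_le_measure_univ_mul {α : Type*} [MeasurableSpace α] (μ : Measure α) {p : ℝ}
    (hp : 1 < p) {h : α → ℝ≥0∞} (hh : AEMeasurable h μ) :
    (∫⁻ x, h x ∂μ) ^ p ≤ μ univ ^ (p - 1) * ∫⁻ x, h x ^ p ∂μ := by
  have hq := Real.HolderConjugate.conjExponent hp
  have h0 : 0 < p := by linarith
  have key := ENNReal.lintegral_mul_le_Lp_mul_Lq μ hq hh (aemeasurable_const (b := (1 : ℝ≥0∞)))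
  simp only [Pi.mul_apply, mul_one, ENNReal.one_rpow, lintegral_const, one_mul] at key
  calc (∫⁻ x, h x ∂μ) ^ p
      ≤ ((∫⁻ x, h x ^ p ∂μ) ^ (1 / p) * μ univ ^ (1 / p.conjExponent)) ^ p :=
        ENNReal.rpow_le_rpow key h0.le
    _ = μ univ ^ (p - 1) * ∫⁻ x, h x ^ p ∂μ := by
        rw [ENNReal.mul_rpow_of_nonneg _ _ h0.le, ← ENNReal.rpow_mul, ← ENNReal.rpow_mul,
          one_div_mul_cancel h0.ne', ENNReal.rpow_one, mul_comm]
        congr 2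
        unfold Real.conjExponent
        field_simp

variable {d m : ℕ}

theorem lintegral_ofReal_normed (φ : ContDiffBump (0 : Space d)) :
    ∫⁻ t, ENNReal.ofReal (φ.normed volume t) = 1 := by
  rw [← ofReal_integral_eq_lintegral_ofReal φ.integrable_normed (ae_of_all _ φ.nonneg_normed),
    φ.integral_normed, ENNReal.ofReal_one]

theorem measurable_ofReal_normed (φ : ContDiffBump (0 : Space d)) :
    Measurable fun t => ENNReal.ofReal (φ.normed volume t) :=
  φ.continuous_normed.measurable.ennreal_ofReal

/-- Jensen's inequality for the probability measure with density the normalized bump. -/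
theorem lintegral_normed_mul_rpow_le (φ : ContDiffBump (0 : Space d)) {p : ℝ} (hp : 1 < p)
    {h : Space d → ℝ≥0∞} (hh : AEMeasurable h) :
    (∫⁻ t, ENNReal.ofReal (φ.normed volume t) * h t) ^ p
      ≤ ∫⁻ t, ENNReal.ofReal (φ.normed volume t) * h t ^ p := by
  have hm := measurable_ofReal_normed φ
  have key := lintegral_rpow_le_measure_univ_mul
    (volume.withDensity fun t => ENNReal.ofReal (φ.normed volume t)) hp
    (hh.mono_ac (withDensity_absolutelyContinuous _ _))
  rw [lintegral_withDensity_eq_lintegral_mul₀ hm.aemeasurable hh,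
    lintegral_withDensity_eq_lintegral_mul₀ hm.aemeasurable (hh.pow_const p),
    withDensity_apply _ MeasurableSet.univ, Measure.restrict_univ, lintegral_ofReal_normed,
    ENNReal.one_rpow, one_mul] at key
  simpa only [Pi.mul_apply] using key

theorem lintegral_normed_convolution (φ : ContDiffBump (0 : Space d))
    {h : Space d → ℝ≥0∞} (hh : AEMeasurable h) :
    ∫⁻ x, ∫⁻ t, ENNReal.ofReal (φ.normed volume t) * h (x - t) = ∫⁻ x, h x := by
  have hm := measurable_ofReal_normed φ
  have hsub : AEMeasurable (fun z : Space d × Space d => h (z.1 - z.2)) (volume.prod volume) :=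
    hh.comp_quasiMeasurePreserving (quasiMeasurePreserving_sub volume volume)
  rw [lintegral_lintegral_swap ((hm.comp measurable_snd).aemeasurable.mul hsub)]
  have : ∀ t : Space d, ∫⁻ x, ENNReal.ofReal (φ.normed volume t) * h (x - t)
      = ENNReal.ofReal (φ.normed volume t) * ∫⁻ x, h x := by
    intro t
    rw [lintegral_const_mul' _ _ ENNReal.ofReal_ne_top, lintegral_sub_right_eq_self h t]
  simp only [this]
  rw [lintegral_mul_const _ hm, lintegral_ofReal_normed, one_mul]

theorem integrable_normed_smul_sub (φ : ContDiffBump (0 : Space d)) {E : Type*}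
    [NormedAddCommGroup E] [NormedSpace ℝ E] {g : Space d → E} (hg : Integrable g) (x : Space d) :
    Integrable fun t => φ.normed volume t • g (x - t) :=
  integrable_smul_of_hasCompactSupport φ.continuous_normed φ.hasCompactSupport_normed
    (hg.comp_sub_left x)

/-- The kernel has integral one, so the left side is an average of `g - c` and Jensen applies. The
free constant `c` serves for oscillations around `G x`; `c = 0` gives contraction in `Lᵖ`. -/
theorem enorm_convolution_sub_const_rpow_le (φ : ContDiffBump (0 : Space d)) {p : ℝ} (hp : 1 < p)
    {E : Type*} [NormedAddCommGroup E] [NormedSpace ℝ E] [CompleteSpace E] {g : Space d → E}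
    (hg : Integrable g) (c : E) (x : Space d) :
    ‖(φ.normed volume ⋆[lsmul ℝ ℝ, volume] g) x - c‖ₑ ^ p
      ≤ ∫⁻ t, ENNReal.ofReal (φ.normed volume t) * ‖g (x - t) - c‖ₑ ^ p := by
  have h0 : 0 < p := by linarith
  have hc : (φ.normed volume ⋆[lsmul ℝ ℝ, volume] g) x - c
      = ∫ t, φ.normed volume t • (g (x - t) - c) := by
    simp only [smul_sub]
    rw [integral_sub (integrable_normed_smul_sub φ hg x) (φ.integrable_normed.smul_const c),
      φ.integral_normed_smul volume c]
    rfl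
  have hmeas : AEMeasurable fun t => ‖g (x - t) - c‖ₑ :=
    ((hg.comp_sub_left x).aestronglyMeasurable.sub aestronglyMeasurable_const).enorm
  refine le_trans ?_ (lintegral_normed_mul_rpow_le φ hp hmeas)
  refine ENNReal.rpow_le_rpow ?_ h0.le
  rw [hc]
  refine (enorm_integral_le_lintegral_enorm _).trans_eq ?_
  congr 1
  ext1 t
  rw [enorm_smul, Real.enorm_of_nonneg (φ.nonneg_normed t)]

theorem lintegral_enorm_convolution_rpow_le (φ : ContDiffBump (0 : Space d)) {p : ℝ} (hp : 1 < p)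
    {E : Type*} [NormedAddCommGroup E] [NormedSpace ℝ E] [CompleteSpace E] {g : Space d → E}
    (hg : Integrable g) :
    ∫⁻ x, ‖(φ.normed volume ⋆[lsmul ℝ ℝ, volume] g) x‖ₑ ^ p ≤ ∫⁻ x, ‖g x‖ₑ ^ p := by
  rw [← lintegral_normed_convolution φ (hg.aestronglyMeasurable.enorm.pow_const p)]
  refine lintegral_mono fun x => ?_
  simpa using enorm_convolution_sub_const_rpow_le φ hp hg 0 x

theorem integrable_indicator_of_integrableOn {α E : Type*} [MeasurableSpace α]
    [NormedAddCommGroup E] {μ : Measure α} {s : Set α} (hs : MeasurableSet s) {f : α → E}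
    (hf : IntegrableOn f s μ) : Integrable (s.indicator f) μ :=
  (integrable_indicator_iff hs).2 hf

/-- Mollification commutes with the weak gradient, away from the boundary. -/
theorem HasWeakGradient.hasFDerivAt_convolution {Ω : Set (Space d)} (hΩ : IsOpen Ω)
    {f : Space d → Space m} {G : Space d → Space d →L[ℝ] Space m} (h : HasWeakGradient Ω f G)
    (hf : IntegrableOn f Ω) (hG : IntegrableOn G Ω) (φ : ContDiffBump (0 : Space d)) {x : Space d}
    (hx : Metric.closedBall x φ.rOut ⊆ Ω) :
    HasFDerivAt (φ.normed volume ⋆[lsmul ℝ ℝ, volume] Ω.indicator f)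
      ((φ.normed volume ⋆[lsmul ℝ ℝ, volume] Ω.indicator G) x) x := by
  have hfi : Integrable (Ω.indicator f) := integrable_indicator_of_integrableOn hΩ.measurableSet hf
  have hGi : Integrable (Ω.indicator G) := integrable_indicator_of_integrableOn hΩ.measurableSet hG
  have hη : ContDiff ℝ ∞ (φ.normed volume) := φ.contDiff_normed
  have hηs := φ.hasCompactSupport_normed (μ := (volume : Measure (Space d)))
  have key := hηs.hasFDerivAt_convolution_left (lsmul ℝ ℝ) (hη.of_le (by simp))
    hfi.locallyIntegrable x
  refine key.congr_fderiv ?_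
  ext1 e
  -- The reflected kernel is the test function: the condition on the closed ball puts its support
  -- inside `Ω`, and the reflection cancels the minus sign of the weak identity.
  set ψ : Space d → ℝ := fun y => φ.normed volume (x - y) with hψ
  have hψc : ContDiff ℝ ∞ ψ := hη.comp (contDiff_const.sub contDiff_id)
  have hψd : ∀ y, fderiv ℝ ψ y e = - fderiv ℝ (φ.normed volume) (x - y) e := by
    intro y
    have := ((hη.differentiable (by simp) (x - y)).hasFDerivAt).comp y
      ((hasFDerivAt_id y).const_sub x)
    rw [show fderiv ℝ ψ y = _ from this.fderiv]
    simp
  have hts : tsupport ψ ⊆ Metric.closedBall x φ.rOut := by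
    refine closure_minimal (fun y hy => ?_) Metric.isClosed_closedBall
    have : x - y ∈ Function.support (φ.normed (volume : Measure (Space d))) := hy
    rw [φ.support_normed_eq, mem_ball_zero_iff] at this
    rw [Metric.mem_closedBall, dist_eq_norm_sub']
    exact this.le
  have hψs : HasCompactSupport ψ :=
    (isCompact_closedBall x φ.rOut).of_isClosed_subset (isClosed_tsupport _) hts
  have hw := h ψ hψc hψs (hts.trans hx) e
  have hI1 : Integrable fun t => fderiv ℝ (φ.normed volume) t e • Ω.indicator f (x - t) :=
    integrable_fderiv_smul hη hηs (hfi.comp_sub_left x) e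
  have hI2 : Integrable fun t => (fderiv ℝ (φ.normed volume) t).smulRight
      (Ω.indicator f (x - t)) := by
    obtain ⟨C, hC⟩ := (hη.continuous_fderiv (by simp)).bounded_above_of_compact_support
      (hηs.fderiv ℝ)
    have := memLp_smulRight_of_hasCompactSupport (hη.continuous_fderiv (by simp))
      (hηs.fderiv ℝ) (memLp_one_iff_integrable.2 (hfi.comp_sub_left x))
    exact memLp_one_iff_integrable.1 this
  have e1 : ((fderiv ℝ (φ.normed volume) ⋆[(lsmul ℝ ℝ).precompL (Space d), volume]
      Ω.indicator f) x) e = ∫ t, fderiv ℝ (φ.normed volume) t e • Ω.indicator f (x - t) := by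
    have := ContinuousLinearMap.integral_apply hI2 e
    simp only [ContinuousLinearMap.smulRight_apply] at this
    rw [← this]
    congr 1
  have e2 : ((φ.normed volume ⋆[lsmul ℝ ℝ, volume] Ω.indicator G) x) e
      = ∫ t, φ.normed volume t • Ω.indicator G (x - t) e := by
    have := ContinuousLinearMap.integral_apply (integrable_normed_smul_sub φ hGi x) e
    simp only [smul_apply] at this
    rw [← this]
    rfl
  rw [e1, e2, ← integral_sub_left_eq_self _ volume x, ← integral_sub_left_eq_self
    (fun t => φ.normed volume t • Ω.indicator G (x - t) e) volume x]
  simp only [sub_sub_cancel]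
  have e3 : ∫ t, fderiv ℝ (φ.normed volume) (x - t) e • Ω.indicator f t
      = - ∫ t in Ω, fderiv ℝ ψ t e • f t := by
    rw [← integral_indicator hΩ.measurableSet, ← integral_neg]
    congr 1
    ext1 t
    by_cases ht : t ∈ Ω
    · simp [ht, hψd]
    · simp [ht]
  have e4 : ∫ t, φ.normed volume (x - t) • Ω.indicator G t e = ∫ t in Ω, ψ t • G t e := by
    rw [← integral_indicator hΩ.measurableSet]
    congr 1
    ext1 t
    by_cases ht : t ∈ Ω
    · simp [ht, hψ]
    · simp [ht]
  rw [e3, e4, hw, neg_neg]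

end Mollification

/-! ### Poincaré's inequality for maps vanishing outside a compact set. -/

section Poincare

open scoped Convolution
open ContinuousLinearMap (lsmul)

variable {d m : ℕ}

theorem enorm_sub_le_lintegral_fderiv {F : Space d → Space m}
    {D : Space d → Space d →L[ℝ] Space m} {y e : Space d} {T : ℝ} (hT : 0 ≤ T)
    (hF : ∀ t ∈ Icc 0 T, HasFDerivAt F (D (y + t • e)) (y + t • e)) (hD : Continuous D) :
    ‖F (y + T • e) - F y‖ₑ ≤ ‖e‖ₑ * ∫⁻ t in Ioc 0 T, ‖D (y + t • e)‖ₑ := by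
  have hder : ∀ t ∈ uIcc 0 T, HasDerivAt (fun t => F (y + t • e)) (D (y + t • e) e) t := by
    intro t ht
    rw [uIcc_of_le hT] at ht
    have h1 : HasDerivAt (fun t : ℝ => y + t • e) e t := by
      simpa using ((hasDerivAt_id t).smul_const e).const_add y
    exact (hF t ht).comp_hasDerivAt t h1
  have hc : Continuous fun t : ℝ => D (y + t • e) e := by fun_prop
  have key := intervalIntegral.integral_eq_sub_of_hasDerivAt hder (hc.intervalIntegrable _ _)
  simp only [zero_smul, add_zero] at key
  rw [← key, intervalIntegral.integral_of_le hT, ← lintegral_const_mul]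
  · refine (enorm_integral_le_lintegral_enorm _).trans (lintegral_mono fun t => ?_)
    rw [mul_comm]
    exact (D (y + t • e)).le_opENorm e
  · have : Continuous fun t : ℝ => D (y + t • e) := by fun_prop
    exact this.enorm.measurable

/-- Where `F y ≠ 0`, the value `F y` is minus the increment of `F` along the segment from `y` to `y
+ T e`. Jensen on that segment gives the factor `T^(p-1)`; Tonelli and translation invariance give
one more factor `T`. -/
theorem lintegral_enorm_rpow_le_of_translate_eq_zero {p : ℝ} (hp : 1 < p) {F : Space d → Space m}
    {D : Space d → Space d →L[ℝ] Space m} (hF : ∀ y, HasFDerivAt F (D y) y) (hD : Continuous D)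
    {e : Space d} (he : ‖e‖ = 1) {T : ℝ} (hT : 0 < T) (h0 : ∀ y, F y ≠ 0 → F (y + T • e) = 0) :
    ∫⁻ y, ‖F y‖ₑ ^ p ≤ ENNReal.ofReal T ^ p * ∫⁻ y, ‖D y‖ₑ ^ p := by
  have hp0 : 0 < p := by linarith
  have he' : ‖e‖ₑ = 1 := by rw [← ofReal_norm, he, ENNReal.ofReal_one]
  have hcont : Continuous fun z : Space d × ℝ => D (z.1 + z.2 • e) := by fun_prop
  have hpt : ∀ y, ‖F y‖ₑ ^ p
      ≤ ENNReal.ofReal T ^ (p - 1) * ∫⁻ t in Ioc 0 T, ‖D (y + t • e)‖ₑ ^ p := by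
    intro y
    by_cases hy : F y = 0
    · simp [hy, hp0]
    · have h1 := enorm_sub_le_lintegral_fderiv hT.le (fun t _ => hF (y + t • e)) hD
      rw [h0 y hy, zero_sub, enorm_neg, he', one_mul] at h1
      refine (ENNReal.rpow_le_rpow h1 hp0.le).trans ?_
      have hm : Continuous fun t : ℝ => D (y + t • e) := by fun_prop
      have := lintegral_rpow_le_measure_univ_mul (volume.restrict (Ioc 0 T)) hp
        (h := fun t => ‖D (y + t • e)‖ₑ) hm.enorm.measurable.aemeasurable
      simpa using this
  calc ∫⁻ y, ‖F y‖ₑ ^ p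
      ≤ ∫⁻ y, ENNReal.ofReal T ^ (p - 1) * ∫⁻ t in Ioc 0 T, ‖D (y + t • e)‖ₑ ^ p :=
        lintegral_mono hpt
    _ = ENNReal.ofReal T ^ (p - 1) * ∫⁻ t in Ioc 0 T, ∫⁻ y, ‖D (y + t • e)‖ₑ ^ p := by
        rw [lintegral_const_mul' _ _ (by
          exact ENNReal.rpow_ne_top_of_nonneg (by linarith) ENNReal.ofReal_ne_top)]
        rw [lintegral_lintegral_swap]
        exact (hcont.enorm.measurable.pow_const p).aemeasurable
    _ = ENNReal.ofReal T ^ (p - 1) * ∫⁻ t in Ioc 0 T, ∫⁻ y, ‖D y‖ₑ ^ p := by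
        congr 2
        ext1 t
        exact lintegral_add_right_eq_self (fun y => ‖D y‖ₑ ^ p) (t • e)
    _ = ENNReal.ofReal T ^ p * ∫⁻ y, ‖D y‖ₑ ^ p := by
        rw [setLIntegral_const, Real.volume_Ioc, sub_zero, mul_comm (∫⁻ y, ‖D y‖ₑ ^ p),
          ← mul_assoc]
        congr 1
        nth_rewrite 2 [← ENNReal.rpow_one (ENNReal.ofReal T)]
        rw [← ENNReal.rpow_add _ _ (by simpa using hT) ENNReal.ofReal_ne_top]
        congr 1
        ring

theorem exists_contDiff_cutoff {s t : Set (Space d)} (hs : IsOpen s) (ht : IsClosed t)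
    (h : t ⊆ s) : ∃ χ : Space d → ℝ, ContDiff ℝ ∞ χ ∧ (∀ x, χ x ∈ Icc (0 : ℝ) 1) ∧
      Function.support χ = s ∧ ∀ x ∈ t, χ x = 1 := by
  obtain ⟨f, hf, hr, hsu, h1⟩ := exists_contMDiff_support_eq_eq_one_iff
    (n := (⊤ : ℕ∞)) (modelWithCornersSelf ℝ (Space d)) hs ht h
  exact ⟨f, hf.contDiff, fun x => hr (mem_range_self x), hsu, fun x hx => (h1 x).1 hx⟩

/-- A function vanishing outside a compact subset of `Ω` may be extended by zero. -/
theorem HasWeakGradient.indicator_compact {Ω K : Set (Space d)} (hΩ : IsOpen Ω) (hK : IsCompact K)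
    (hKΩ : K ⊆ Ω) {f : Space d → Space m} {G : Space d → Space d →L[ℝ] Space m}
    (h : HasWeakGradient Ω f G)
    (hf0 : ∀ᵐ x ∂volume.restrict (Ω \ K), f x = 0)
    (hG0 : ∀ᵐ x ∂volume.restrict (Ω \ K), G x = 0) :
    HasWeakGradient univ (K.indicator f) (K.indicator G) := by
  -- Two intermediate compacts: the cut-off is one on `K₂`, a neighbourhood of `K`, so it leaves the
  -- derivative of a test function unchanged on `K`; its support lies in `K₁`, so any test function
  -- times it is admissible in `Ω`.
  obtain ⟨K₁, hK₁, hKK₁, hK₁Ω⟩ := exists_compact_between hK hΩ hKΩ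
  obtain ⟨K₂, hK₂, hKK₂, hK₂K₁⟩ := exists_compact_between hK isOpen_interior hKK₁
  obtain ⟨χ, hχ, -, hχs, hχ1⟩ := exists_contDiff_cutoff isOpen_interior hK₂.isClosed hK₂K₁
  have hts : tsupport χ ⊆ K₁ := by
    rw [tsupport, hχs]
    exact closure_minimal interior_subset hK₁.isClosed
  have hχc : HasCompactSupport χ := hK₁.of_isClosed_subset (isClosed_tsupport _) hts
  intro φ hφ hφs _ e
  have key := h (fun x => φ x * χ x) (hφ.mul hχ) hφs.mul_right
    ((tsupport_mul_subset_right).trans (hts.trans hK₁Ω)) e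
  have hd : ∀ x ∈ K, fderiv ℝ (fun x => φ x * χ x) x = fderiv ℝ φ x := by
    intro x hx
    apply Filter.EventuallyEq.fderiv_eq
    filter_upwards [mem_interior_iff_mem_nhds.1 (hKK₂ hx)] with y hy
    rw [hχ1 y hy, mul_one]
  rw [setIntegral_eq_of_subset_of_ae_sdiff_eq_zero hΩ.nullMeasurableSet hKΩ,
    setIntegral_eq_of_subset_of_ae_sdiff_eq_zero hΩ.nullMeasurableSet hKΩ] at key
  · simp only [Measure.restrict_univ]
    rw [← setIntegral_eq_integral_of_forall_compl_eq_zero (s := K),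
      ← setIntegral_eq_integral_of_forall_compl_eq_zero (s := K)
        (f := fun x => φ x • K.indicator G x e),
      setIntegral_congr_fun hK.measurableSet
        (g := fun x => fderiv ℝ (fun x => φ x * χ x) x e • f x),
      setIntegral_congr_fun hK.measurableSet (f := fun x => φ x • K.indicator G x e)
        (g := fun x => (φ x * χ x) • G x e)]
    · exact key
    · intro x hx
      simp [hx, hχ1 x (interior_subset (hKK₂ hx))]
    · intro x hx
      simp [hx, hd x hx]
    · intro x hx
      simp [hx]
    · intro x hx
      simp [hx]
  · filter_upwards [(ae_restrict_iff' (hΩ.measurableSet.diff hK.measurableSet)).1 hG0]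
      with x hx hxm
    simp [hx hxm]
  · filter_upwards [(ae_restrict_iff' (hΩ.measurableSet.diff hK.measurableSet)).1 hf0]
      with x hx hxm
    simp [hx hxm]

/-- A sequence of mollifiers shrinking to a point. -/
noncomputable def mollifier (d n : ℕ) : ContDiffBump (0 : Space d) where
  rIn := 1 / ((n : ℝ) + 1)
  rOut := 2 * (1 / ((n : ℝ) + 1))
  rIn_pos := Nat.one_div_pos_of_nat
  rIn_lt_rOut := by
    have : 0 < 1 / ((n : ℝ) + 1) := Nat.one_div_pos_of_nat
    linarith

theorem tendsto_mollifier_rOut (d : ℕ) :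
    Tendsto (fun n => (mollifier d n).rOut) atTop (𝓝 0) := by
  have := (tendsto_one_div_add_atTop_nhds_zero_nat (𝕜 := ℝ)).const_mul 2
  simpa [mollifier] using this

theorem mollifier_rOut_le (d n : ℕ) : (mollifier d n).rOut ≤ 2 * (mollifier d n).rIn := le_rfl

theorem ae_tendsto_mollifier_convolution {g : Space d → Space m} (hg : Integrable g) :
    ∀ᵐ x, Tendsto (fun n => ((mollifier d n).normed volume ⋆[lsmul ℝ ℝ, volume] g) x) atTop
      (𝓝 (g x)) :=
  ContDiffBump.ae_convolution_tendsto_right_of_locallyIntegrable (tendsto_mollifier_rOut d)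
    (Eventually.of_forall fun n => mollifier_rOut_le d n) hg.locallyIntegrable

theorem continuous_normed_convolution (φ : ContDiffBump (0 : Space d)) {E : Type*}
    [NormedAddCommGroup E] [NormedSpace ℝ E] {g : Space d → E} (hg : Integrable g) :
    Continuous (φ.normed volume ⋆[lsmul ℝ ℝ, volume] g) :=
  φ.hasCompactSupport_normed.continuous_convolution_left (lsmul ℝ ℝ)
    φ.continuous_normed hg.locallyIntegrable

/-- Poincaré's inequality for functions vanishing outside a compact subset of `Ω`. -/
theorem HasWeakGradient.poincare (hd : 1 ≤ d) {p : ℝ} (hp : 1 < p) {Ω K : Set (Space d)}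
    (hΩ : IsOpen Ω) (hK : IsCompact K)
    (hKΩ : K ⊆ Ω) {f : Space d → Space m} {G : Space d → Space d →L[ℝ] Space m}
    (h : HasWeakGradient Ω f G) (hf : IntegrableOn f Ω) (hG : IntegrableOn G Ω)
    (hf0 : ∀ᵐ x ∂volume.restrict (Ω \ K), f x = 0)
    (hG0 : ∀ᵐ x ∂volume.restrict (Ω \ K), G x = 0) {T₀ T : ℝ} (hT₀ : 0 ≤ T₀) (hT : T₀ < T)
    (hKT : ∀ x ∈ K, ∀ y ∈ K, dist x y ≤ T₀) :
    ∫⁻ x in K, ‖f x‖ₑ ^ p ≤ ENNReal.ofReal T ^ p * ∫⁻ x in K, ‖G x‖ₑ ^ p := by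
  have hp0 : 0 < p := by linarith
  have hw := h.indicator_compact hΩ hK hKΩ hf0 hG0
  have hfi := integrable_indicator_of_integrableOn hK.measurableSet (hf.mono_set hKΩ)
  have hGi := integrable_indicator_of_integrableOn hK.measurableSet (hG.mono_set hKΩ)
  obtain ⟨e, he⟩ : ∃ e : Space d, ‖e‖ = 1 := ⟨EuclideanSpace.single ⟨0, hd⟩ 1, by simp⟩
  have hmain : ∀ᶠ n in atTop,
      ∫⁻ y, ‖((mollifier d n).normed volume ⋆[lsmul ℝ ℝ, volume] K.indicator f) y‖ₑ ^ p
        ≤ ENNReal.ofReal T ^ p * ∫⁻ x in K, ‖G x‖ₑ ^ p := by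
    have hev : ∀ᶠ n in atTop, (mollifier d n).rOut < (T - T₀) / 2 :=
      (tendsto_mollifier_rOut d).eventually (gt_mem_nhds (by linarith))
    filter_upwards [hev] with n hn
    have hder : ∀ y, HasFDerivAt
        ((mollifier d n).normed volume ⋆[lsmul ℝ ℝ, volume] K.indicator f)
        (((mollifier d n).normed volume ⋆[lsmul ℝ ℝ, volume] K.indicator G) y) y := by
      intro y
      have := hw.hasFDerivAt_convolution isOpen_univ hfi.integrableOn hGi.integrableOn
        (mollifier d n) (x := y) (subset_univ _)
      simpa only [indicator_univ] using this
    have hsupp : ∀ y, ((mollifier d n).normed volume ⋆[lsmul ℝ ℝ, volume] K.indicator f) y ≠ 0 →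
        ∃ k ∈ K, dist y k < (mollifier d n).rOut := by
      intro y hy
      have := support_convolution_subset_swap (lsmul ℝ ℝ) hy
      obtain ⟨k, hk, s, hs, rfl⟩ := this
      rw [(mollifier d n).support_normed_eq, mem_ball_zero_iff] at hs
      refine ⟨k, ?_, by simpa [dist_eq_norm] using hs⟩
      by_contra hkK
      exact hk (indicator_of_notMem hkK f)
    -- The mollified map lives within distance `rOut` of `K`, a set of diameter at most `T₀ + 2 rOut
    -- < T`; a translation of length `T` therefore leaves it. The gap between `T₀` and `T` exists
    -- for this purpose.
    have h0 := lintegral_enorm_rpow_le_of_translate_eq_zero hp hder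
      (continuous_normed_convolution _ hGi) he (hT₀.trans_lt hT) (fun y hy => by
        by_contra hy2
        obtain ⟨k, hk, hyk⟩ := hsupp y hy
        obtain ⟨k', hk', hyk'⟩ := hsupp _ hy2
        have h1 : dist y (y + T • e) = T := by
          rw [dist_eq_norm, sub_add_cancel_left, norm_neg, norm_smul, he, mul_one,
            Real.norm_of_nonneg (hT₀.trans hT.le)]
        have h2 := dist_triangle4 y k k' (y + T • e)
        rw [dist_comm k' (y + T • e)] at h2
        linarith [hKT k hk k' hk'])
    refine h0.trans (mul_le_mul' le_rfl ?_)
    refine (lintegral_enorm_convolution_rpow_le _ hp hGi).trans_eq ?_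
    rw [← lintegral_indicator hK.measurableSet]
    congr 1
    ext1 x
    by_cases hx : x ∈ K <;> simp [hx, hp0]
  calc ∫⁻ x in K, ‖f x‖ₑ ^ p = ∫⁻ x, ‖K.indicator f x‖ₑ ^ p := by
        rw [← lintegral_indicator hK.measurableSet]
        congr 1
        ext1 x
        by_cases hx : x ∈ K <;> simp [hx, hp0]
    _ = ∫⁻ x, liminf (fun n => ‖((mollifier d n).normed volume ⋆[lsmul ℝ ℝ, volume]
          K.indicator f) x‖ₑ ^ p) atTop := by
        refine lintegral_congr_ae ?_
        filter_upwards [ae_tendsto_mollifier_convolution hfi] with x hx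
        exact (((ENNReal.continuous_rpow_const (y := p)).tendsto _).comp
          hx.enorm).liminf_eq.symm
    _ ≤ liminf (fun n => ∫⁻ x, ‖((mollifier d n).normed volume ⋆[lsmul ℝ ℝ, volume]
          K.indicator f) x‖ₑ ^ p) atTop :=
        lintegral_liminf_le fun n =>
          (continuous_normed_convolution _ hfi).enorm.measurable.pow_const p
    _ ≤ ENNReal.ofReal T ^ p * ∫⁻ x in K, ‖G x‖ₑ ^ p :=
        liminf_le_of_frequently_le' hmain.frequently

end Poincare

/-! ### Taylor estimates in the mean, uniform in the mollification. -/

section Differentiability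

open scoped Convolution
open ContinuousLinearMap (lsmul)

variable {d m : ℕ}

theorem volume_ball_eq_ofReal_pow (x : Space d) {r : ℝ} (hr : 0 < r) :
    volume (Metric.ball x r) = ENNReal.ofReal r ^ d * volume (Metric.ball (0 : Space d) 1) := by
  rw [Measure.addHaar_ball_of_pos _ x hr, finrank_euclideanSpace_fin, ENNReal.ofReal_pow hr.le]

/-- The average of a mollified function over a small ball is controlled by its averages at
comparable scales, whatever the mollification parameter. -/
theorem lintegral_ball_normed_convolution_le {φ : ContDiffBump (0 : Space d)}
    (hφ : φ.rOut ≤ 2 * φ.rIn) {g : Space d → ℝ≥0∞} (hg : AEMeasurable g) {x : Space d} {W : ℝ≥0∞}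
    {R : ℝ} (hgR : ∀ s, 0 < s → s ≤ 2 * R →
      ∫⁻ y in Metric.ball x s, g y ≤ W * ENNReal.ofReal s ^ d)
    (hφR : φ.rOut ≤ R) {s : ℝ} (hs : 0 < s) (hsR : s ≤ R) :
    ∫⁻ z in Metric.ball x s, ∫⁻ t, ENNReal.ofReal (φ.normed volume t) * g (z - t)
      ≤ 4 ^ d * W * ENNReal.ofReal s ^ d := by
  have hloc : ∀ τ, s ≤ τ → φ.rOut ≤ τ → ∀ z ∈ Metric.ball x s, ∀ t,
      ENNReal.ofReal (φ.normed volume t) * g (z - t) ≤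
        ENNReal.ofReal (φ.normed volume t) * (Metric.ball x (2 * τ)).indicator g (z - t) := by
    intro τ h1 h2 z hz t
    by_cases ht : t ∈ Metric.ball (0 : Space d) φ.rOut
    · rw [indicator_of_mem]
      rw [mem_ball_zero_iff] at ht
      rw [Metric.mem_ball, dist_eq_norm] at hz ⊢
      have : z - t - x = (z - x) - t := by abel
      rw [this]
      linarith [norm_sub_le (z - x) t]
    · rw [← φ.support_normed_eq (μ := volume), Function.notMem_support] at ht
      simp [ht]
  have h4 : (2 : ℝ≥0∞) ^ d * 2 ^ d = 4 ^ d := by rw [← mul_pow]; norm_num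
  -- If the kernel is narrower than the ball, mass conservation on the ball of radius `2 s`
  -- suffices. If it is wider, the kernel is at most `2^d` divided by the volume of its support
  -- ball, and averaging over the ball of radius `2 rOut` bounds the convolution pointwise; each
  -- doubling costs a factor `2^d`.
  rcases le_total φ.rOut s with hcase | hcase
  · calc ∫⁻ z in Metric.ball x s, ∫⁻ t, ENNReal.ofReal (φ.normed volume t) * g (z - t)
        ≤ ∫⁻ z in Metric.ball x s, ∫⁻ t, ENNReal.ofReal (φ.normed volume t) *
            (Metric.ball x (2 * s)).indicator g (z - t) :=
          setLIntegral_mono' Metric.isOpen_ball.measurableSet fun z hz =>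
            lintegral_mono (hloc s le_rfl hcase z hz)
      _ ≤ ∫⁻ z, ∫⁻ t, ENNReal.ofReal (φ.normed volume t) *
            (Metric.ball x (2 * s)).indicator g (z - t) := setLIntegral_le_lintegral _ _
      _ = ∫⁻ y in Metric.ball x (2 * s), g y := by
          rw [lintegral_normed_convolution φ
            (hg.indicator Metric.isOpen_ball.measurableSet),
            lintegral_indicator Metric.isOpen_ball.measurableSet]
      _ ≤ W * ENNReal.ofReal (2 * s) ^ d := hgR _ (by linarith) (by linarith)
      _ = 2 ^ d * W * ENNReal.ofReal s ^ d := by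
          rw [ENNReal.ofReal_mul zero_le_two, mul_pow, ENNReal.ofReal_ofNat]
          ring
      _ ≤ 4 ^ d * W * ENNReal.ofReal s ^ d := by gcongr; norm_num
  · set δ := φ.rOut with hδ
    have hδ0 : 0 < δ := φ.rOut_pos
    set κ := volume (Metric.ball (0 : Space d) 1) with hκ
    have hκ0 : κ ≠ 0 := (Metric.measure_ball_pos volume _ one_pos).ne'
    have hκt : κ ≠ ⊤ := measure_ball_lt_top.ne
    have hδd : ENNReal.ofReal δ ^ d ≠ 0 := pow_ne_zero _ (by simpa using hδ0)
    have hδdt : ENNReal.ofReal δ ^ d ≠ ⊤ := ENNReal.pow_ne_top ENNReal.ofReal_ne_top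
    have hη : ∀ t, ENNReal.ofReal (φ.normed volume t) * (ENNReal.ofReal δ ^ d * κ) ≤ 2 ^ d := by
      intro t
      have h1 := φ.normed_le_div_measure_closedBall_rOut volume 2 hφ t
      rw [finrank_euclideanSpace_fin] at h1
      have hpos : 0 < volume.real (Metric.closedBall (0 : Space d) φ.rOut) :=
        ENNReal.toReal_pos (Metric.measure_closedBall_pos _ _ hδ0).ne' measure_closedBall_lt_top.ne
      rw [le_div_iff₀ hpos] at h1
      have h2 := ENNReal.ofReal_le_ofReal h1
      rw [ENNReal.ofReal_mul (φ.nonneg_normed t), ENNReal.ofReal_pow zero_le_two,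
        ENNReal.ofReal_ofNat, measureReal_def,
        ENNReal.ofReal_toReal measure_closedBall_lt_top.ne,
        Measure.addHaar_closedBall _ _ hδ0.le, finrank_euclideanSpace_fin,
        ENNReal.ofReal_pow hδ0.le] at h2
      exact h2
    have hη' : ∀ t, ENNReal.ofReal (φ.normed volume t) ≤ 2 ^ d / (ENNReal.ofReal δ ^ d * κ) :=
      fun t => (ENNReal.le_div_iff_mul_le (Or.inl (mul_ne_zero hδd hκ0))
        (Or.inl (ENNReal.mul_ne_top hδdt hκt))).2 (hη t)
    have hin : ∀ z ∈ Metric.ball x s,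
        ∫⁻ t, ENNReal.ofReal (φ.normed volume t) * g (z - t) ≤ 4 ^ d * W / κ := by
      intro z hz
      calc ∫⁻ t, ENNReal.ofReal (φ.normed volume t) * g (z - t)
          ≤ ∫⁻ t, 2 ^ d / (ENNReal.ofReal δ ^ d * κ) *
            (Metric.ball x (2 * δ)).indicator g (z - t) :=
            lintegral_mono fun t => (hloc δ hcase le_rfl z hz t).trans
              (mul_le_mul' (hη' t) le_rfl)
        _ = 2 ^ d / (ENNReal.ofReal δ ^ d * κ) * ∫⁻ y in Metric.ball x (2 * δ), g y := by
            rw [lintegral_const_mul' _ _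
              (ENNReal.div_ne_top (by simp) (mul_ne_zero hδd hκ0)),
              lintegral_sub_left_eq_self (fun y => (Metric.ball x (2 * δ)).indicator g y) z,
              lintegral_indicator Metric.isOpen_ball.measurableSet]
        _ ≤ 2 ^ d / (ENNReal.ofReal δ ^ d * κ) * (W * ENNReal.ofReal (2 * δ) ^ d) :=
            mul_le_mul' le_rfl (hgR _ (by linarith) (by linarith))
        _ = 4 ^ d * W / κ := by
            rw [ENNReal.ofReal_mul zero_le_two, mul_pow, ENNReal.ofReal_ofNat, ← h4,
              ENNReal.div_eq_inv_mul, ENNReal.div_eq_inv_mul,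
              ENNReal.mul_inv (Or.inl hδd) (Or.inl hδdt)]
            calc (ENNReal.ofReal δ ^ d)⁻¹ * κ⁻¹ * 2 ^ d * (W * (2 ^ d * ENNReal.ofReal δ ^ d))
                = ((ENNReal.ofReal δ ^ d)⁻¹ * ENNReal.ofReal δ ^ d) *
                  (κ⁻¹ * (2 ^ d * 2 ^ d * W)) := by ring
              _ = _ := by rw [ENNReal.inv_mul_cancel hδd hδdt, one_mul]
    calc ∫⁻ z in Metric.ball x s, ∫⁻ t, ENNReal.ofReal (φ.normed volume t) * g (z - t)
        ≤ ∫⁻ z in Metric.ball x s, 4 ^ d * W / κ :=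
          setLIntegral_mono' Metric.isOpen_ball.measurableSet hin
      _ = 4 ^ d * W / κ * (ENNReal.ofReal s ^ d * κ) := by
          rw [setLIntegral_const, volume_ball_eq_ofReal_pow x hs]
      _ = 4 ^ d * W * ENNReal.ofReal s ^ d := by
          rw [mul_comm (ENNReal.ofReal s ^ d), ← mul_assoc, ENNReal.div_mul_cancel hκ0 hκt]

theorem lintegral_ball_homothety {h : Space d → ℝ≥0∞} (x : Space d) {t r : ℝ} (ht : 0 < t) :
    ENNReal.ofReal t ^ d * ∫⁻ y in Metric.ball x r, h (x + t • (y - x))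
      = ∫⁻ z in Metric.ball x (t * r), h z := by
  have hmap := Measure.map_addHaar_smul (volume : Measure (Space d)) ht.ne'
  rw [finrank_euclideanSpace_fin] at hmap
  have hE : MeasurableEmbedding fun y : Space d => t • y :=
    (Homeomorph.smulOfNeZero t ht.ne').measurableEmbedding
  rw [← lintegral_indicator Metric.isOpen_ball.measurableSet,
    ← lintegral_indicator Metric.isOpen_ball.measurableSet,
    ← lintegral_add_left_eq_self _ x,
    ← lintegral_add_left_eq_self (fun z => (Metric.ball x (t * r)).indicator h z) x]
  set k : Space d → ℝ≥0∞ := fun z => (Metric.ball x (t * r)).indicator h (x + z) with hk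
  have h1 : ∀ y, (Metric.ball x r).indicator (fun y => h (x + t • (y - x))) (x + y)
      = k (t • y) := by
    intro y
    have : x + y ∈ Metric.ball x r ↔ x + t • y ∈ Metric.ball x (t * r) := by
      simp only [Metric.mem_ball, dist_self_add_left, norm_smul, Real.norm_of_nonneg ht.le]
      exact (mul_lt_mul_iff_right₀ ht).symm
    by_cases hy : x + y ∈ Metric.ball x r
    · simp only [hk, indicator_of_mem hy, indicator_of_mem (this.1 hy), add_sub_cancel_left]
    · simp only [hk, indicator_of_notMem hy, indicator_of_notMem (fun h => hy (this.2 h))]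
  simp only [h1]
  rw [← hE.lintegral_map (μ := volume) k, hmap, lintegral_smul_measure, smul_eq_mul, ← mul_assoc,
    ← ENNReal.ofReal_pow ht.le, ← ENNReal.ofReal_mul (by positivity), abs_of_nonneg (by positivity),
    mul_inv_cancel₀ (by positivity), ENNReal.ofReal_one, one_mul]

/-- The remainder is the integral of `D - A` along rays from `x`. After Jensen and Tonelli, the
homothety of ratio `t` carries the integral at time `t` to the ball of radius `t r`, where the bound
`C (t r)^d` cancels the Jacobian `t^d`. This is why the oscillation must be controlled at all scales
below `r`. -/
theorem lintegral_ball_taylor_le {p : ℝ} (hp : 1 < p) {F : Space d → Space m}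
    {D : Space d → Space d →L[ℝ] Space m} {x : Space d} {r : ℝ} (hr : 0 < r)
    (hF : ∀ y ∈ Metric.ball x r, HasFDerivAt F (D y) y) (hD : Continuous D)
    (A : Space d →L[ℝ] Space m) {C : ℝ≥0∞}
    (hC : ∀ s, 0 < s → s ≤ r →
      ∫⁻ z in Metric.ball x s, ‖D z - A‖ₑ ^ p ≤ C * ENNReal.ofReal s ^ d) :
    ∫⁻ y in Metric.ball x r, ‖F y - F x - A (y - x)‖ₑ ^ p
      ≤ C * (ENNReal.ofReal r ^ d * ENNReal.ofReal r ^ p) := by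
  have hp0 : 0 < p := by linarith
  have hpt : ∀ y ∈ Metric.ball x r, ‖F y - F x - A (y - x)‖ₑ ^ p
      ≤ ENNReal.ofReal r ^ p * ∫⁻ t in Ioc (0 : ℝ) 1, ‖D (x + t • (y - x)) - A‖ₑ ^ p := by
    intro y hy
    have hder : ∀ t ∈ Icc (0 : ℝ) 1, HasFDerivAt (fun z => F z - A z)
        (D (x + t • (y - x)) - A) (x + t • (y - x)) := by
      intro t ht
      refine (hF _ ?_).sub A.hasFDerivAt
      rw [Metric.mem_ball, dist_self_add_left, norm_smul, Real.norm_of_nonneg ht.1]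
      rw [Metric.mem_ball, dist_eq_norm] at hy
      nlinarith [ht.2, norm_nonneg (y - x)]
    have h1 := enorm_sub_le_lintegral_fderiv (F := fun z => F z - A z) (D := fun z => D z - A)
      (y := x) (e := y - x) zero_le_one hder (hD.sub continuous_const)
    have h2 : F (x + (1 : ℝ) • (y - x)) - A (x + (1 : ℝ) • (y - x)) - (F x - A x)
        = F y - F x - A (y - x) := by
      rw [one_smul, add_sub_cancel, map_sub]
      abel
    rw [h2] at h1
    have h3 : ‖y - x‖ₑ ≤ ENNReal.ofReal r := by
      rw [← ofReal_norm]
      rw [Metric.mem_ball, dist_eq_norm] at hy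
      exact ENNReal.ofReal_le_ofReal hy.le
    have hm : Continuous fun t : ℝ => D (x + t • (y - x)) - A := by fun_prop
    have h4 := lintegral_rpow_le_measure_univ_mul (volume.restrict (Ioc (0 : ℝ) 1)) hp
        (h := fun t => ‖D (x + t • (y - x)) - A‖ₑ) hm.enorm.measurable.aemeasurable
    calc ‖F y - F x - A (y - x)‖ₑ ^ p
        ≤ (ENNReal.ofReal r * ∫⁻ t in Ioc (0 : ℝ) 1, ‖D (x + t • (y - x)) - A‖ₑ) ^ p :=
          ENNReal.rpow_le_rpow (h1.trans (mul_le_mul' h3 le_rfl)) hp0.le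
      _ = ENNReal.ofReal r ^ p * (∫⁻ t in Ioc (0 : ℝ) 1, ‖D (x + t • (y - x)) - A‖ₑ) ^ p :=
          ENNReal.mul_rpow_of_nonneg _ _ hp0.le
      _ ≤ _ := mul_le_mul' le_rfl (by simpa using h4)
  have hcont : Continuous fun z : Space d × ℝ => D (x + z.2 • (z.1 - x)) - A := by fun_prop
  calc ∫⁻ y in Metric.ball x r, ‖F y - F x - A (y - x)‖ₑ ^ p
      ≤ ∫⁻ y in Metric.ball x r, ENNReal.ofReal r ^ p *
          ∫⁻ t in Ioc (0 : ℝ) 1, ‖D (x + t • (y - x)) - A‖ₑ ^ p :=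
        setLIntegral_mono' Metric.isOpen_ball.measurableSet hpt
    _ = ENNReal.ofReal r ^ p * ∫⁻ t in Ioc (0 : ℝ) 1,
          ∫⁻ y in Metric.ball x r, ‖D (x + t • (y - x)) - A‖ₑ ^ p := by
        rw [lintegral_const_mul' _ _
          (ENNReal.rpow_ne_top_of_nonneg hp0.le ENNReal.ofReal_ne_top)]
        rw [lintegral_lintegral_swap]
        exact (hcont.enorm.measurable.pow_const p).aemeasurable
    _ ≤ ENNReal.ofReal r ^ p * ∫⁻ t in Ioc (0 : ℝ) 1, C * ENNReal.ofReal r ^ d := by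
        refine mul_le_mul' le_rfl (setLIntegral_mono' measurableSet_Ioc fun t ht => ?_)
        have hto : ENNReal.ofReal t ^ d ≠ 0 := pow_ne_zero _ (by simpa using ht.1)
        have htt : ENNReal.ofReal t ^ d ≠ ⊤ := ENNReal.pow_ne_top ENNReal.ofReal_ne_top
        rw [← ENNReal.mul_le_mul_iff_right hto htt, lintegral_ball_homothety
          (h := fun z => ‖D z - A‖ₑ ^ p) x ht.1]
        refine (hC _ (mul_pos ht.1 hr) (by nlinarith [ht.2])).trans_eq ?_
        rw [ENNReal.ofReal_mul ht.1.le, mul_pow]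
        ring
    _ = C * (ENNReal.ofReal r ^ d * ENNReal.ofReal r ^ p) := by
        simp only [lintegral_const, MeasurableSet.univ, Measure.restrict_apply, univ_inter,
          Real.volume_Ioc, sub_zero, ENNReal.ofReal_one, mul_one]
        ring

end Differentiability

/-! ### Lebesgue points and differentiability in `Lᵖ`. -/

section LebesguePoints

open scoped Convolution
open ContinuousLinearMap (lsmul)

variable {d m : ℕ}

theorem enorm_add_rpow_le {E : Type*} [NormedAddCommGroup E] {p : ℝ} (hp : 1 < p) (a b : E) :
    ‖a + b‖ₑ ^ p ≤ 2 ^ (p - 1) * (‖a‖ₑ ^ p + ‖b‖ₑ ^ p) := by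
  have hp0 : 0 < p := by linarith
  exact (ENNReal.rpow_le_rpow (enorm_add_le a b) hp0.le).trans
    (ENNReal.rpow_add_le_mul_rpow_add_rpow _ _ hp.le)

theorem ae_tendsto_lintegral_sub_const {E : Type*} [NormedAddCommGroup E] {p : ℝ} (hp : 1 < p)
    {Ω : Set (Space d)} (hΩ : IsOpen Ω) [IsFiniteMeasure (volume.restrict Ω)] {g : Space d → E}
    (hg : MemLp g (ENNReal.ofReal p) (volume.restrict Ω)) (c : E) :
    ∀ᵐ x ∂volume.restrict Ω, Tendsto (fun s => (∫⁻ y in Metric.closedBall x s, ‖g y - c‖ₑ ^ p) /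
      volume (Metric.closedBall x s)) (𝓝[>] (0 : ℝ)) (𝓝 (‖g x - c‖ₑ ^ p)) := by
  have hgc : MemLp (fun y => g y - c) (ENNReal.ofReal p) (volume.restrict Ω) :=
    memLp_fun_sub hg (memLp_const c)
  have hm : AEMeasurable (Ω.indicator fun y => ‖g y - c‖ₑ ^ p) := by
    rw [aemeasurable_indicator_iff hΩ.measurableSet]
    exact hgc.1.enorm.pow_const p
  have hfin : ∫⁻ y, Ω.indicator (fun y => ‖g y - c‖ₑ ^ p) y ≠ ⊤ := by
    rw [lintegral_indicator hΩ.measurableSet]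
    exact ((eLpNorm_ofReal_lt_top_iff hp _).1 hgc.2).ne
  have key := (Besicovitch.vitaliFamily (volume : Measure (Space d))).ae_tendsto_lintegral_div
    hm hfin
  rw [ae_restrict_iff' hΩ.measurableSet]
  filter_upwards [key] with x hx hxΩ
  have h1 := hx.comp (Besicovitch.tendsto_filterAt volume x)
  rw [indicator_of_mem hxΩ] at h1
  refine h1.congr' ?_
  obtain ⟨ε, hε, hball⟩ := Metric.nhds_basis_closedBall.mem_iff.1 (hΩ.mem_nhds hxΩ)
  filter_upwards [Ioc_mem_nhdsGT hε] with s hs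
  simp only [Function.comp]
  congr 1
  refine setLIntegral_congr_fun Metric.isClosed_closedBall.measurableSet fun y hy => ?_
  exact indicator_of_mem (hball (Metric.closedBall_subset_closedBall hs.2 hy)) _

/-- The differentiation theorem is applied to `‖g - c‖ᵖ` for `c` in a countable dense set, which
keeps a single null set; then `c` is taken close to `g x`. -/
theorem ae_tendsto_lintegral_sub_self {E : Type*} [NormedAddCommGroup E]
    [TopologicalSpace.SeparableSpace E] {p : ℝ} (hp : 1 < p)
    {Ω : Set (Space d)} (hΩ : IsOpen Ω) [IsFiniteMeasure (volume.restrict Ω)] {g : Space d → E}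
    (hg : MemLp g (ENNReal.ofReal p) (volume.restrict Ω)) :
    ∀ᵐ x ∂volume.restrict Ω, Tendsto (fun s => (∫⁻ y in Metric.closedBall x s, ‖g y - g x‖ₑ ^ p) /
      volume (Metric.closedBall x s)) (𝓝[>] (0 : ℝ)) (𝓝 0) := by
  have hp0 : 0 < p := by linarith
  have hall : ∀ᵐ x ∂volume.restrict Ω, ∀ n, Tendsto
      (fun s => (∫⁻ y in Metric.closedBall x s, ‖g y - TopologicalSpace.denseSeq E n‖ₑ ^ p) /
      volume (Metric.closedBall x s)) (𝓝[>] (0 : ℝ))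
      (𝓝 (‖g x - TopologicalSpace.denseSeq E n‖ₑ ^ p)) :=
    ae_all_iff.2 fun n => ae_tendsto_lintegral_sub_const hp hΩ hg _
  filter_upwards [hall] with x hx
  rw [ENNReal.tendsto_nhds_zero]
  intro ε hε
  have hcont : Tendsto (fun c => (2 : ℝ≥0∞) ^ (p - 1) * (‖g x - c‖ₑ ^ p + ‖g x - c‖ₑ ^ p))
      (𝓝 (g x)) (𝓝 0) := by
    have h1 : Tendsto (fun c => ‖g x - c‖ₑ ^ p) (𝓝 (g x)) (𝓝 0) := by
      have : Continuous fun c => ‖g x - c‖ₑ ^ p :=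
        (ENNReal.continuous_rpow_const).comp (continuous_const.sub continuous_id).enorm
      simpa [hp0] using this.tendsto (g x)
    simpa using ENNReal.Tendsto.const_mul (h1.add h1) (Or.inr (by simp : (2 : ℝ≥0∞) ^ (p - 1) ≠ ⊤))
  obtain ⟨n, hn⟩ : ∃ n, 2 ^ (p - 1) * (‖g x - TopologicalSpace.denseSeq E n‖ₑ ^ p +
      ‖g x - TopologicalSpace.denseSeq E n‖ₑ ^ p) < ε := by
    have hnhds := hcont.eventually (gt_mem_nhds hε)
    obtain ⟨y, hy2, hy1⟩ := (TopologicalSpace.denseRange_denseSeq E).inter_nhds_nonempty hnhds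
    obtain ⟨n, hn⟩ := hy2
    exact ⟨n, hn ▸ hy1⟩
  set c := TopologicalSpace.denseSeq E n with hc
  have hlim : Tendsto (fun s => 2 ^ (p - 1) *
      ((∫⁻ y in Metric.closedBall x s, ‖g y - c‖ₑ ^ p) / volume (Metric.closedBall x s) +
        ‖g x - c‖ₑ ^ p)) (𝓝[>] (0 : ℝ))
      (𝓝 (2 ^ (p - 1) * (‖g x - c‖ₑ ^ p + ‖g x - c‖ₑ ^ p))) :=
    ENNReal.Tendsto.const_mul ((hx n).add tendsto_const_nhds)
      (Or.inr (by simp : (2 : ℝ≥0∞) ^ (p - 1) ≠ ⊤))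
  filter_upwards [hlim.eventually (gt_mem_nhds hn), self_mem_nhdsWithin] with s hs hs0
  refine le_trans ?_ hs.le
  have hv0 : volume (Metric.closedBall x s) ≠ 0 := (Metric.measure_closedBall_pos _ _ hs0).ne'
  have hvt : volume (Metric.closedBall x s) ≠ ⊤ := measure_closedBall_lt_top.ne
  rw [ENNReal.div_le_iff hv0 hvt, mul_assoc, add_mul, ENNReal.div_mul_cancel hv0 hvt,
    ← setLIntegral_const, ← lintegral_add_right _ measurable_const,
    ← lintegral_const_mul' _ _ (by simp : (2 : ℝ≥0∞) ^ (p - 1) ≠ ⊤)]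
  refine lintegral_mono fun y => ?_
  have := enorm_add_rpow_le hp (g y - c) (c - g x)
  rwa [sub_add_sub_cancel, enorm_sub_rev c] at this

/-- Sobolev functions are `Lᵖ`-differentiable almost everywhere. -/
theorem HasWeakGradient.ae_tendsto_lintegral_taylor {p : ℝ} (hp : 1 < p)
    {Ω : Set (Space d)} (hΩ : IsOpen Ω) [IsFiniteMeasure (volume.restrict Ω)]
    {f : Space d → Space m} {G : Space d → Space d →L[ℝ] Space m} (h : HasWeakGradient Ω f G)
    (hf : MemLp f (ENNReal.ofReal p) (volume.restrict Ω))
    (hG : MemLp G (ENNReal.ofReal p) (volume.restrict Ω)) :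
    ∀ᵐ x ∂volume.restrict Ω, Tendsto (fun r => (∫⁻ y in Metric.ball x r,
      ‖f y - f x - G x (y - x)‖ₑ ^ p) / (ENNReal.ofReal r ^ d * ENNReal.ofReal r ^ p))
      (𝓝[>] (0 : ℝ)) (𝓝 0) := by
  have hp0 : 0 < p := by linarith
  have hfi : IntegrableOn f Ω := hf.integrable (one_le_ofReal_of_lt hp)
  have hGi : IntegrableOn G Ω := hG.integrable (one_le_ofReal_of_lt hp)
  have hfI := integrable_indicator_of_integrableOn hΩ.measurableSet hfi
  have hGI := integrable_indicator_of_integrableOn hΩ.measurableSet hGi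
  have : ProperSpace (Space d →L[ℝ] Space m) := FiniteDimensional.proper ℝ _
  have hconv := ae_tendsto_mollifier_convolution hfI
  filter_upwards [ae_tendsto_lintegral_sub_self hp hΩ hG, ae_restrict_of_ae hconv,
    ae_restrict_mem hΩ.measurableSet] with x hx hxc hxΩ
  rw [indicator_of_mem hxΩ] at hxc
  set κ := volume (Metric.ball (0 : Space d) 1) with hκ
  have hκ0 : κ ≠ 0 := (Metric.measure_ball_pos volume _ one_pos).ne'
  have hκt : κ ≠ ⊤ := measure_ball_lt_top.ne
  rw [ENNReal.tendsto_nhds_zero]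
  intro ε hε
  obtain ⟨W, hW0, hW⟩ : ∃ W : ℝ≥0∞, 0 < W ∧ 4 ^ d * (W * κ) ≤ ε := by
    refine ⟨ε / (4 ^ d * κ), ENNReal.div_pos hε.ne' (ENNReal.mul_ne_top (by simp) hκt), ?_⟩
    rw [mul_left_comm, ENNReal.div_mul_cancel (mul_ne_zero (by simp) hκ0)
      (ENNReal.mul_ne_top (by simp) hκt)]
  obtain ⟨ε₁, hε₁, hball⟩ := Metric.nhds_basis_ball.mem_iff.1 (hΩ.mem_nhds hxΩ)
  obtain ⟨ε₂, hε₂, hsmall⟩ := mem_nhdsGT_iff_exists_Ioc_subset.1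
    (ENNReal.tendsto_nhds_zero.1 hx W hW0)
  set g : Space d → ℝ≥0∞ := fun y => ‖Ω.indicator G y - G x‖ₑ ^ p with hg
  have hgm : AEMeasurable g :=
    (hGI.aestronglyMeasurable.sub aestronglyMeasurable_const).enorm.pow_const p
  -- A quarter leaves room for a radius up to `R`, a mollification of radius below `R`, and the
  -- doubling of balls.
  have hR0 : 0 < min ε₁ ε₂ / 4 := div_pos (lt_min hε₁ hε₂) four_pos
  set R := min ε₁ ε₂ / 4 with hR
  have hR1 : 4 * R ≤ ε₁ := by rw [hR]; linarith [min_le_left ε₁ ε₂]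
  have hR2 : 4 * R ≤ ε₂ := by rw [hR]; linarith [min_le_right ε₁ ε₂]
  have hgR : ∀ s, 0 < s → s ≤ 2 * R →
      ∫⁻ y in Metric.ball x s, g y ≤ W * κ * ENNReal.ofReal s ^ d := by
    intro s hs hsR
    have h1 : (∫⁻ y in Metric.closedBall x s, ‖G y - G x‖ₑ ^ p) /
      volume (Metric.closedBall x s) ≤ W := hsmall ⟨hs, by linarith⟩
    have hv0 : volume (Metric.closedBall x s) ≠ 0 := (Metric.measure_closedBall_pos _ _ hs).ne'
    have hvt : volume (Metric.closedBall x s) ≠ ⊤ := measure_closedBall_lt_top.ne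
    rw [ENNReal.div_le_iff hv0 hvt, Measure.addHaar_closedBall _ _ hs.le,
      finrank_euclideanSpace_fin, ENNReal.ofReal_pow hs.le] at h1
    calc ∫⁻ y in Metric.ball x s, g y = ∫⁻ y in Metric.ball x s, ‖G y - G x‖ₑ ^ p := by
          refine setLIntegral_congr_fun Metric.isOpen_ball.measurableSet fun y hy => ?_
          simp only [hg]
          rw [indicator_of_mem (hball (Metric.ball_subset_ball (by linarith) hy))]
      _ ≤ ∫⁻ y in Metric.closedBall x s, ‖G y - G x‖ₑ ^ p :=
          lintegral_mono_set Metric.ball_subset_closedBall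
      _ ≤ _ := h1.trans_eq (by rw [← hκ]; ring)
  filter_upwards [Ioc_mem_nhdsGT hR0] with r hr
  have hr0 : ENNReal.ofReal r ≠ 0 := by simpa using hr.1
  have hrd0 : ENNReal.ofReal r ^ d * ENNReal.ofReal r ^ p ≠ 0 :=
    mul_ne_zero (pow_ne_zero _ hr0) (by simp [ENNReal.rpow_eq_zero_iff, hr.1])
  have hrdt : ENNReal.ofReal r ^ d * ENNReal.ofReal r ^ p ≠ ⊤ :=
    ENNReal.mul_ne_top (ENNReal.pow_ne_top ENNReal.ofReal_ne_top)
      (ENNReal.rpow_ne_top_of_nonneg hp0.le ENNReal.ofReal_ne_top)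
  rw [ENNReal.div_le_iff hrd0 hrdt]
  set F : ℕ → Space d → Space m :=
    fun n => (mollifier d n).normed volume ⋆[lsmul ℝ ℝ, volume] Ω.indicator f with hF
  have hFc : ∀ n, Continuous (F n) := fun n => continuous_normed_convolution _ hfI
  -- The bound holds for the smooth `F n` with a constant independent of `n`, so Fatou transfers it
  -- to `f`. This also uses convergence of `F n` at the centre `x` itself.
  have hmain : ∀ᶠ n in atTop, ∫⁻ y in Metric.ball x r, ‖F n y - F n x - G x (y - x)‖ₑ ^ p
      ≤ ε * (ENNReal.ofReal r ^ d * ENNReal.ofReal r ^ p) := by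
    have hev : ∀ᶠ n in atTop, (mollifier d n).rOut < R :=
      (tendsto_mollifier_rOut d).eventually (gt_mem_nhds hR0)
    filter_upwards [hev] with n hn
    refine (lintegral_ball_taylor_le hp hr.1 (D := (mollifier d n).normed volume
      ⋆[lsmul ℝ ℝ, volume] Ω.indicator G) (C := 4 ^ d * (W * κ)) (fun y hy => ?_)
      (continuous_normed_convolution _ hGI) (G x) fun s hs hsr => ?_).trans
      (mul_le_mul' hW le_rfl)
    · refine h.hasFDerivAt_convolution hΩ hfi hGi _ fun z hz => hball ?_
      rw [Metric.mem_closedBall] at hz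
      rw [Metric.mem_ball] at hy ⊢
      linarith [dist_triangle z y x, hr.2]
    · refine le_trans (lintegral_mono fun z => ?_) (lintegral_ball_normed_convolution_le
        (mollifier_rOut_le d n) hgm hgR hn.le hs (hsr.trans hr.2))
      exact enorm_convolution_sub_const_rpow_le _ hp hGI (G x) z
  calc ∫⁻ y in Metric.ball x r, ‖f y - f x - G x (y - x)‖ₑ ^ p
      = ∫⁻ y in Metric.ball x r, liminf (fun n => ‖F n y - F n x - G x (y - x)‖ₑ ^ p) atTop := by
        refine lintegral_congr_ae ?_
        filter_upwards [ae_restrict_of_ae hconv, ae_restrict_mem Metric.isOpen_ball.measurableSet]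
          with y hy hyb
        rw [indicator_of_mem (hball (Metric.ball_subset_ball (by linarith [hr.2]) hyb))] at hy
        exact (((ENNReal.continuous_rpow_const (y := p)).tendsto _).comp
          ((hy.sub hxc).sub_const (G x (y - x))).enorm).liminf_eq.symm
    _ ≤ liminf (fun n => ∫⁻ y in Metric.ball x r, ‖F n y - F n x - G x (y - x)‖ₑ ^ p) atTop := by
        refine lintegral_liminf_le fun n => ?_
        have : Continuous fun y => F n y - F n x - G x (y - x) := by
          have := hFc n
          fun_prop
        exact this.enorm.measurable.pow_const p
    _ ≤ _ := liminf_le_of_frequently_le' hmain.frequently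

end LebesguePoints

/-! ### Cubes: volumes, differentiation, Vitali coverings, cut-offs. -/

section Cubes

variable {d : ℕ}

/-- The closed cube `x + ρ [-1/2,1/2]ᵈ`. -/
def closedCube (x : Space d) (ρ : ℝ) : Set (Space d) := {y | ∀ i, |y i - x i| ≤ ρ / 2}

theorem openCube_subset_closedCube (x : Space d) (ρ : ℝ) : openCube x ρ ⊆ closedCube x ρ :=
  fun _ hy i => (hy i).le

theorem isOpen_openCube (x : Space d) (ρ : ℝ) : IsOpen (openCube x ρ) := by
  have : openCube x ρ = ⋂ i, {y : Space d | |y i - x i| < ρ / 2} := by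
    ext y; simp [openCube]
  rw [this]
  exact isOpen_iInter_of_finite fun i => isOpen_lt (by fun_prop) continuous_const

theorem isClosed_closedCube (x : Space d) (ρ : ℝ) : IsClosed (closedCube x ρ) := by
  have : closedCube x ρ = ⋂ i, {y : Space d | |y i - x i| ≤ ρ / 2} := by
    ext y; simp [closedCube]
  rw [this]
  exact isClosed_iInter fun i => isClosed_le (by fun_prop) continuous_const

theorem volume_openCube (x : Space d) {ρ : ℝ} (hρ : 0 ≤ ρ) :
    volume (openCube x ρ) = ENNReal.ofReal (ρ ^ d) := by
  have h : openCube x ρ = (WithLp.ofLp : Space d → Fin d → ℝ) ⁻¹'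
      (Set.pi univ fun i => Ioo (x i - ρ / 2) (x i + ρ / 2)) := by
    ext y
    simp only [openCube, mem_ofPred_eq, mem_preimage, Set.mem_pi, mem_univ, forall_const, mem_Ioo,
      abs_lt]
    refine forall_congr' fun i => ⟨fun h => ⟨?_, ?_⟩, fun h => ⟨?_, ?_⟩⟩ <;> linarith [h.1, h.2]
  rw [h, (PiLp.volume_preserving_ofLp (Fin d)).measure_preimage
    (MeasurableSet.univ_pi fun i => measurableSet_Ioo).nullMeasurableSet, Real.volume_pi_Ioo]
  simp only [add_sub_sub_cancel, add_halves, Finset.prod_const, Finset.card_univ, Fintype.card_fin]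
  rw [ENNReal.ofReal_pow hρ]

theorem volume_closedCube (x : Space d) {ρ : ℝ} (hρ : 0 ≤ ρ) :
    volume (closedCube x ρ) = ENNReal.ofReal (ρ ^ d) := by
  have h : closedCube x ρ = (WithLp.ofLp : Space d → Fin d → ℝ) ⁻¹'
      (Icc (fun i => x i - ρ / 2) (fun i => x i + ρ / 2)) := by
    ext y
    simp only [closedCube, mem_ofPred_eq, mem_preimage, mem_Icc, Pi.le_def, abs_le, ← forall_and]
    refine forall_congr' fun i => ⟨fun h => ⟨?_, ?_⟩, fun h => ⟨?_, ?_⟩⟩ <;> linarith [h.1, h.2]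
  rw [h, (PiLp.volume_preserving_ofLp (Fin d)).measure_preimage
    measurableSet_Icc.nullMeasurableSet, Real.volume_Icc_pi]
  simp only [add_sub_sub_cancel, add_halves, Finset.prod_const, Finset.card_univ, Fintype.card_fin]
  rw [ENNReal.ofReal_pow hρ]

theorem volume_closedCube_diff_openCube (x : Space d) {ρ : ℝ} (hρ : 0 ≤ ρ) :
    volume (closedCube x ρ \ openCube x ρ) = 0 := by
  rw [measure_sdiff (openCube_subset_closedCube x ρ) (isOpen_openCube x ρ).nullMeasurableSet
    (by rw [volume_openCube x hρ]; exact ENNReal.ofReal_ne_top), volume_openCube x hρ,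
    volume_closedCube x hρ, tsub_self]

theorem openCube_ae_eq_closedCube (x : Space d) {ρ : ℝ} (hρ : 0 ≤ ρ) :
    openCube x ρ =ᵐ[volume] closedCube x ρ := by
  refine Filter.EventuallyLE.antisymm (openCube_subset_closedCube x ρ).eventuallyLE ?_
  exact ae_le_set.2 (volume_closedCube_diff_openCube x hρ)

theorem dist_le_of_mem_closedCube {x y : Space d} {ρ : ℝ} (hρ : 0 ≤ ρ) (hy : y ∈ closedCube x ρ) :
    dist y x ≤ d * (ρ / 2) := by
  rw [EuclideanSpace.dist_eq]
  refine Real.sqrt_le_iff.2 ⟨by positivity, ?_⟩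
  calc ∑ i, dist (y i) (x i) ^ 2 ≤ ∑ _i : Fin d, (ρ / 2) ^ 2 := by
        refine Finset.sum_le_sum fun i _ => ?_
        rw [Real.dist_eq]
        exact pow_le_pow_left₀ (abs_nonneg _) (hy i) 2
    _ = d * (ρ / 2) ^ 2 := by simp
    _ ≤ (d * (ρ / 2)) ^ 2 := by
        rw [mul_pow]
        gcongr
        exact_mod_cast Nat.le_self_pow two_ne_zero d

theorem isCompact_closedCube (x : Space d) {ρ : ℝ} (hρ : 0 ≤ ρ) : IsCompact (closedCube x ρ) :=
  (isCompact_closedBall x (d * (ρ / 2))).of_isClosed_subset (isClosed_closedCube x ρ)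
    fun _ hy => dist_le_of_mem_closedCube hρ hy

theorem openCube_mono {x : Space d} {r s : ℝ} (h : r ≤ s) : openCube x r ⊆ openCube x s :=
  fun _ hy i => (hy i).trans_le (by linarith)

theorem closedCube_subset_openCube {x : Space d} {r s : ℝ} (h : r < s) :
    closedCube x r ⊆ openCube x s := fun _ hy i => (hy i).trans_lt (by linarith)

theorem openCube_subset_openCube_of_dist {x y : Space d} {r s : ℝ} (h : r + 2 * dist y x ≤ s) :
    openCube y r ⊆ openCube x s := by
  intro z hz i
  have h1 := hz i
  have h2 : |y i - x i| ≤ dist y x := by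
    rw [dist_eq_norm]; exact PiLp.norm_apply_le (y - x) i
  have h3 := abs_sub_le (z i) (y i) (x i)
  linarith

/-- A closed cube of edge `ρ` lies in a ball of radius `dρ/2` whose threefold dilation has volume at
most `(3d/2)^d κ ρ^d`, so cubes qualify for the Vitali family of a doubling measure. The constant
`C` is a sum so as to dominate both this ratio and the doubling constant `3^d`. -/
theorem exists_cubeFamily (d : ℕ) : ∃ v : VitaliFamily (volume : Measure (Space d)),
    (∀ x (ρ : ℝ), 0 < ρ → closedCube x ρ ∈ v.setsAt x) ∧
    ∀ x, Tendsto (fun ρ => closedCube x ρ) (𝓝[>] (0 : ℝ)) (v.filterAt x) := by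
  set κ := volume (Metric.ball (0 : Space d) 1) with hκ
  have hκt : κ ≠ ⊤ := measure_ball_lt_top.ne
  set C : NNReal := 3 ^ d + (ENNReal.ofReal (3 * d / 2) ^ d * κ).toNNReal with hC
  have hCle : ENNReal.ofReal (3 * d / 2) ^ d * κ ≤ C := by
    rw [hC, ENNReal.coe_add, ENNReal.coe_toNNReal
      (ENNReal.mul_ne_top (ENNReal.pow_ne_top ENNReal.ofReal_ne_top) hκt)]
    exact le_add_self
  have hC3 : (3 : ℝ≥0∞) ^ d ≤ C := by
    rw [hC, ENNReal.coe_add]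
    push_cast
    exact le_self_add
  have hdoub : ∀ x : Space d, ∃ᶠ r in 𝓝[>] (0 : ℝ),
      volume (Metric.closedBall x (3 * r)) ≤ C * volume (Metric.closedBall x r) := by
    intro x
    refine Eventually.frequently ?_
    filter_upwards [self_mem_nhdsWithin] with r hr
    have hr : 0 < r := hr
    rw [Measure.addHaar_closedBall _ _ hr.le, Measure.addHaar_closedBall _ _ (by positivity),
      finrank_euclideanSpace_fin, mul_pow, ENNReal.ofReal_mul (by positivity), mul_assoc,
      ENNReal.ofReal_pow zero_le_three, ENNReal.ofReal_ofNat]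
    gcongr
  have hmem : ∀ x (ρ : ℝ), 0 < ρ → closedCube x ρ ∈ (Vitali.vitaliFamily volume C hdoub).setsAt x := by
    intro x ρ hρ
    refine ⟨isClosed_closedCube x ρ, ⟨x, ?_⟩, d * (ρ / 2), fun y hy =>
      dist_le_of_mem_closedCube hρ.le hy, ?_⟩
    · refine interior_maximal (openCube_subset_closedCube x ρ) (isOpen_openCube x ρ) ?_
      intro i
      simpa using hρ
    · rw [Measure.addHaar_closedBall _ _ (by positivity), volume_closedCube x hρ.le,
        finrank_euclideanSpace_fin]
      have : 3 * (d * (ρ / 2)) = 3 * d / 2 * ρ := by ring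
      rw [this, mul_pow, ENNReal.ofReal_mul (by positivity), ENNReal.ofReal_pow (by positivity),
        mul_right_comm]
      gcongr
  refine ⟨_, hmem, fun x => ?_⟩
  rw [VitaliFamily.tendsto_filterAt_iff]
  constructor
  · filter_upwards [self_mem_nhdsWithin] with ρ hρ using hmem x ρ hρ
  · intro ε hε
    have : Tendsto (fun ρ : ℝ => d * (ρ / 2)) (𝓝[>] 0) (𝓝 0) := by
      have h : Continuous fun ρ : ℝ => d * (ρ / 2) := by fun_prop
      simpa using (h.tendsto 0).mono_left nhdsWithin_le_nhds
    filter_upwards [this.eventually (gt_mem_nhds hε), self_mem_nhdsWithin] with ρ h1 h2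
    exact fun y hy => (dist_le_of_mem_closedCube (le_of_lt h2) hy).trans h1.le

theorem setLIntegral_openCube_eq (f : Space d → ℝ≥0∞) (x : Space d) {ρ : ℝ} (hρ : 0 ≤ ρ) :
    ∫⁻ y in openCube x ρ, f y = ∫⁻ y in closedCube x ρ, f y :=
  setLIntegral_congr (openCube_ae_eq_closedCube x hρ)

/-- Lebesgue's differentiation theorem along centred cubes. -/
theorem ae_tendsto_lintegral_openCube_div {f : Space d → ℝ≥0∞} (hf : AEMeasurable f)
    (hfi : ∫⁻ x, f x ≠ ⊤) :
    ∀ᵐ x, Tendsto (fun ρ : ℝ => (∫⁻ y in openCube x ρ, f y) / ENNReal.ofReal (ρ ^ d)) (𝓝[>] 0)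
      (𝓝 (f x)) := by
  obtain ⟨v, -, hv⟩ := exists_cubeFamily d
  filter_upwards [v.ae_tendsto_lintegral_div hf hfi] with x hx
  refine (hx.comp (hv x)).congr' ?_
  filter_upwards [self_mem_nhdsWithin] with ρ hρ
  have hρ : 0 < ρ := hρ
  simp only [Function.comp, volume_closedCube x hρ.le, setLIntegral_openCube_eq f x hρ.le]

theorem ae_tendsto_measure_openCube_div (μ : Measure (Space d)) [IsFiniteMeasure μ]
    (hμ : μ ≪ volume) :
    ∀ᵐ x, Tendsto (fun ρ : ℝ => μ (openCube x ρ) / ENNReal.ofReal (ρ ^ d)) (𝓝[>] 0)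
      (𝓝 (μ.rnDeriv volume x)) := by
  have h1 : ∫⁻ x, μ.rnDeriv volume x ≠ ⊤ := by
    rw [Measure.lintegral_rnDeriv hμ]; exact measure_ne_top _ _
  filter_upwards [ae_tendsto_lintegral_openCube_div (Measure.measurable_rnDeriv μ volume).aemeasurable
    h1] with x hx
  simpa only [Measure.setLIntegral_rnDeriv hμ] using hx

/-- Vitali covering of an open set by small disjoint cubes satisfying a property which holds at
almost every point for all small cubes. -/
theorem exists_disjoint_openCube_covering {O : Set (Space d)} (hO : IsOpen O)
    {P : Space d → ℝ → Prop} (hP : ∀ᵐ x ∂volume.restrict O, ∀ᶠ ρ in 𝓝[>] (0 : ℝ), P x ρ)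
    {η : ℝ} (hη : 0 < η) :
    ∃ t : Set (Space d × ℝ), t.Countable ∧ (∀ c ∈ t, 0 < c.2 ∧ c.2 < η ∧ closedCube c.1 c.2 ⊆ O ∧
      P c.1 c.2) ∧ Pairwise (Function.onFun Disjoint fun c : t => openCube c.1.1 c.1.2) ∧
      volume (O \ ⋃ c : t, openCube c.1.1 c.1.2) = 0 := by
  obtain ⟨v, hv, hvt⟩ := exists_cubeFamily d
  set s : Set (Space d) := {x | x ∈ O ∧ ∀ᶠ ρ in 𝓝[>] (0 : ℝ), P x ρ} with hs
  set F : Space d → Set (Set (Space d)) := fun x =>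
    {a | ∃ ρ : ℝ, a = closedCube x ρ ∧ 0 < ρ ∧ ρ < η ∧ closedCube x ρ ⊆ O ∧ P x ρ} with hF
  have hfine : v.FineSubfamilyOn F s := by
    refine v.fineSubfamilyOn_of_frequently F s fun x hx => ?_
    refine (hvt x).frequently (Eventually.frequently ?_)
    have hsub : ∀ᶠ ρ in 𝓝[>] (0 : ℝ), closedCube x ρ ⊆ O := by
      obtain ⟨ε, hε, hball⟩ := Metric.nhds_basis_closedBall.mem_iff.1 (hO.mem_nhds hx.1)
      have := (VitaliFamily.tendsto_filterAt_iff v).1 (hvt x) |>.2 ε hε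
      filter_upwards [this] with ρ hρ using hρ.trans hball
    filter_upwards [hx.2, hsub, Ioo_mem_nhdsGT hη] with ρ h1 h2 h3
    exact ⟨ρ, rfl, h3.1, h3.2, h2, h1⟩
  have hmem : ∀ q ∈ hfine.index, ∃ ρ : ℝ, q.2 = closedCube q.1 ρ ∧ 0 < ρ ∧ ρ < η ∧
      closedCube q.1 ρ ⊆ O ∧ P q.1 ρ := fun q hq => hfine.covering_mem hq
  -- The covering theorem returns sets only; the edge length is recovered by choice.
  choose! rad hrad using hmem
  have hcov : ∀ q ∈ hfine.index, openCube q.1 (rad q) ⊆ hfine.covering q := fun q hq =>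
    (openCube_subset_closedCube _ _).trans_eq (hrad q hq).1.symm
  refine ⟨(fun q => (q.1, rad q)) '' hfine.index, hfine.index_countable.image _, ?_, ?_, ?_⟩
  · rintro _ ⟨q, hq, rfl⟩
    exact (hrad q hq).2
  · rintro ⟨_, q, hq, rfl⟩ ⟨_, q', hq', rfl⟩ hne
    have hqq : q ≠ q' := by rintro rfl; exact hne rfl
    exact (hfine.covering_disjoint hq hq' hqq).mono (hcov q hq) (hcov q' hq')
  · have h1 : volume (O \ s) = 0 := by
      have := (ae_restrict_iff' hO.measurableSet).1 hP
      refine measure_mono_null ?_ (ae_iff.1 this)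
      intro x hx
      simp only [mem_ofPred_eq]
      intro h
      exact hx.2 ⟨hx.1, h hx.1⟩
    -- The covering consists of closed cubes; passing to their interiors loses only countably many
    -- null boundaries.
    have h2 : volume (⋃ q ∈ hfine.index, (closedCube q.1 (rad q) \ openCube q.1 (rad q))) = 0 :=
      (measure_biUnion_null_iff hfine.index_countable).2 fun q hq =>
        volume_closedCube_diff_openCube _ (hrad q hq).2.1.le
    refine measure_mono_null ?_ (measure_union_null (measure_union_null h1
      hfine.measure_sdiff_biUnion) h2)
    intro x hx
    by_cases hxs : x ∈ s
    · by_cases hxu : x ∈ ⋃ q ∈ hfine.index, hfine.covering q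
      · right
        obtain ⟨q, hq, hxq⟩ := mem_iUnion₂.1 hxu
        refine mem_iUnion₂.2 ⟨q, hq, (hrad q hq).1 ▸ hxq, fun hxo => hx.2 ?_⟩
        exact mem_iUnion.2 ⟨⟨_, q, hq, rfl⟩, hxo⟩
      · exact Or.inl (Or.inr ⟨hxs, hxu⟩)
    · exact Or.inl (Or.inl ⟨hx.1, hxs⟩)

/-- Smooth cut-off functions between concentric cubes, with the natural bound of the gradient. -/
theorem exists_cube_cutoff {σ : ℝ} (hσ : σ < 1) : ∃ N : ℝ, 0 ≤ N ∧
    ∀ (x : Space d) (ρ : ℝ), 0 < ρ → ∃ χ : Space d → ℝ, ContDiff ℝ ∞ χ ∧ HasCompactSupport χ ∧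
      (∀ y, χ y ∈ Icc (0 : ℝ) 1) ∧ (∀ y ∈ openCube x (σ * ρ), χ y = 1) ∧
      (∀ y ∉ openCube x ρ, χ y = 0) ∧ ∀ y, ‖fderiv ℝ χ y‖ ≤ N / ρ := by
  -- One cut-off on the unit cube is rescaled to all others, which makes `N` independent of the
  -- centre and of the edge.
  obtain ⟨χ, hχ, hχI, hχs, hχ1⟩ := exists_contDiff_cutoff (isOpen_openCube (0 : Space d) 1)
    (isClosed_closedCube 0 σ) (closedCube_subset_openCube hσ)
  have hc : HasCompactSupport χ := by
    refine (isCompact_closedCube (0 : Space d) zero_le_one).of_isClosed_subset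
      (isClosed_tsupport _) (closure_minimal ?_ (isClosed_closedCube 0 1))
    rw [hχs]
    exact openCube_subset_closedCube 0 1
  obtain ⟨N, hN⟩ := (hχ.continuous_fderiv (by simp)).bounded_above_of_compact_support (hc.fderiv ℝ)
  refine ⟨N, (norm_nonneg _).trans (hN 0), fun x ρ hρ => ?_⟩
  have hscale : ∀ y i, |(ρ⁻¹ • (y - x)) i - (0 : Space d) i| = ρ⁻¹ * |y i - x i| := by
    intro y i
    simp [abs_mul, abs_of_pos hρ]
  refine ⟨fun y => χ (ρ⁻¹ • (y - x)), ?_, ?_, fun y => hχI _, fun y hy => hχ1 _ fun i => ?_,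
    fun y hy => ?_, fun y => ?_⟩
  · exact hχ.comp ((contDiff_id.sub contDiff_const).const_smul ρ⁻¹)
  · exact hc.comp_homeomorph ((Homeomorph.subRight x).trans
      (Homeomorph.smulOfNeZero ρ⁻¹ (inv_ne_zero hρ.ne')))
  · rw [hscale, inv_mul_le_iff₀ hρ]
    have := hy i
    linarith
  · rw [← Function.notMem_support, hχs]
    intro h
    refine hy fun i => ?_
    have := h i
    rw [hscale, inv_mul_lt_iff₀ hρ] at this
    linarith
  · have h1 : HasFDerivAt (fun y => ρ⁻¹ • (y - x)) (ρ⁻¹ • ContinuousLinearMap.id ℝ (Space d)) y :=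
      ((hasFDerivAt_id y).sub_const x).const_smul ρ⁻¹
    have h2 := ((hχ.differentiable (by simp) (ρ⁻¹ • (y - x))).hasFDerivAt).comp y h1
    rw [show fderiv ℝ (fun y => χ (ρ⁻¹ • (y - x))) y = _ from h2.fderiv]
    rw [ContinuousLinearMap.comp_smul, ContinuousLinearMap.comp_id, norm_smul, norm_inv,
      Real.norm_of_nonneg hρ.le, inv_mul_eq_div]
    gcongr
    exact hN _

end Cubes

/-! ### Dirichlet infima: additivity, interpolation across layers, fundamental estimate. -/

section Functionals

variable {d m : ℕ} {Ω : Set (Space d)} {p α : ℝ} {Φ : SobolevMap Ω m p → Set (Space d) → ℝ≥0∞}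

/-- The growth bound for the Dirichlet infima of a single functional, without quotients. -/
def DirichletGrowth (Φ : SobolevMap Ω m p → Set (Space d) → ℝ≥0∞) (b : ℝ≥0∞)
    (ν : Measure (Space d)) : Prop :=
  ∀ V : Set (Space d), IsOpen V → V ⊆ Ω → ∀ w : SobolevMap Ω m p,
    dirichletInf Φ w.val V ≤ b * (ν V + (∫⁻ x in V, ‖w.val x‖ₑ ^ p) + ∫⁻ x in V, ‖w.grad x‖ₑ ^ p)

theorem dirichletInf_le {w : Space d → Space m} {V : Set (Space d)} {v : SobolevMap Ω m p}
    (h : ∀ᵐ x ∂volume.restrict (Ω \ V), v.val x = w x) : dirichletInf Φ w V ≤ Φ v V :=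
  iInf₂_le v h

theorem exists_lt_of_dirichletInf_lt {w : Space d → Space m} {V : Set (Space d)} {c : ℝ≥0∞}
    (h : dirichletInf Φ w V < c) :
    ∃ v : SobolevMap Ω m p, (∀ᵐ x ∂volume.restrict (Ω \ V), v.val x = w x) ∧ Φ v V < c := by
  simpa only [dirichletInf, iInf_lt_iff, exists_prop] using h

/-- Allows the affine datum to be exchanged for a Sobolev map that represents it in `Ω`. -/
theorem dirichletInf_congr {w₁ w₂ : Space d → Space m} (V : Set (Space d))
    (h : w₁ =ᵐ[volume.restrict Ω] w₂) : dirichletInf Φ w₁ V = dirichletInf Φ w₂ V := by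
  have h' : ∀ᵐ x ∂volume.restrict (Ω \ V), w₁ x = w₂ x :=
    ae_restrict_of_ae_restrict_of_subset sdiff_subset h
  unfold dirichletInf
  refine iInf_congr fun v => iInf_congr_Prop ⟨fun hv => ?_, fun hv => ?_⟩ fun _ => rfl
  · filter_upwards [hv, h'] with x h1 h2 using h1.trans h2
  · filter_upwards [hv, h'] with x h1 h2 using h1.trans h2.symm

namespace CoerciveLocal

theorem mono (h : CoerciveLocal α Φ) (v : SobolevMap Ω m p) {A B : Set (Space d)}
    (hA : IsOpen A) (hB : IsOpen B) (hAB : A ⊆ B) (hBΩ : B ⊆ Ω) : Φ v A ≤ Φ v B := by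
  obtain ⟨μ, -, hμ⟩ := h.isMeasure v
  rw [hμ A hA (hAB.trans hBΩ), hμ B hB hBΩ]
  exact measure_mono hAB

/-- Absolute continuity of the measure behind `Φ v` discards the uncovered null set, in practice
faces of cubes. -/
theorem eq_tsum (h : CoerciveLocal α Φ) (v : SobolevMap Ω m p) {ι : Type*} [Countable ι]
    {B : Set (Space d)} (hB : IsOpen B) (hBΩ : B ⊆ Ω) {Q : ι → Set (Space d)}
    (hQ : ∀ i, IsOpen (Q i)) (hQB : ∀ i, Q i ⊆ B) (hd : Pairwise (Function.onFun Disjoint Q))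
    (h0 : volume (B \ ⋃ i, Q i) = 0) : Φ v B = ∑' i, Φ v (Q i) := by
  obtain ⟨μ, hac, hμ⟩ := h.isMeasure v
  have h1 : μ (B \ ⋃ i, Q i) = 0 := hac
    (le_antisymm ((Measure.restrict_apply_le _ _).trans h0.le) zero_le)
  rw [hμ B hB hBΩ, tsum_congr fun i => hμ (Q i) (hQ i) ((hQB i).trans hBΩ),
    ← measure_iUnion hd fun i => (hQ i).measurableSet]
  refine le_antisymm ?_ (measure_mono (iUnion_subset hQB))
  calc μ B ≤ μ ((B \ ⋃ i, Q i) ∪ ⋃ i, Q i) := measure_mono (by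
        intro x hx
        by_cases hxu : x ∈ ⋃ i, Q i
        · exact Or.inr hxu
        · exact Or.inl ⟨hx, hxu⟩)
    _ ≤ μ (B \ ⋃ i, Q i) + μ (⋃ i, Q i) := measure_union_le _ _
    _ = μ (⋃ i, Q i) := by rw [h1, zero_add]

theorem tsum_le (h : CoerciveLocal α Φ) (v : SobolevMap Ω m p) {ι : Type*} [Countable ι]
    {B : Set (Space d)} (hB : IsOpen B) (hBΩ : B ⊆ Ω) {Q : ι → Set (Space d)}
    (hQ : ∀ i, IsOpen (Q i)) (hQB : ∀ i, Q i ⊆ B) (hd : Pairwise (Function.onFun Disjoint Q)) :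
    ∑' i, Φ v (Q i) ≤ Φ v B := by
  obtain ⟨μ, hac, hμ⟩ := h.isMeasure v
  rw [hμ B hB hBΩ, tsum_congr fun i => hμ (Q i) (hQ i) ((hQB i).trans hBΩ),
    ← measure_iUnion hd fun i => (hQ i).measurableSet]
  exact measure_mono (iUnion_subset hQB)

theorem eq_add (h : CoerciveLocal α Φ) (v : SobolevMap Ω m p) {A L B : Set (Space d)}
    (hA : IsOpen A) (hL : IsOpen L) (hB : IsOpen B) (hAB : A ⊆ B) (hLB : L ⊆ B) (hBΩ : B ⊆ Ω)
    (hd : Disjoint A L) (h0 : volume (B \ (A ∪ L)) = 0) : Φ v B = Φ v A + Φ v L := by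
  rw [h.eq_tsum v hB hBΩ (Q := fun i : Bool => cond i A L) (by rintro (_ | _) <;> assumption)
    (by rintro (_ | _) <;> assumption) (pairwise_disjoint_on_bool.2 hd)
    (by rwa [← union_eq_iUnion]), tsum_bool, add_comm]
  rfl

/-- Almost subadditivity of the Dirichlet infima. -/
theorem dirichletInf_le_add (h : CoerciveLocal α Φ) {A L B : Set (Space d)}
    (hA : IsOpen A) (hL : IsOpen L) (hB : IsOpen B) (hAB : A ⊆ B) (hLB : L ⊆ B) (hBΩ : B ⊆ Ω)
    (hd : Disjoint A L) (h0 : volume (B \ (A ∪ L)) = 0) {v₁ w : SobolevMap Ω m p}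
    {f : Space d → Space m} (h1 : ∀ᵐ x ∂volume.restrict A, w.val x = v₁.val x)
    (h2 : ∀ᵐ x ∂volume.restrict (Ω \ B), w.val x = f x) :
    dirichletInf Φ f B ≤ Φ v₁ A + dirichletInf Φ w.val L := by
  conv_rhs => rw [dirichletInf]
  simp only [ENNReal.add_iInf]
  -- A competitor for `w` on `L` agrees with `w` off `L`, hence with `v₁` on `A` and with `f`
  -- outside `B`. It thus competes on `B`, and its energy there splits over `A` and `L`.
  refine le_iInf₂ fun v hv => ?_
  have hAL : A ⊆ Ω \ L := fun x hx => ⟨hBΩ (hAB hx), fun hxL => disjoint_left.1 hd hx hxL⟩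
  have hBL : Ω \ B ⊆ Ω \ L := sdiff_subset_sdiff_right hLB
  have hvA : ∀ᵐ x ∂volume.restrict A, v.val x = v₁.val x := by
    filter_upwards [ae_restrict_of_ae_restrict_of_subset hAL hv, h1] with x hx hx'
      using hx.trans hx'
  have hvB : ∀ᵐ x ∂volume.restrict (Ω \ B), v.val x = f x := by
    filter_upwards [ae_restrict_of_ae_restrict_of_subset hBL hv, h2] with x hx hx'
      using hx.trans hx'
  refine (dirichletInf_le hvB).trans_eq ?_
  rw [h.eq_add v hA hL hB hAB hLB hBΩ hd h0, h.isLocal A hA (hAB.trans hBΩ) v v₁ hvA]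

end CoerciveLocal

/-- The error in replacing `v₁` by `v₂` across the layer `L`, by means of a cut-off function
whose gradient is bounded by `k`. -/
noncomputable def layerError (ν : Measure (Space d)) (u : SobolevMap Ω m p) (k : ℝ≥0∞)
    (L : Set (Space d)) (v₁ v₂ : SobolevMap Ω m p) : ℝ≥0∞ :=
  4 ^ p * (ν L + (∫⁻ x in L, ‖u.val x‖ₑ ^ p) + (∫⁻ x in L, ‖v₁.grad x‖ₑ ^ p) +
    (∫⁻ x in L, ‖v₂.grad x‖ₑ ^ p) + (1 + k ^ p) * ((∫⁻ x in L, ‖v₁.val x - u.val x‖ₑ ^ p) +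
      ∫⁻ x in L, ‖v₂.val x - u.val x‖ₑ ^ p))

theorem ENNReal.add_four_rpow_le (hp : 0 < p) (a b c e : ℝ≥0∞) :
    (a + b + c + e) ^ p ≤ 4 ^ p * (a ^ p + b ^ p + c ^ p + e ^ p) := by
  set M := max (max a b) (max c e) with hM
  have h1 : a + b + c + e ≤ 4 * M := by
    have ha : a ≤ M := (le_max_left _ _).trans (le_max_left _ _)
    have hb : b ≤ M := (le_max_right _ _).trans (le_max_left _ _)
    have hc : c ≤ M := (le_max_left _ _).trans (le_max_right _ _)
    have he : e ≤ M := (le_max_right _ _).trans (le_max_right _ _)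
    calc a + b + c + e ≤ M + M + M + M := by gcongr
      _ = 4 * M := by ring
  have h2 : M ^ p ≤ a ^ p + b ^ p + c ^ p + e ^ p := by
    have hmono : Monotone fun x : ℝ≥0∞ => x ^ p := ENNReal.monotone_rpow_of_nonneg hp.le
    rw [hM, hmono.map_max, hmono.map_max, hmono.map_max]
    refine max_le (max_le ?_ ?_) (max_le ?_ ?_)
    · exact le_self_add.trans (le_self_add.trans le_self_add)
    · exact le_add_self.trans (le_self_add.trans le_self_add)
    · exact le_add_self.trans le_self_add
    · exact le_add_self
  calc (a + b + c + e) ^ p ≤ (4 * M) ^ p := ENNReal.rpow_le_rpow h1 hp.le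
    _ = 4 ^ p * M ^ p := ENNReal.mul_rpow_of_nonneg _ _ hp.le
    _ ≤ _ := mul_le_mul' le_rfl h2

theorem SobolevMap.aemeasurable_enorm_rpow_grad (v : SobolevMap Ω m p) {L : Set (Space d)}
    (hL : L ⊆ Ω) : AEMeasurable (fun x => ‖v.grad x‖ₑ ^ p) (volume.restrict L) :=
  (v.memLp_grad.1.mono_measure (Measure.restrict_mono_set _ hL)).enorm.pow_const p

theorem SobolevMap.aemeasurable_enorm_rpow_val (v : SobolevMap Ω m p) {L : Set (Space d)}
    (hL : L ⊆ Ω) : AEMeasurable (fun x => ‖v.val x‖ₑ ^ p) (volume.restrict L) :=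
  (v.memLp_val.1.mono_measure (Measure.restrict_mono_set _ hL)).enorm.pow_const p

theorem SobolevMap.aemeasurable_enorm_rpow_sub (v u : SobolevMap Ω m p) {L : Set (Space d)}
    (hL : L ⊆ Ω) : AEMeasurable (fun x => ‖v.val x - u.val x‖ₑ ^ p) (volume.restrict L) :=
  (((v.memLp_val.1.sub u.memLp_val.1)).mono_measure
    (Measure.restrict_mono_set _ hL)).enorm.pow_const p

theorem enorm_interpolate_add_le {E : Type*} [NormedAddCommGroup E] [NormedSpace ℝ E] {t : ℝ}
    (ht : t ∈ Icc (0 : ℝ) 1) (a b s : E) : ‖b + (t • (a - b) + s)‖ₑ ≤ ‖a‖ₑ + ‖b‖ₑ + ‖s‖ₑ := by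
  have h1 : ‖t‖ₑ ≤ 1 := by rw [Real.enorm_of_nonneg ht.1, ENNReal.ofReal_le_one]; exact ht.2
  have h2 : ‖1 - t‖ₑ ≤ 1 := by
    rw [Real.enorm_of_nonneg (by linarith [ht.2]), ENNReal.ofReal_le_one]
    linarith [ht.1]
  have h3 : b + (t • (a - b) + s) = t • a + (1 - t) • b + s := by
    rw [sub_smul, one_smul, smul_sub]; abel
  rw [h3]
  refine (enorm_add_le _ _).trans (add_le_add ((enorm_add_le _ _).trans (add_le_add ?_ ?_)) le_rfl)
  · rw [enorm_smul]; exact mul_le_of_le_one_left' h1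
  · rw [enorm_smul]; exact mul_le_of_le_one_left' h2

/-- Energy of an interpolation between two Sobolev maps. -/
theorem interpolate_energy_le (hp : 1 < p) (ν : Measure (Space d))
    (u v₁ v₂ w : SobolevMap Ω m p) {χ : Space d → ℝ} {k : ℝ≥0∞} (hχI : ∀ x, χ x ∈ Icc (0 : ℝ) 1)
    (hk : ∀ x, ‖fderiv ℝ χ x‖ₑ ≤ k) {L : Set (Space d)} (hL : L ⊆ Ω)
    (hwv : ∀ᵐ x ∂volume.restrict Ω, w.val x = v₂.val x + χ x • (v₁.val x - v₂.val x))
    (hwg : ∀ᵐ x ∂volume.restrict Ω, w.grad x = v₂.grad x + (χ x • (v₁.grad x - v₂.grad x) +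
        (fderiv ℝ χ x).smulRight (v₁.val x - v₂.val x))) :
    ν L + (∫⁻ x in L, ‖w.val x‖ₑ ^ p) + (∫⁻ x in L, ‖w.grad x‖ₑ ^ p)
      ≤ layerError ν u k L v₁ v₂ := by
  have hp0 : 0 < p := by linarith
  have hval : ∀ᵐ x ∂volume.restrict L, ‖w.val x‖ₑ ^ p ≤ 4 ^ p * (‖u.val x‖ₑ ^ p +
      (‖v₁.val x - u.val x‖ₑ ^ p + ‖v₂.val x - u.val x‖ₑ ^ p)) := by
    filter_upwards [ae_restrict_of_ae_restrict_of_subset hL hwv] with x hx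
    have h1 : ‖w.val x‖ₑ ≤ ‖u.val x‖ₑ + ‖v₁.val x - u.val x‖ₑ + ‖v₂.val x - u.val x‖ₑ + 0 := by
      -- Everything is centred at `u`, so that besides `|u|ᵖ`, which belongs to the energy measure,
      -- only the differences `v₁ - u` and `v₂ - u` enter.
      have : w.val x = (v₂.val x - u.val x) +
          (χ x • ((v₁.val x - u.val x) - (v₂.val x - u.val x)) + u.val x) := by
        rw [hx, sub_sub_sub_cancel_right]; abel
      rw [this, add_zero]
      exact (enorm_interpolate_add_le (hχI x) _ _ _).trans_eq (by ring)
    refine (ENNReal.rpow_le_rpow h1 hp0.le).trans ((ENNReal.add_four_rpow_le hp0 _ _ _ _).trans ?_)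
    rw [ENNReal.zero_rpow_of_pos hp0, add_zero, add_assoc]
  have hgrad : ∀ᵐ x ∂volume.restrict L, ‖w.grad x‖ₑ ^ p ≤ 4 ^ p * (‖v₁.grad x‖ₑ ^ p +
      ‖v₂.grad x‖ₑ ^ p + k ^ p * (‖v₁.val x - u.val x‖ₑ ^ p + ‖v₂.val x - u.val x‖ₑ ^ p)) := by
    filter_upwards [ae_restrict_of_ae_restrict_of_subset hL hwg] with x hx
    have h1 : ‖w.grad x‖ₑ ≤ ‖v₁.grad x‖ₑ + ‖v₂.grad x‖ₑ + k * ‖v₁.val x - u.val x‖ₑ +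
        k * ‖v₂.val x - u.val x‖ₑ := by
      have h3 : ‖(fderiv ℝ χ x).smulRight (v₁.val x - v₂.val x)‖ₑ
          ≤ k * ‖v₁.val x - u.val x‖ₑ + k * ‖v₂.val x - u.val x‖ₑ := by
        rw [← mul_add, ← ofReal_norm, ContinuousLinearMap.norm_smulRight_apply,
          ENNReal.ofReal_mul (norm_nonneg _), ofReal_norm, ofReal_norm]
        refine mul_le_mul' (hk x) ?_
        rw [← sub_sub_sub_cancel_right _ _ (u.val x)]
        exact enorm_sub_le
      rw [hx, add_assoc _ (k * _)]
      exact (enorm_interpolate_add_le (hχI x) _ _ _).trans (add_le_add le_rfl h3)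
    refine (ENNReal.rpow_le_rpow h1 hp0.le).trans ((ENNReal.add_four_rpow_le hp0 _ _ _ _).trans ?_)
    rw [ENNReal.mul_rpow_of_nonneg _ _ hp0.le, ENNReal.mul_rpow_of_nonneg _ _ hp0.le]
    exact le_of_eq (by ring)
  have m1 := u.aemeasurable_enorm_rpow_val hL
  have m2 := v₁.aemeasurable_enorm_rpow_grad hL
  have m3 := v₂.aemeasurable_enorm_rpow_grad hL
  have m4 := v₁.aemeasurable_enorm_rpow_sub u hL
  have m5 := v₂.aemeasurable_enorm_rpow_sub u hL
  have m45 : AEMeasurable (fun x => ‖v₁.val x - u.val x‖ₑ ^ p + ‖v₂.val x - u.val x‖ₑ ^ p)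
      (volume.restrict L) := m4.add m5
  have h4t : (4 : ℝ≥0∞) ^ p ≠ ⊤ := by simp
  have h41 : (1 : ℝ≥0∞) ≤ 4 ^ p := by
    have := ENNReal.rpow_le_rpow (show (1 : ℝ≥0∞) ≤ 4 by norm_num) hp0.le
    rwa [ENNReal.one_rpow] at this
  have I1 : ∫⁻ x in L, ‖w.val x‖ₑ ^ p ≤ 4 ^ p * ((∫⁻ x in L, ‖u.val x‖ₑ ^ p) +
      ((∫⁻ x in L, ‖v₁.val x - u.val x‖ₑ ^ p) + ∫⁻ x in L, ‖v₂.val x - u.val x‖ₑ ^ p)) := by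
    refine (lintegral_mono_ae hval).trans_eq ?_
    rw [lintegral_const_mul' _ _ h4t, lintegral_add_left' m1, lintegral_add_left' m4]
  have I2 : ∫⁻ x in L, ‖w.grad x‖ₑ ^ p ≤ 4 ^ p * ((∫⁻ x in L, ‖v₁.grad x‖ₑ ^ p) +
      (∫⁻ x in L, ‖v₂.grad x‖ₑ ^ p) + k ^ p * ((∫⁻ x in L, ‖v₁.val x - u.val x‖ₑ ^ p) +
        ∫⁻ x in L, ‖v₂.val x - u.val x‖ₑ ^ p)) := by
    refine (lintegral_mono_ae hgrad).trans_eq ?_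
    rw [lintegral_const_mul' _ _ h4t,
      lintegral_add_right' _ (m45.const_mul (k ^ p)), lintegral_add_left' m2,
      lintegral_const_mul'' (k ^ p) m45, lintegral_add_left' m4]
  have I0 : ν L ≤ 4 ^ p * ν L := le_mul_of_one_le_left' h41
  refine (add_le_add (add_le_add I0 I1) I2).trans_eq ?_
  unfold layerError
  ring

/-- The open layer between two concentric cubes. -/
def cubeLayer (x : Space d) (σ ρ : ℝ) : Set (Space d) := openCube x ρ \ closedCube x (σ * ρ)

theorem isOpen_cubeLayer (x : Space d) (σ ρ : ℝ) : IsOpen (cubeLayer x σ ρ) :=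
  (isOpen_openCube x ρ).sdiff (isClosed_closedCube x _)

theorem cubeLayer_subset (x : Space d) (σ ρ : ℝ) : cubeLayer x σ ρ ⊆ openCube x ρ := sdiff_subset

theorem disjoint_openCube_cubeLayer (x : Space d) (σ ρ : ℝ) :
    Disjoint (openCube x (σ * ρ)) (cubeLayer x σ ρ) :=
  disjoint_left.2 fun _ hy hy' => hy'.2 (openCube_subset_closedCube _ _ hy)

theorem volume_openCube_diff_union_cubeLayer (x : Space d) {σ ρ : ℝ} (hσ : 0 ≤ σ) (hρ : 0 ≤ ρ) :
    volume (openCube x ρ \ (openCube x (σ * ρ) ∪ cubeLayer x σ ρ)) = 0 := by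
  refine measure_mono_null ?_ (volume_closedCube_diff_openCube x (mul_nonneg hσ hρ))
  intro y hy
  refine ⟨?_, fun h => hy.2 (Or.inl h)⟩
  by_contra hc
  exact hy.2 (Or.inr ⟨hy.1, hc⟩)

/-- The fundamental estimate. The interpolation `w` by `χ` equals `v₁` on the inner cube and `v₂`
outside the outer one. On the layer `w` only serves as a boundary datum: its Dirichlet infimum is
bounded by the growth condition, even if `Φ w` is infinite there. -/
theorem DirichletGrowth.transition_le {b : ℝ≥0∞} {ν : Measure (Space d)} (hp : 1 < p)
    [IsFiniteMeasure (volume.restrict Ω)] (hΩm : IsOpen Ω) (h : CoerciveLocal α Φ)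
    (hG : DirichletGrowth Φ b ν)
    (u v₁ v₂ : SobolevMap Ω m p) {x : Space d} {σ ρ : ℝ} (hσ0 : 0 ≤ σ) (hσ1 : σ ≤ 1) (hρ : 0 < ρ)
    (hΩ : openCube x ρ ⊆ Ω) {χ : Space d → ℝ} {k : ℝ≥0∞}
    (hχ : ContDiff ℝ ∞ χ) (hχc : HasCompactSupport χ) (hχI : ∀ x, χ x ∈ Icc (0 : ℝ) 1)
    (hχ1 : ∀ y ∈ openCube x (σ * ρ), χ y = 1) (hχ0 : ∀ y ∉ openCube x ρ, χ y = 0)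
    (hk : ∀ x, ‖fderiv ℝ χ x‖ₑ ≤ k) :
    dirichletInf Φ v₂.val (openCube x ρ) ≤ Φ v₁ (openCube x (σ * ρ)) +
      b * layerError ν u k (cubeLayer x σ ρ) v₁ v₂ := by
  obtain ⟨w, hwv, hwg⟩ := SobolevMap.exists_interpolate hp v₁ v₂ hχ hχc
  have hAB : openCube x (σ * ρ) ⊆ openCube x ρ :=
    openCube_mono (by nlinarith)
  have hLΩ := (cubeLayer_subset x σ ρ).trans hΩ
  refine (h.dirichletInf_le_add (isOpen_openCube x _) (isOpen_cubeLayer x σ ρ)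
    (isOpen_openCube x ρ) hAB (cubeLayer_subset x σ ρ) hΩ (disjoint_openCube_cubeLayer x σ ρ)
    (volume_openCube_diff_union_cubeLayer x hσ0 hρ.le) (v₁ := v₁) (w := w) ?_ ?_).trans
    (add_le_add le_rfl ((hG _ (isOpen_cubeLayer x σ ρ) hLΩ w).trans
      (mul_le_mul' le_rfl (interpolate_energy_le hp ν u v₁ v₂ w hχI hk hLΩ hwv hwg))))
  · filter_upwards [ae_restrict_of_ae_restrict_of_subset (hAB.trans hΩ) hwv,
      ae_restrict_mem (isOpen_openCube x _).measurableSet] with y hy hyA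
    rw [hy, hχ1 y hyA, one_smul, add_sub_cancel]
  · filter_upwards [ae_restrict_of_ae_restrict_of_subset sdiff_subset hwv, ae_restrict_mem
      (hΩm.measurableSet.diff (isOpen_openCube x ρ).measurableSet)] with y hy hyB
    rw [hy, hχ0 y hyB.2, zero_smul, add_zero]

theorem SobolevMap.ae_eq_on_cubeLayer {v w : SobolevMap Ω m p} {x : Space d} {σ ρ : ℝ}
    (hΩ : openCube x ρ ⊆ Ω)
    (h : ∀ᵐ y ∂volume.restrict (Ω \ openCube x (σ * ρ)), v.val y = w.val y) :
    ∀ᵐ y ∂volume.restrict (cubeLayer x σ ρ), v.val y = w.val y :=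
  ae_restrict_of_ae_restrict_of_subset (subset_sdiff.2 ⟨(cubeLayer_subset x σ ρ).trans hΩ,
    (disjoint_openCube_cubeLayer x σ ρ).symm⟩) h

/-- `DirichletGrowth.transition_le` is applied to every competitor for `v₁` on the inner cube. The
layer lies outside that cube, so values and gradients there are those of `v₁` and the error does not
depend on the competitor. -/
theorem DirichletGrowth.dirichletInf_transition_le {b : ℝ≥0∞} {ν : Measure (Space d)} (hp : 1 < p)
    [IsFiniteMeasure (volume.restrict Ω)] (hΩm : IsOpen Ω) (h : CoerciveLocal α Φ)
    (hG : DirichletGrowth Φ b ν)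
    (u v₁ v₂ : SobolevMap Ω m p) {x : Space d} {σ ρ : ℝ} (hσ0 : 0 ≤ σ) (hσ1 : σ ≤ 1) (hρ : 0 < ρ)
    (hΩ : openCube x ρ ⊆ Ω) {χ : Space d → ℝ} {k : ℝ≥0∞}
    (hχ : ContDiff ℝ ∞ χ) (hχc : HasCompactSupport χ) (hχI : ∀ x, χ x ∈ Icc (0 : ℝ) 1)
    (hχ1 : ∀ y ∈ openCube x (σ * ρ), χ y = 1) (hχ0 : ∀ y ∉ openCube x ρ, χ y = 0)
    (hk : ∀ x, ‖fderiv ℝ χ x‖ₑ ≤ k) :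
    dirichletInf Φ v₂.val (openCube x ρ) ≤ dirichletInf Φ v₁.val (openCube x (σ * ρ)) +
      b * layerError ν u k (cubeLayer x σ ρ) v₁ v₂ := by
  conv_rhs => rw [dirichletInf]
  simp only [ENNReal.iInf_add]
  refine le_iInf₂ fun v hv => ?_
  have hvL := SobolevMap.ae_eq_on_cubeLayer hΩ hv
  have hvg := v.grad_ae_eq hp hΩm v₁ (isOpen_cubeLayer x σ ρ) ((cubeLayer_subset x σ ρ).trans hΩ) hvL
  refine (hG.transition_le hp hΩm h u v v₂ hσ0 hσ1 hρ hΩ hχ hχc hχI hχ1 hχ0 hk).trans_eq ?_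
  have e1 : ∫⁻ y in cubeLayer x σ ρ, ‖v.grad y‖ₑ ^ p = ∫⁻ y in cubeLayer x σ ρ, ‖v₁.grad y‖ₑ ^ p :=
    lintegral_congr_ae (by filter_upwards [hvg] with y hy; rw [hy])
  have e2 : ∫⁻ y in cubeLayer x σ ρ, ‖v.val y - u.val y‖ₑ ^ p
      = ∫⁻ y in cubeLayer x σ ρ, ‖v₁.val y - u.val y‖ₑ ^ p :=
    lintegral_congr_ae (by filter_upwards [hvL] with y hy; rw [hy])
  simp only [layerError, e1, e2]

/-- The Dirichlet infimum of a fixed map grows at most like the energy measure. -/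
theorem DirichletGrowth.dirichletInf_le_add_of_subset {b : ℝ≥0∞} {ν : Measure (Space d)}
    (hp : 1 < p)
    [IsFiniteMeasure (volume.restrict Ω)] (hΩm : IsOpen Ω) (h : CoerciveLocal α Φ)
    (hG : DirichletGrowth Φ b ν) (u : SobolevMap Ω m p) {A L B : Set (Space d)}
    (hA : IsOpen A) (hL : IsOpen L) (hB : IsOpen B) (hAB : A ⊆ B) (hLB : L ⊆ B) (hBΩ : B ⊆ Ω)
    (hd : Disjoint A L) (h0 : volume (B \ (A ∪ L)) = 0) :
    dirichletInf Φ u.val B ≤ dirichletInf Φ u.val A +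
      b * (ν L + (∫⁻ x in L, ‖u.val x‖ₑ ^ p) + ∫⁻ x in L, ‖u.grad x‖ₑ ^ p) := by
  conv_rhs => rw [dirichletInf]
  simp only [ENNReal.iInf_add]
  refine le_iInf₂ fun v hv => ?_
  have hvL : ∀ᵐ y ∂volume.restrict L, v.val y = u.val y :=
    ae_restrict_of_ae_restrict_of_subset
      (subset_sdiff.2 ⟨hLB.trans hBΩ, hd.symm⟩) hv
  have hvg := v.grad_ae_eq hp hΩm u hL (hLB.trans hBΩ) hvL
  -- No cut-off is needed: both infima have the datum `u`, and a competitor on `A` already equals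
  -- `u` on `L`.
  refine (h.dirichletInf_le_add hA hL hB hAB hLB hBΩ hd h0 (v₁ := v) (w := v)
    (ae_of_all _ fun _ => rfl) (ae_restrict_of_ae_restrict_of_subset
      (sdiff_subset_sdiff_right hAB) hv)).trans (add_le_add le_rfl ((hG L hL (hLB.trans hBΩ) v).trans_eq ?_))
  have e1 : ∫⁻ y in L, ‖v.grad y‖ₑ ^ p = ∫⁻ y in L, ‖u.grad y‖ₑ ^ p :=
    lintegral_congr_ae (by filter_upwards [hvg] with y hy; rw [hy])
  have e2 : ∫⁻ y in L, ‖v.val y‖ₑ ^ p = ∫⁻ y in L, ‖u.val y‖ₑ ^ p :=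
    lintegral_congr_ae (by filter_upwards [hvL] with y hy; rw [hy])
  rw [e1, e2]

theorem GrowthBoundG1.exists_dirichletGrowth
    {F : ℝ → SobolevMap Ω m p → Set (Space d) → ℝ≥0∞} (hΩb : Bornology.IsBounded Ω)
    (hF : ∀ ε ∈ Ioc (0 : ℝ) 1, CoerciveLocal α (F ε)) (hG : GrowthBoundG1 F) :
    ∃ (b : ℝ≥0∞) (ν : Measure (Space d)), b ≠ ⊤ ∧ IsFiniteMeasure ν ∧ ν ≪ volume ∧
      ∀ ε ∈ Ioc (0 : ℝ) 1, DirichletGrowth (F ε) b ν := by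
  obtain ⟨β, ν, -, hν, hac, hb⟩ := hG
  refine ⟨ENNReal.ofReal β, ν, ENNReal.ofReal_ne_top, hν,
    hac.trans Measure.absolutelyContinuous_restrict, fun ε hε V hV hVΩ w => ?_⟩
  -- Clearing the quotients requires `0 < |V| < ∞`; the empty set is treated apart, where `Φ`
  -- vanishes because it is a measure.
  rcases V.eq_empty_or_nonempty with rfl | hne
  · obtain ⟨μ, -, hμ⟩ := (hF ε hε).isMeasure w
    refine (dirichletInf_le (v := w) (ae_of_all _ fun _ => rfl)).trans ?_
    rw [hμ ∅ isOpen_empty (empty_subset _)]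
    simp
  · have hv0 : volume V ≠ 0 := (hV.measure_pos volume hne).ne'
    have hvt : volume V ≠ ⊤ := (hΩb.subset hVΩ).measure_lt_top.ne
    have h1 := hb V hV hVΩ w ε hε
    rw [ENNReal.div_le_iff hv0 hvt, setLAverage_eq, setLAverage_eq, mul_assoc, add_mul, add_mul,
      ENNReal.div_mul_cancel hv0 hvt, ENNReal.div_mul_cancel hv0 hvt,
      ENNReal.div_mul_cancel hv0 hvt] at h1
    exact h1

end Functionals

/-! ### Upper and lower limits: dilations and finite sums. -/

theorem map_mul_left_nhdsGT_zero {σ : ℝ} (hσ : 0 < σ) :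
    map (fun ρ => σ * ρ) (𝓝[>] (0 : ℝ)) = 𝓝[>] 0 := by
  conv_lhs => rw [← comap_mulLeft_nhdsGT_zero hσ]
  exact map_comap_of_surjective (fun y => ⟨y / σ, mul_div_cancel₀ y hσ.ne'⟩) _

/-- Comparison of upper limits at `0` up to dilations. -/
theorem limsup_nhdsGT_zero_le_of_dilation {f g : ℝ → ℝ≥0∞}
    (h : ∀ δ : ℝ≥0∞, 0 < δ → ∃ σ : ℝ, 0 < σ ∧ ∀ᶠ ρ in 𝓝[>] (0 : ℝ), f ρ ≤ g (σ * ρ) + δ) :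
    limsup f (𝓝[>] 0) ≤ limsup g (𝓝[>] 0) := by
  refine ENNReal.le_of_forall_pos_le_add fun δ hδ _ => ?_
  obtain ⟨σ, hσ, h1⟩ := h δ (by exact_mod_cast hδ)
  refine (limsup_le_limsup h1).trans_eq ?_
  rw [limsup_add_const _ _ _ (by isBoundedDefault) (by isBoundedDefault)]
  congr 1
  conv_rhs => rw [← map_mul_left_nhdsGT_zero hσ]
  rfl

theorem liminf_nhdsGT_zero_le_of_dilation {f g : ℝ → ℝ≥0∞}
    (h : ∀ δ : ℝ≥0∞, 0 < δ → ∃ σ : ℝ, 0 < σ ∧ ∀ᶠ ρ in 𝓝[>] (0 : ℝ), f ρ ≤ g (σ * ρ) + δ) :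
    liminf f (𝓝[>] 0) ≤ liminf g (𝓝[>] 0) := by
  refine ENNReal.le_of_forall_pos_le_add fun δ hδ _ => ?_
  obtain ⟨σ, hσ, h1⟩ := h δ (by exact_mod_cast hδ)
  refine (liminf_le_liminf h1).trans_eq ?_
  rw [liminf_add_const _ _ _ (by isBoundedDefault) (by isBoundedDefault)]
  congr 1
  conv_rhs => rw [← map_mul_left_nhdsGT_zero hσ]
  rfl

theorem liminf_add_liminf_le {ι : Type*} {l : Filter ι} (u v : ι → ℝ≥0∞) :
    liminf u l + liminf v l ≤ liminf (fun i => u i + v i) l := by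
  rw [liminf_eq, liminf_eq, sSup_eq_iSup, sSup_eq_iSup]
  refine ENNReal.biSup_add_biSup_le' ⟨0, by simp⟩ ⟨0, by simp⟩ fun a ha b hb => ?_
  refine le_liminf_of_le (by isBoundedDefault) ?_
  filter_upwards [ha, hb] with i h1 h2 using add_le_add h1 h2

theorem limsup_add_le_limsup {ι : Type*} {l : Filter ι} (u v : ι → ℝ≥0∞) :
    limsup (fun i => u i + v i) l ≤ limsup u l + limsup v l := by
  refine ENNReal.le_of_forall_pos_le_add fun δ hδ hlt => ?_
  have hδ2 : (δ / 2 : ℝ≥0∞) ≠ 0 := by simpa using hδ.ne'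
  obtain ⟨hu, hv⟩ := ENNReal.add_lt_top.1 hlt
  refine limsup_le_of_le (by isBoundedDefault) ?_
  filter_upwards [eventually_lt_of_limsup_lt (ENNReal.lt_add_right hu.ne hδ2),
    eventually_lt_of_limsup_lt (ENNReal.lt_add_right hv.ne hδ2)] with i h1 h2
  refine (add_le_add h1.le h2.le).trans_eq ?_
  rw [add_add_add_comm, ENNReal.add_halves]

theorem sum_liminf_le {ι κ : Type*} {l : Filter ι} (s : Finset κ) (f : κ → ι → ℝ≥0∞) :
    ∑ k ∈ s, liminf (f k) l ≤ liminf (fun i => ∑ k ∈ s, f k i) l := by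
  classical
  induction s using Finset.induction_on with
  | empty => simp
  | insert a s ha ih =>
    simp only [Finset.sum_insert ha]
    exact (add_le_add le_rfl ih).trans (liminf_add_liminf_le _ _)

theorem limsup_sum_le {ι κ : Type*} {l : Filter ι} [l.NeBot] (s : Finset κ) (f : κ → ι → ℝ≥0∞) :
    limsup (fun i => ∑ k ∈ s, f k i) l ≤ ∑ k ∈ s, limsup (f k) l := by
  classical
  induction s using Finset.induction_on with
  | empty => simp
  | insert a s ha ih =>
    simp only [Finset.sum_insert ha]
    exact (limsup_add_le_limsup _ _).trans (add_le_add le_rfl ih)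

/-! ### The energy measure and regular points. -/

section Regular

variable {d m : ℕ} {Ω : Set (Space d)} {p α : ℝ}

/-- The measure `ν + (|u|ᵖ + |∇u|ᵖ) dx`. -/
noncomputable def energyMeasure (ν : Measure (Space d)) (u : SobolevMap Ω m p) :
    Measure (Space d) :=
  ν + (volume.restrict Ω).withDensity (fun x => ‖u.val x‖ₑ ^ p) +
    (volume.restrict Ω).withDensity (fun x => ‖u.grad x‖ₑ ^ p)

theorem energyMeasure_apply (ν : Measure (Space d)) (u : SobolevMap Ω m p) {V : Set (Space d)}
    (hV : MeasurableSet V) (hVΩ : V ⊆ Ω) : energyMeasure ν u V =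
      ν V + (∫⁻ x in V, ‖u.val x‖ₑ ^ p) + ∫⁻ x in V, ‖u.grad x‖ₑ ^ p := by
  rw [energyMeasure, Measure.add_apply, Measure.add_apply, withDensity_apply _ hV,
    withDensity_apply _ hV, Measure.restrict_restrict hV, inter_eq_left.2 hVΩ]

theorem isFiniteMeasure_energyMeasure (hp : 1 < p) (ν : Measure (Space d)) [IsFiniteMeasure ν]
    (u : SobolevMap Ω m p) : IsFiniteMeasure (energyMeasure ν u) := by
  have h1 := isFiniteMeasure_withDensity (u.lintegral_val_lt_top hp).ne
  have h2 := isFiniteMeasure_withDensity (u.lintegral_grad_lt_top hp).ne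
  unfold energyMeasure
  infer_instance

theorem energyMeasure_absolutelyContinuous {ν : Measure (Space d)} (hν : ν ≪ volume)
    (u : SobolevMap Ω m p) : energyMeasure ν u ≪ volume := by
  intro s hs
  have h0 : volume.restrict Ω s = 0 := le_antisymm ((Measure.restrict_apply_le _ _).trans hs.le) zero_le
  simp [energyMeasure, hν hs, withDensity_absolutelyContinuous (volume.restrict Ω) _ h0]

theorem tendsto_mul_const_nhdsGT_zero {σ : ℝ} (hσ : 0 < σ) :
    Tendsto (fun ρ => σ * ρ) (𝓝[>] (0 : ℝ)) (𝓝[>] 0) :=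
  (map_mul_left_nhdsGT_zero hσ).le

theorem ofReal_pow_ne_zero {ρ : ℝ} (hρ : 0 < ρ) : ENNReal.ofReal (ρ ^ d) ≠ 0 := by
  simpa using pow_pos hρ d

theorem ofReal_dilate_pow {σ ρ : ℝ} (hσ : 0 < σ) :
    ENNReal.ofReal ((σ * ρ) ^ d) = ENNReal.ofReal (σ ^ d) * ENNReal.ofReal (ρ ^ d) := by
  rw [mul_pow, ENNReal.ofReal_mul (by positivity)]

theorem div_ofReal_pow_eq {σ ρ : ℝ} (hσ : 0 < σ) (a : ℝ≥0∞) :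
    a / ENNReal.ofReal (ρ ^ d) = ENNReal.ofReal (σ ^ d) * (a / ENNReal.ofReal ((σ * ρ) ^ d)) := by
  rw [ofReal_dilate_pow hσ, ← mul_div_assoc,
    ENNReal.mul_div_mul_left _ _ (ofReal_pow_ne_zero hσ) ENNReal.ofReal_ne_top]

/-- A point of approximate differentiability of `u` at which the energy measure has a density. -/
structure IsRegularPoint (ν : Measure (Space d)) (u : SobolevMap Ω m p) (x : Space d)
    (g : ℝ≥0∞) : Prop where
  mem : x ∈ Ω
  ne_top : g ≠ ⊤
  tendsto_density : Tendsto (fun ρ : ℝ => energyMeasure ν u (openCube x ρ) / ENNReal.ofReal (ρ ^ d))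
    (𝓝[>] 0) (𝓝 g)
  tendsto_taylor : Tendsto (fun ρ : ℝ => (∫⁻ y in openCube x ρ,
    ‖u.val y - affineAt x (u.val x) (u.grad x) y‖ₑ ^ p) /
      (ENNReal.ofReal (ρ ^ d) * ENNReal.ofReal ρ ^ p)) (𝓝[>] 0) (𝓝 0)

theorem ae_isRegularPoint (hd : 1 ≤ d) (hp : 1 < p) (hΩ : IsOpen Ω)
    [IsFiniteMeasure (volume.restrict Ω)] {ν : Measure (Space d)} [IsFiniteMeasure ν]
    (hν : ν ≪ volume) (u : SobolevMap Ω m p) :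
    ∀ᵐ x ∂volume.restrict Ω, IsRegularPoint ν u x ((energyMeasure ν u).rnDeriv volume x) := by
  have hfin := isFiniteMeasure_energyMeasure hp ν u
  filter_upwards [u.hasWeakGradient.ae_tendsto_lintegral_taylor hp hΩ u.memLp_val u.memLp_grad,
    ae_restrict_of_ae (ae_tendsto_measure_openCube_div _ (energyMeasure_absolutelyContinuous hν u)),
    ae_restrict_of_ae (Measure.rnDeriv_lt_top (energyMeasure ν u) volume),
    ae_restrict_mem hΩ.measurableSet] with x h1 h2 h3 h4
  refine ⟨h4, h3.ne, h2, ?_⟩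
  have hd0 : (0 : ℝ) < d := by exact_mod_cast hd
  -- The cube of edge `ρ` lies in the ball of radius `dρ`; the change of scale costs the constant
  -- `d^d d^p`.
  have h5 := (h1.comp (tendsto_mul_const_nhdsGT_zero hd0))
  have h6 := ENNReal.Tendsto.const_mul (a := ENNReal.ofReal d ^ d * ENNReal.ofReal d ^ p) h5
    (Or.inr (ENNReal.mul_ne_top (by finiteness) (ENNReal.rpow_ne_top_of_nonneg (by linarith)
      (by finiteness))))
  rw [mul_zero] at h6
  refine tendsto_of_tendsto_of_tendsto_of_le_of_le' tendsto_const_nhds h6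
    (Eventually.of_forall fun _ => zero_le) ?_
  filter_upwards [self_mem_nhdsWithin] with ρ hρ
  have hρ : 0 < ρ := hρ
  have hc0 : ENNReal.ofReal d ^ d * ENNReal.ofReal d ^ p ≠ 0 := by
    refine mul_ne_zero (by simp [Nat.one_le_iff_ne_zero.1 hd]) ?_
    exact (ENNReal.rpow_pos (by simpa using hd0) (by finiteness)).ne'
  have hct : ENNReal.ofReal d ^ d * ENNReal.ofReal d ^ p ≠ ⊤ :=
    ENNReal.mul_ne_top (by finiteness) (ENNReal.rpow_ne_top_of_nonneg (by linarith)
      (by finiteness))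
  simp only [Function.comp]
  have e1 : ENNReal.ofReal (d * ρ) ^ d * ENNReal.ofReal (d * ρ) ^ p =
      (ENNReal.ofReal d ^ d * ENNReal.ofReal d ^ p) *
        (ENNReal.ofReal (ρ ^ d) * ENNReal.ofReal ρ ^ p) := by
    rw [ENNReal.ofReal_mul hd0.le, mul_pow, ENNReal.mul_rpow_of_nonneg _ _ (by linarith : 0 ≤ p),
      ENNReal.ofReal_pow hρ.le]
    ring
  rw [e1, ← mul_div_assoc, ENNReal.mul_div_mul_left _ _ hc0 hct]
  refine ENNReal.div_le_div_right ?_ _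
  have hsub : openCube x ρ ⊆ Metric.ball x (d * ρ) := fun y hy => by
    have := dist_le_of_mem_closedCube hρ.le (openCube_subset_closedCube _ _ hy)
    rw [Metric.mem_ball]
    nlinarith
  refine (lintegral_mono_set hsub).trans_eq (lintegral_congr fun y => ?_)
  rw [affineAt, sub_add_eq_sub_sub]

end Regular

/-! ### Comparison of `u` with its affine expansion at a regular point. -/

section Pointwise

variable {d m : ℕ} {Ω : Set (Space d)} {p α : ℝ}

/-- The limit is `(1 - σ^d) c`: layers become cheap as `σ → 1`. Absolute continuity makes the inner
boundary negligible. -/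
theorem tendsto_measure_cubeLayer_div (μ : Measure (Space d)) [IsFiniteMeasure μ]
    (hμ : μ ≪ volume) {x : Space d} {c : ℝ≥0∞} (hc : c ≠ ⊤)
    (h : Tendsto (fun ρ : ℝ => μ (openCube x ρ) / ENNReal.ofReal (ρ ^ d)) (𝓝[>] 0) (𝓝 c))
    {σ : ℝ} (hσ0 : 0 < σ) (hσ1 : σ ≤ 1) :
    Tendsto (fun ρ : ℝ => μ (cubeLayer x σ ρ) / ENNReal.ofReal (ρ ^ d)) (𝓝[>] 0)
      (𝓝 (c - ENNReal.ofReal (σ ^ d) * c)) := by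
  have h1 := ENNReal.Tendsto.const_mul (a := ENNReal.ofReal (σ ^ d))
    (h.comp (tendsto_mul_const_nhdsGT_zero hσ0)) (Or.inr ENNReal.ofReal_ne_top)
  refine (ENNReal.Tendsto.sub h h1 (Or.inl hc)).congr' ?_
  filter_upwards [self_mem_nhdsWithin] with ρ hρ
  have hρ : 0 < ρ := hρ
  simp only [Function.comp]
  rw [← div_ofReal_pow_eq hσ0, ENNReal.div_eq_inv_mul, ENNReal.div_eq_inv_mul,
    ENNReal.div_eq_inv_mul, ← ENNReal.mul_sub fun _ _ => ENNReal.inv_ne_top.2 (ofReal_pow_ne_zero hρ)]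
  congr 1
  have h3 : openCube x (σ * ρ) =ᵐ[μ] closedCube x (σ * ρ) :=
    hμ.ae_le (openCube_ae_eq_closedCube x (by positivity))
  have hsub : openCube x (σ * ρ) ⊆ openCube x ρ := openCube_mono (by nlinarith)
  have h4 : cubeLayer x σ ρ =ᵐ[μ] (openCube x ρ \ openCube x (σ * ρ) : Set (Space d)) :=
    (ae_eq_refl _).diff h3.symm
  rw [measure_congr h4, measure_sdiff hsub (isOpen_openCube _ _).measurableSet.nullMeasurableSet
    (measure_ne_top _ _)]

theorem eventually_openCube_subset (hd : 1 ≤ d) (hΩ : IsOpen Ω) {x : Space d} (hx : x ∈ Ω) :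
    ∀ᶠ ρ in 𝓝[>] (0 : ℝ), closedCube x ρ ⊆ Ω := by
  obtain ⟨ε, hε, hball⟩ := Metric.nhds_basis_ball.mem_iff.1 (hΩ.mem_nhds hx)
  have hd0 : (0 : ℝ) < d := by exact_mod_cast hd
  filter_upwards [Ioo_mem_nhdsGT (show 0 < ε / d by positivity)] with ρ hρ y hy
  refine hball ?_
  have h1 := dist_le_of_mem_closedCube hρ.1.le hy
  have h2 := (lt_div_iff₀ hd0).1 hρ.2
  rw [Metric.mem_ball]
  nlinarith [mul_pos hd0 hρ.1]

/-- The energy measure of `u` plus that of an affine map of gradient `ξ`. -/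
noncomputable def affineEnergyMeasure (ν : Measure (Space d)) (u : SobolevMap Ω m p)
    (ξ : Space d →L[ℝ] Space m) : Measure (Space d) :=
  energyMeasure ν u + ‖ξ‖ₑ ^ p • volume.restrict Ω

theorem isFiniteMeasure_affineEnergyMeasure (hp : 1 < p) (ν : Measure (Space d)) [IsFiniteMeasure ν]
    [IsFiniteMeasure (volume.restrict Ω)]
    (u : SobolevMap Ω m p) (ξ : Space d →L[ℝ] Space m) :
    IsFiniteMeasure (affineEnergyMeasure ν u ξ) := by
  have h1 := isFiniteMeasure_energyMeasure hp ν u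
  have h2 : ‖ξ‖ₑ ^ p ≠ ⊤ := ENNReal.rpow_ne_top_of_nonneg (by linarith) (by finiteness)
  have h3 := Measure.smul_finite (volume.restrict Ω) h2
  unfold affineEnergyMeasure
  infer_instance

theorem affineEnergyMeasure_absolutelyContinuous {ν : Measure (Space d)} (hν : ν ≪ volume)
    (u : SobolevMap Ω m p) (ξ : Space d →L[ℝ] Space m) :
    affineEnergyMeasure ν u ξ ≪ volume := by
  intro s hs
  have h0 : volume.restrict Ω s = 0 := le_antisymm ((Measure.restrict_apply_le _ _).trans hs.le) zero_le
  simp [affineEnergyMeasure, energyMeasure_absolutelyContinuous hν u hs, h0]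

theorem affineEnergyMeasure_apply (ν : Measure (Space d)) (u : SobolevMap Ω m p)
    (ξ : Space d →L[ℝ] Space m) {V : Set (Space d)} (hV : MeasurableSet V) (hVΩ : V ⊆ Ω) :
    affineEnergyMeasure ν u ξ V = ν V + (∫⁻ x in V, ‖u.val x‖ₑ ^ p) +
      (∫⁻ x in V, ‖u.grad x‖ₑ ^ p) + ‖ξ‖ₑ ^ p * volume V := by
  rw [affineEnergyMeasure, Measure.add_apply, energyMeasure_apply ν u hV hVΩ, Measure.smul_apply,
    Measure.restrict_apply hV, inter_eq_left.2 hVΩ, smul_eq_mul]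

/-- The remainder of the first-order expansion of `u` at `x`. -/
noncomputable def taylorRemainder (u : SobolevMap Ω m p) (x : Space d) (V : Set (Space d)) : ℝ≥0∞ :=
  ∫⁻ y in V, ‖u.val y - affineAt x (u.val x) (u.grad x) y‖ₑ ^ p

theorem ae_affine_rpow_eq {u A : SobolevMap Ω m p} {x : Space d} {v : Space m}
    {ξ : Space d →L[ℝ] Space m} (hA : A.val =ᵐ[volume.restrict Ω] affineAt x v ξ)
    {L : Set (Space d)} (hLΩ : L ⊆ Ω) :
    ∫⁻ y in L, ‖A.val y - u.val y‖ₑ ^ p = ∫⁻ y in L, ‖u.val y - affineAt x v ξ y‖ₑ ^ p :=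
  lintegral_congr_ae (by
    filter_upwards [ae_restrict_of_ae_restrict_of_subset hLΩ hA] with y hy
    rw [hy, enorm_sub_rev])

theorem setLIntegral_grad_affine {A : SobolevMap Ω m p} {ξ : Space d →L[ℝ] Space m}
    (hAg : A.grad =ᵐ[volume.restrict Ω] fun _ => ξ) {L : Set (Space d)} (hLΩ : L ⊆ Ω) :
    ∫⁻ y in L, ‖A.grad y‖ₑ ^ p = ‖ξ‖ₑ ^ p * volume L := by
  rw [← setLIntegral_const]
  refine lintegral_congr_ae ?_
  filter_upwards [ae_restrict_of_ae_restrict_of_subset hLΩ hAg] with y hy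
  rw [hy]

theorem layerError_affine (hp : 0 < p) (ν : Measure (Space d)) (u A : SobolevMap Ω m p)
    {x : Space d}
    (hA : A.val =ᵐ[volume.restrict Ω] affineAt x (u.val x) (u.grad x))
    (hAg : A.grad =ᵐ[volume.restrict Ω] fun _ => u.grad x) (k : ℝ≥0∞) {L : Set (Space d)}
    (hL : MeasurableSet L) (hLΩ : L ⊆ Ω) :
    layerError ν u k L u A = 4 ^ p * (affineEnergyMeasure ν u (u.grad x) L +
      (1 + k ^ p) * taylorRemainder u x L) := by
  have h0 : ∫⁻ y in L, ‖u.val y - u.val y‖ₑ ^ p = 0 := by simp [hp]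
  rw [layerError, ae_affine_rpow_eq hA hLΩ, setLIntegral_grad_affine hAg hLΩ,
    affineEnergyMeasure_apply ν u _ hL hLΩ, h0, zero_add]
  rfl

/-- Lets one error estimate serve both directions of the comparison between `u` and its affine
expansion. -/
theorem layerError_comm (ν : Measure (Space d)) (u v w : SobolevMap Ω m p) (k : ℝ≥0∞)
    (L : Set (Space d)) : layerError ν u k L v w = layerError ν u k L w v := by
  unfold layerError
  ring

namespace IsRegularPoint

variable {ν : Measure (Space d)} {u : SobolevMap Ω m p} {x : Space d} {g : ℝ≥0∞}

theorem tendsto_affineEnergyMeasure (h : IsRegularPoint ν u x g) (hd : 1 ≤ d) (hΩ : IsOpen Ω)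
    (ξ : Space d →L[ℝ] Space m) :
    Tendsto (fun ρ : ℝ => affineEnergyMeasure ν u ξ (openCube x ρ) / ENNReal.ofReal (ρ ^ d))
      (𝓝[>] 0) (𝓝 (g + ‖ξ‖ₑ ^ p)) := by
  refine (h.tendsto_density.add_const (‖ξ‖ₑ ^ p)).congr' ?_
  filter_upwards [eventually_openCube_subset hd hΩ h.mem, self_mem_nhdsWithin] with ρ hρΩ hρ
  have hρ : 0 < ρ := hρ
  have hs := (openCube_subset_closedCube x ρ).trans hρΩ
  rw [affineEnergyMeasure_apply ν u ξ (isOpen_openCube x ρ).measurableSet hs,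
    ← energyMeasure_apply ν u (isOpen_openCube x ρ).measurableSet hs, volume_openCube x hρ.le,
    ENNReal.add_div, mul_div_assoc, ENNReal.div_self (ofReal_pow_ne_zero hρ) ENNReal.ofReal_ne_top,
    mul_one]

/-- The factor `(N/ρ)^p`, coming from the gradient of a cut-off at scale `ρ`, is exactly what
differentiability in `Lᵖ` compensates. -/
theorem tendsto_taylorRemainder (h : IsRegularPoint ν u x g) (hp : 0 < p) (N : ℝ) :
    Tendsto (fun ρ : ℝ => (1 + ENNReal.ofReal (N / ρ) ^ p) * taylorRemainder u x (openCube x ρ) /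
      ENNReal.ofReal (ρ ^ d)) (𝓝[>] 0) (𝓝 0) := by
  have h1 : Tendsto (fun ρ : ℝ => ENNReal.ofReal ρ ^ p + ENNReal.ofReal N ^ p) (𝓝[>] 0)
      (𝓝 (ENNReal.ofReal 0 ^ p + ENNReal.ofReal N ^ p)) := by
    have hc : Continuous fun ρ : ℝ => ENNReal.ofReal ρ ^ p + ENNReal.ofReal N ^ p :=
      (ENNReal.continuous_rpow_const.comp ENNReal.continuous_ofReal).add_const _
    exact (hc.tendsto 0).mono_left nhdsWithin_le_nhds
  have hfin : ENNReal.ofReal 0 ^ p + ENNReal.ofReal N ^ p ≠ ⊤ :=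
    ENNReal.add_ne_top.2 ⟨ENNReal.rpow_ne_top_of_nonneg hp.le ENNReal.ofReal_ne_top,
      ENNReal.rpow_ne_top_of_nonneg hp.le ENNReal.ofReal_ne_top⟩
  have h2 := ENNReal.Tendsto.mul h1 (Or.inr ENNReal.zero_ne_top) h.tendsto_taylor (Or.inr hfin)
  rw [mul_zero] at h2
  refine h2.congr' ?_
  filter_upwards [self_mem_nhdsWithin] with ρ hρ
  have hρ : 0 < ρ := hρ
  have hr0 : ENNReal.ofReal ρ ^ p ≠ 0 :=
    (ENNReal.rpow_pos (by simpa using hρ) ENNReal.ofReal_ne_top).ne'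
  have hrt : ENNReal.ofReal ρ ^ p ≠ ⊤ := ENNReal.rpow_ne_top_of_nonneg hp.le ENNReal.ofReal_ne_top
  have e1 : ENNReal.ofReal ρ ^ p + ENNReal.ofReal N ^ p =
      ENNReal.ofReal ρ ^ p * (1 + ENNReal.ofReal (N / ρ) ^ p) := by
    rw [ENNReal.ofReal_div_of_pos hρ, ENNReal.div_rpow_of_nonneg _ _ hp.le, mul_add, mul_one,
      ENNReal.mul_div_cancel hr0 hrt]
  rw [e1, mul_assoc, ← mul_div_assoc, ← mul_div_assoc, mul_comm (ENNReal.ofReal (ρ ^ d)),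
    ENNReal.mul_div_mul_left _ _ hr0 hrt]
  rfl

/-- Comparison of the Dirichlet infima of `u` and of its affine expansion at a regular point. -/
theorem exists_dilation (h : IsRegularPoint ν u x g) (hd : 1 ≤ d) (hp : 1 < p) (hΩ : IsOpen Ω)
    (hΩb : Bornology.IsBounded Ω) [IsFiniteMeasure ν] (hν : ν ≪ volume) {b : ℝ≥0∞} (hb : b ≠ ⊤)
    {F : ℝ → SobolevMap Ω m p → Set (Space d) → ℝ≥0∞}
    (hF : ∀ ε ∈ Ioc (0 : ℝ) 1, CoerciveLocal α (F ε))
    (hG : ∀ ε ∈ Ioc (0 : ℝ) 1, DirichletGrowth (F ε) b ν) {δ : ℝ≥0∞} (hδ : 0 < δ) :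
    ∃ σ : ℝ, 0 < σ ∧ σ < 1 ∧ ∀ᶠ ρ in 𝓝[>] (0 : ℝ), ∀ ε ∈ Ioc (0 : ℝ) 1,
      dirichletInf (F ε) (affineAt x (u.val x) (u.grad x)) (openCube x ρ) ≤
        dirichletInf (F ε) u.val (openCube x (σ * ρ)) + δ * ENNReal.ofReal (ρ ^ d) ∧
      dirichletInf (F ε) u.val (openCube x ρ) ≤
        dirichletInf (F ε) (affineAt x (u.val x) (u.grad x)) (openCube x (σ * ρ)) +
          δ * ENNReal.ofReal (ρ ^ d) := by
  have : IsFiniteMeasure (volume.restrict Ω) := ⟨by simpa using hΩb.measure_lt_top⟩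
  have hp0 : 0 < p := by linarith
  set M := affineEnergyMeasure ν u (u.grad x) with hM
  have hMfin : IsFiniteMeasure M := isFiniteMeasure_affineEnergyMeasure hp ν u _
  set c := g + ‖u.grad x‖ₑ ^ p with hc
  have hct : c ≠ ⊤ := ENNReal.add_ne_top.2 ⟨h.ne_top,
    ENNReal.rpow_ne_top_of_nonneg hp0.le (by finiteness)⟩
  have h4t : (4 : ℝ≥0∞) ^ p ≠ ⊤ := by simp
  have hbt : b * 4 ^ p ≠ ⊤ := ENNReal.mul_ne_top hb h4t
  -- The order of choices matters: `σ` is fixed first, to make the layer energy smaller than `δ`;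
  -- the cut-off constant `N` depends on `σ`, and its contribution disappears only as `ρ → 0`.
  obtain ⟨σ, hσ0, hσ1, hσ⟩ : ∃ σ : ℝ, 0 < σ ∧ σ < 1 ∧
      b * 4 ^ p * (c - ENNReal.ofReal (σ ^ d) * c) < δ := by
    have t1 : Tendsto (fun σ : ℝ => ENNReal.ofReal (σ ^ d)) (𝓝[<] 1) (𝓝 (ENNReal.ofReal (1 ^ d))) :=
      ((ENNReal.continuous_ofReal.comp (continuous_pow d)).tendsto 1).mono_left nhdsWithin_le_nhds
    have t2 := ENNReal.Tendsto.const_mul (a := b * 4 ^ p) (ENNReal.Tendsto.sub (tendsto_const_nhds (x := c))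
      (ENNReal.Tendsto.mul_const (b := c) t1 (Or.inr hct)) (Or.inl hct)) (Or.inr hbt)
    simp only [one_pow, ENNReal.ofReal_one, one_mul, tsub_self, mul_zero] at t2
    obtain ⟨σ, h1, h2⟩ := ((t2.eventually_lt_const hδ).and
      (Ioo_mem_nhdsLT (show (0 : ℝ) < 1 by norm_num))).exists
    exact ⟨σ, h2.1, h2.2, h1⟩
  refine ⟨σ, hσ0, hσ1, ?_⟩
  obtain ⟨N, -, hcut⟩ := exists_cube_cutoff (d := d) hσ1
  obtain ⟨A, hA, hAg⟩ := SobolevMap.exists_affineAt (p := p) hΩ hΩb x (u.val x) (u.grad x)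
  have t3 := tendsto_measure_cubeLayer_div M (affineEnergyMeasure_absolutelyContinuous hν u _) hct
    (h.tendsto_affineEnergyMeasure hd hΩ (u.grad x)) hσ0 hσ1.le
  have t4 := ENNReal.Tendsto.const_mul (a := b * 4 ^ p) (t3.add (h.tendsto_taylorRemainder hp0 N))
    (Or.inr hbt)
  rw [add_zero] at t4
  filter_upwards [t4.eventually_lt_const hσ, eventually_openCube_subset hd hΩ h.mem,
    self_mem_nhdsWithin] with ρ hlt hρΩ hρ ε hε
  have hρ : 0 < ρ := hρ
  have hs := (openCube_subset_closedCube x ρ).trans hρΩ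
  have hLΩ := (cubeLayer_subset x σ ρ).trans hs
  have herr : b * layerError ν u (ENNReal.ofReal (N / ρ)) (cubeLayer x σ ρ) u A ≤
      δ * ENNReal.ofReal (ρ ^ d) := by
    rw [layerError_affine hp0 ν u A hA hAg _ (isOpen_cubeLayer x σ ρ).measurableSet hLΩ, ← mul_assoc]
    have h5 : taylorRemainder u x (cubeLayer x σ ρ) ≤ taylorRemainder u x (openCube x ρ) :=
      lintegral_mono_set (cubeLayer_subset x σ ρ)
    calc _ ≤ b * 4 ^ p * (M (cubeLayer x σ ρ) + (1 + ENNReal.ofReal (N / ρ) ^ p) *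
          taylorRemainder u x (openCube x ρ)) := by gcongr
      _ ≤ _ := by
        rw [← ENNReal.div_le_iff (ofReal_pow_ne_zero hρ) ENNReal.ofReal_ne_top, mul_div_assoc,
          ENNReal.add_div]
        exact hlt.le
  obtain ⟨χ, hχ, hχc, hχI, hχ1, hχ0, hχk⟩ := hcut x ρ hρ
  have hk : ∀ y, ‖fderiv ℝ χ y‖ₑ ≤ ENNReal.ofReal (N / ρ) := fun y => by
    rw [← ofReal_norm]; exact ENNReal.ofReal_le_ofReal (hχk y)
  rw [← dirichletInf_congr _ hA, ← dirichletInf_congr _ hA]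
  refine ⟨((hG ε hε).dirichletInf_transition_le hp hΩ (hF ε hε) u u A hσ0.le hσ1.le hρ hs hχ hχc hχI hχ1
    hχ0 hk).trans (add_le_add le_rfl herr), ((hG ε hε).dirichletInf_transition_le hp hΩ (hF ε hε) u A u
      hσ0.le hσ1.le hρ hs hχ hχc hχI hχ1 hχ0 hk).trans (add_le_add le_rfl ?_)⟩
  rwa [layerError_comm]

end IsRegularPoint

end Pointwise

theorem liminf_add_le_of_tendsto {ι : Type*} {l : Filter ι} [l.NeBot] {u v : ι → ℝ≥0∞} {c : ℝ≥0∞}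
    (hv : Tendsto v l (𝓝 c)) : liminf (fun i => u i + v i) l ≤ liminf u l + c := by
  refine ENNReal.le_of_forall_pos_le_add fun δ hδ hlt => ?_
  have hc : c ≠ ⊤ := (ENNReal.add_lt_top.1 hlt).2.ne
  have hδ' : (δ : ℝ≥0∞) ≠ 0 := by simpa using hδ.ne'
  have h1 : ∀ᶠ i in l, u i + v i ≤ u i + (c + δ) := by
    filter_upwards [hv.eventually_lt_const (ENNReal.lt_add_right hc hδ')]
      with i hi using add_le_add le_rfl hi.le
  refine (liminf_le_liminf h1).trans_eq ?_
  rw [liminf_add_const _ _ _ (by isBoundedDefault) (by isBoundedDefault), add_assoc]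

theorem sum_measure_le_of_disjoint {X : Type*} [MeasurableSpace X] (μ : Measure X) {K : ℕ}
    {L : ℕ → Set X} {Q : Set X} (hL : ∀ j, MeasurableSet (L j)) (hLQ : ∀ j, L j ⊆ Q)
    (hd : Pairwise (Function.onFun Disjoint L)) : ∑ j ∈ Finset.range K, μ (L j) ≤ μ Q := by
  rw [← measure_biUnion_finset (fun i _ j _ hij => hd hij) fun j _ => hL j]
  exact measure_mono (iUnion₂_subset fun j _ => hLQ j)

theorem sum_setLIntegral_le_of_disjoint {X : Type*} [MeasurableSpace X] {μ : Measure X} {K : ℕ}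
    (f : X → ℝ≥0∞)
    {L : ℕ → Set X} {Q : Set X} (hL : ∀ j, MeasurableSet (L j)) (hQ : MeasurableSet Q)
    (hLQ : ∀ j, L j ⊆ Q) (hd : Pairwise (Function.onFun Disjoint L)) :
    ∑ j ∈ Finset.range K, ∫⁻ x in L j, f x ∂μ ≤ ∫⁻ x in Q, f x ∂μ := by
  have := sum_measure_le_of_disjoint (μ.withDensity f) (K := K) hL hLQ hd
  simpa only [withDensity_apply _ (hL _), withDensity_apply _ hQ] using this

/-! ### Slicing, and the density of the energies of approximating families. -/

section LowerDensity

variable {d m : ℕ} {Ω : Set (Space d)} {p α : ℝ}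

theorem tendsto_lintegral_of_mem_approximatingFamilies (hp : 1 < p) {u : SobolevMap Ω m p}
    {W : ℝ → SobolevMap Ω m p} (hW : W ∈ approximatingFamilies u.val) :
    Tendsto (fun ε => ∫⁻ x in Ω, ‖(W ε).val x - u.val x‖ₑ ^ p) (𝓝[>] 0) (𝓝 0) := by
  have hp0 : 0 < p := by linarith
  have h1 : Tendsto (fun ε => eLpNorm (fun x => (W ε).val x - u.val x) (ENNReal.ofReal p)
    (volume.restrict Ω)) (𝓝[>] (0 : ℝ)) (𝓝 0) := hW
  have h2 := (ENNReal.continuous_rpow_const (y := p)).continuousAt.tendsto.comp h1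
  rw [ENNReal.zero_rpow_of_pos hp0] at h2
  refine h2.congr fun ε => ?_
  simp only [Function.comp]
  rw [eLpNorm_ofReal_eq hp, ← ENNReal.rpow_mul, one_div, inv_mul_cancel₀ hp0.ne', ENNReal.rpow_one]

theorem cubeLayer_pairwise_disjoint (x : Space d) {σ ρ : ℝ} (hσ0 : 0 ≤ σ) (hσ1 : σ ≤ 1)
    (hρ : 0 ≤ ρ) :
    Pairwise (Function.onFun Disjoint fun j : ℕ => cubeLayer x σ (σ ^ j * ρ)) := by
  refine (pairwise_disjoint_on _).2 fun i j hij => disjoint_left.2 fun y hy hy' => hy.2 ?_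
  refine openCube_subset_closedCube _ _ (openCube_mono ?_ hy'.1)
  rw [← mul_assoc, ← pow_succ']
  exact mul_le_mul_of_nonneg_right (pow_le_pow_of_le_one hσ0 hσ1 hij) hρ

theorem layerError_le_of_affine (ν : Measure (Space d)) (u w A : SobolevMap Ω m p)
    {x : Space d} (hA : A.val =ᵐ[volume.restrict Ω] affineAt x (u.val x) (u.grad x))
    (hAg : A.grad =ᵐ[volume.restrict Ω] fun _ => u.grad x) (k : ℝ≥0∞) {L : Set (Space d)}
    (hL : MeasurableSet L) (hLΩ : L ⊆ Ω) :
    layerError ν u k L w A ≤ 4 ^ p * (affineEnergyMeasure ν u (u.grad x) L +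
      (∫⁻ y in L, ‖w.grad y‖ₑ ^ p) +
      (1 + k ^ p) * ((∫⁻ y in L, ‖w.val y - u.val y‖ₑ ^ p) + taylorRemainder u x L)) := by
  rw [layerError, ae_affine_rpow_eq hA hLΩ, setLIntegral_grad_affine hAg hLΩ,
    affineEnergyMeasure_apply ν u _ hL hLΩ]
  refine mul_le_mul' le_rfl (add_le_add ?_ le_rfl)
  rw [add_right_comm, add_right_comm _ (∫⁻ y in L, ‖u.grad y‖ₑ ^ p)]
  exact add_le_add le_self_add le_rfl

/-- Slicing: the sum of the Dirichlet infima of the affine expansion over a geometric family of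
concentric cubes. -/
theorem sum_dirichletInf_le {Φ : SobolevMap Ω m p → Set (Space d) → ℝ≥0∞} (hp : 1 < p)
    (hα : 0 < α) [IsFiniteMeasure (volume.restrict Ω)] (hΩ : IsOpen Ω)
    (h : CoerciveLocal α Φ) {b : ℝ≥0∞} {ν : Measure (Space d)}
    (hG : DirichletGrowth Φ b ν) (u w A : SobolevMap Ω m p) {x : Space d}
    (hA : A.val =ᵐ[volume.restrict Ω] affineAt x (u.val x) (u.grad x))
    (hAg : A.grad =ᵐ[volume.restrict Ω] fun _ => u.grad x)
    {σ ρ N : ℝ} (hσ0 : 0 < σ) (hσ1 : σ ≤ 1) (hρ : 0 < ρ) (hN : 0 ≤ N) (hΩρ : openCube x ρ ⊆ Ω)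
    (hcut : ∀ (x : Space d) (ρ : ℝ), 0 < ρ → ∃ χ : Space d → ℝ, ContDiff ℝ ∞ χ ∧
      HasCompactSupport χ ∧ (∀ y, χ y ∈ Icc (0 : ℝ) 1) ∧ (∀ y ∈ openCube x (σ * ρ), χ y = 1) ∧
      (∀ y ∉ openCube x ρ, χ y = 0) ∧ ∀ y, ‖fderiv ℝ χ y‖ ≤ N / ρ) (K : ℕ) :
    ∑ j ∈ Finset.range K, dirichletInf Φ (affineAt x (u.val x) (u.grad x)) (openCube x (σ ^ j * ρ)) ≤
      (K + b * 4 ^ p * (ENNReal.ofReal α)⁻¹) * Φ w (openCube x ρ) +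
      b * 4 ^ p * (affineEnergyMeasure ν u (u.grad x) (openCube x ρ) +
        (1 + ENNReal.ofReal (N / σ ^ K / ρ) ^ p) * taylorRemainder u x (openCube x ρ)) +
      b * 4 ^ p * (1 + ENNReal.ofReal (N / σ ^ K / ρ) ^ p) *
        ∫⁻ y in Ω, ‖w.val y - u.val y‖ₑ ^ p := by
  have hp0 : 0 < p := by linarith
  rcases Nat.eq_zero_or_pos K with rfl | hK
  · simp
  -- Coercivity says something only for finite energy; otherwise the right side is infinite, since
  -- its coefficient is at least `K > 0`.
  by_cases htop : Φ w (openCube x ρ) = ⊤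
  · rw [htop, ENNReal.mul_top]
    · simp
    · simp [hK.ne']
  -- A common bound for all cut-offs: the gradient at scale `σ^j ρ` is at most `N / (σ^j ρ)`, and
  -- `σ^K ≤ σ^j`.
  set k := ENNReal.ofReal (N / σ ^ K / ρ) with hk
  have hgrad : ∫⁻ y in openCube x ρ, ‖w.grad y‖ₑ ^ p ≤
      (ENNReal.ofReal α)⁻¹ * Φ w (openCube x ρ) := by
    rw [← ENNReal.div_eq_inv_mul, ENNReal.le_div_iff_mul_le (by simp [hα]) (by simp), mul_comm]
    exact h.coercive _ (isOpen_openCube x ρ) hΩρ w (lt_top_iff_ne_top.2 htop)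
  set L : ℕ → Set (Space d) := fun j => cubeLayer x σ (σ ^ j * ρ) with hL
  have hσj : ∀ j, 0 < σ ^ j * ρ := fun j => by positivity
  have hjρ : ∀ j, σ ^ j * ρ ≤ ρ := fun j => mul_le_of_le_one_left hρ.le (pow_le_one₀ hσ0.le hσ1)
  have hLm : ∀ j, MeasurableSet (L j) := fun j => (isOpen_cubeLayer x _ _).measurableSet
  have hLQ : ∀ j, L j ⊆ openCube x ρ := fun j => (cubeLayer_subset x _ _).trans (openCube_mono (hjρ j))
  have hLd := cubeLayer_pairwise_disjoint x hσ0.le hσ1 hρ.le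
  have hQm := (isOpen_openCube x ρ).measurableSet
  have hstep : ∀ j ∈ Finset.range K, dirichletInf Φ (affineAt x (u.val x) (u.grad x))
      (openCube x (σ ^ j * ρ)) ≤ Φ w (openCube x ρ) + b * (4 ^ p *
        (affineEnergyMeasure ν u (u.grad x) (L j) + (∫⁻ y in L j, ‖w.grad y‖ₑ ^ p) +
        (1 + k ^ p) * ((∫⁻ y in L j, ‖w.val y - u.val y‖ₑ ^ p) + taylorRemainder u x (L j)))) := by
    intro j hj
    obtain ⟨χ, hχ, hχc, hχI, hχ1, hχ0, hχk⟩ := hcut x (σ ^ j * ρ) (hσj j)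
    have hkj : ∀ y, ‖fderiv ℝ χ y‖ₑ ≤ k := fun y => by
      rw [← ofReal_norm]
      refine ENNReal.ofReal_le_ofReal ((hχk y).trans ?_)
      rw [div_div]
      refine div_le_div_of_nonneg_left hN (by positivity) ?_
      exact mul_le_mul_of_nonneg_right
        (pow_le_pow_of_le_one hσ0.le hσ1 (Finset.mem_range.1 hj).le) hρ.le
    rw [← dirichletInf_congr _ hA]
    refine (hG.transition_le hp hΩ h u w A hσ0.le hσ1 (hσj j) ((openCube_mono (hjρ j)).trans hΩρ)
      hχ hχc hχI hχ1 hχ0 hkj).trans (add_le_add ?_ (mul_le_mul' le_rfl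
        (layerError_le_of_affine ν u w A hA hAg k (hLm j) ((hLQ j).trans hΩρ))))
    refine h.mono w (isOpen_openCube _ _) (isOpen_openCube _ _) (openCube_mono ?_) hΩρ
    exact (mul_le_of_le_one_left (hσj j).le hσ1).trans (hjρ j)
  refine (Finset.sum_le_sum hstep).trans ?_
  rw [Finset.sum_add_distrib, Finset.sum_const, Finset.card_range, nsmul_eq_mul, ← Finset.mul_sum,
    ← Finset.mul_sum, Finset.sum_add_distrib, Finset.sum_add_distrib, ← Finset.mul_sum,
    Finset.sum_add_distrib]
  -- Since the layers are disjoint, the error terms are paid once in total and not `K` times; only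
  -- the energy of `w` itself is multiplied by `K`.
  have s1 := sum_measure_le_of_disjoint (affineEnergyMeasure ν u (u.grad x)) (K := K) hLm hLQ hLd
  have s2 := (sum_setLIntegral_le_of_disjoint (μ := volume) (K := K) (fun y => ‖w.grad y‖ₑ ^ p) hLm hQm hLQ
    hLd).trans hgrad
  have s3 := (sum_setLIntegral_le_of_disjoint (μ := volume) (K := K) (fun y => ‖w.val y - u.val y‖ₑ ^ p)
    hLm hQm hLQ hLd).trans (lintegral_mono_set hΩρ)
  have s4 : ∑ j ∈ Finset.range K, taylorRemainder u x (L j) ≤ taylorRemainder u x (openCube x ρ) :=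
    sum_setLIntegral_le_of_disjoint (μ := volume) _ hLm hQm hLQ hLd
  calc _ ≤ K * Φ w (openCube x ρ) + b * (4 ^ p * (affineEnergyMeasure ν u (u.grad x) (openCube x ρ) +
        (ENNReal.ofReal α)⁻¹ * Φ w (openCube x ρ) + (1 + k ^ p) *
          ((∫⁻ y in Ω, ‖w.val y - u.val y‖ₑ ^ p) + taylorRemainder u x (openCube x ρ)))) := by gcongr
    _ = _ := by ring

namespace IsRegularPoint

variable {ν : Measure (Space d)} {u : SobolevMap Ω m p} {x : Space d} {g : ℝ≥0∞}

/-- The slicing estimate after passing to the limit in the parameter and in the radius. -/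
theorem mul_liminf_le (h : IsRegularPoint ν u x g) (hd : 1 ≤ d) (hp : 1 < p) (hα : 0 < α)
    (hΩ : IsOpen Ω) (hΩb : Bornology.IsBounded Ω) {b : ℝ≥0∞} (hb : b ≠ ⊤)
    {F : ℝ → SobolevMap Ω m p → Set (Space d) → ℝ≥0∞}
    (hF : ∀ ε ∈ Ioc (0 : ℝ) 1, CoerciveLocal α (F ε))
    (hG : ∀ ε ∈ Ioc (0 : ℝ) 1, DirichletGrowth (F ε) b ν)
    {W : ℝ → SobolevMap Ω m p} (hW : W ∈ approximatingFamilies u.val)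
    {σ : ℝ} (hσ0 : 0 < σ) (hσ1 : σ < 1) (K : ℕ) :
    K * (ENNReal.ofReal (σ ^ (K * d)) * liminf (fun ρ : ℝ => dirichletLiminf F
      (affineAt x (u.val x) (u.grad x)) (openCube x ρ) / ENNReal.ofReal (ρ ^ d)) (𝓝[>] 0)) ≤
    (K + b * 4 ^ p * (ENNReal.ofReal α)⁻¹) *
      liminf (fun ρ : ℝ => liminf (fun ε => F ε (W ε) (openCube x ρ)) (𝓝[>] 0) /
        ENNReal.ofReal (ρ ^ d)) (𝓝[>] 0) + b * 4 ^ p * (g + ‖u.grad x‖ₑ ^ p) := by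
  have : IsFiniteMeasure (volume.restrict Ω) := ⟨by simpa using hΩb.measure_lt_top⟩
  have hp0 : 0 < p := by linarith
  have hbt : b * 4 ^ p ≠ ⊤ := ENNReal.mul_ne_top hb (by simp)
  have hC1 : (K + b * 4 ^ p * (ENNReal.ofReal α)⁻¹ : ℝ≥0∞) ≠ ⊤ :=
    ENNReal.add_ne_top.2 ⟨by simp, ENNReal.mul_ne_top hbt (by simp [hα])⟩
  obtain ⟨N, hN, hcut⟩ := exists_cube_cutoff (d := d) hσ1
  obtain ⟨A, hA, hAg⟩ := SobolevMap.exists_affineAt (p := p) hΩ hΩb x (u.val x) (u.grad x)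
  set ℓ : ℝ → ℝ≥0∞ := fun ρ => dirichletLiminf F (affineAt x (u.val x) (u.grad x)) (openCube x ρ)
  set E : ℝ → ℝ≥0∞ := fun ρ => affineEnergyMeasure ν u (u.grad x) (openCube x ρ) +
    (1 + ENNReal.ofReal (N / σ ^ K / ρ) ^ p) * taylorRemainder u x (openCube x ρ) with hE
  have hsum : ∀ᶠ ρ in 𝓝[>] (0 : ℝ), ∑ j ∈ Finset.range K, ℓ (σ ^ j * ρ) ≤
      (K + b * 4 ^ p * (ENNReal.ofReal α)⁻¹) * liminf (fun ε => F ε (W ε) (openCube x ρ)) (𝓝[>] 0) +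
      b * 4 ^ p * E ρ := by
    filter_upwards [eventually_openCube_subset hd hΩ h.mem, self_mem_nhdsWithin] with ρ hρΩ hρ
    have hρ : 0 < ρ := hρ
    have hs := (openCube_subset_closedCube x ρ).trans hρΩ
    refine (sum_liminf_le _ _).trans ?_
    have hkt : b * 4 ^ p * (1 + ENNReal.ofReal (N / σ ^ K / ρ) ^ p) ≠ ⊤ :=
      ENNReal.mul_ne_top hbt (ENNReal.add_ne_top.2 ⟨by simp,
        ENNReal.rpow_ne_top_of_nonneg hp0.le ENNReal.ofReal_ne_top⟩)
    -- The coefficient may blow up as `ρ → 0` but is finite for fixed `ρ`, so `ε → 0` has to come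
    -- first.
    have ht := ENNReal.Tendsto.const_mul (tendsto_lintegral_of_mem_approximatingFamilies hp hW)
      (Or.inr hkt)
    rw [mul_zero] at ht
    have hev : ∀ᶠ ε in 𝓝[>] (0 : ℝ), ε ∈ Ioc (0 : ℝ) 1 := Ioc_mem_nhdsGT zero_lt_one
    refine (liminf_le_liminf (hev.mono fun ε hε => sum_dirichletInf_le hp hα hΩ (hF ε hε) (hG ε hε)
      u (W ε) A hA hAg hσ0 hσ1.le hρ hN hs hcut K)).trans ?_
    refine (liminf_add_le_of_tendsto ht).trans_eq ?_
    rw [add_zero, liminf_add_const _ _ _ (by isBoundedDefault) (by isBoundedDefault),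
      ENNReal.liminf_const_mul_of_ne_top hC1]
  have hEt : Tendsto (fun ρ : ℝ => b * 4 ^ p * (E ρ / ENNReal.ofReal (ρ ^ d))) (𝓝[>] 0)
      (𝓝 (b * 4 ^ p * (g + ‖u.grad x‖ₑ ^ p))) := by
    refine ENNReal.Tendsto.const_mul ?_ (Or.inr hbt)
    have := (h.tendsto_affineEnergyMeasure hd hΩ (u.grad x)).add
      (h.tendsto_taylorRemainder hp0 (N / σ ^ K))
    rw [add_zero] at this
    simpa only [hE, ENNReal.add_div] using this
  have hdiv : ∀ᶠ ρ in 𝓝[>] (0 : ℝ), ∑ j ∈ Finset.range K, ENNReal.ofReal ((σ ^ j) ^ d) *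
      (ℓ (σ ^ j * ρ) / ENNReal.ofReal ((σ ^ j * ρ) ^ d)) ≤
      (K + b * 4 ^ p * (ENNReal.ofReal α)⁻¹) * (liminf (fun ε => F ε (W ε) (openCube x ρ)) (𝓝[>] 0) /
        ENNReal.ofReal (ρ ^ d)) + b * 4 ^ p * (E ρ / ENNReal.ofReal (ρ ^ d)) := by
    filter_upwards [hsum] with ρ hρ
    simp only [← div_ofReal_pow_eq (pow_pos hσ0 _)]
    rw [← mul_div_assoc, ← mul_div_assoc, ← ENNReal.add_div]
    simp only [div_eq_mul_inv]
    rw [← Finset.sum_mul]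
    exact mul_le_mul' hρ le_rfl
  have hfinal := (sum_liminf_le (l := 𝓝[>] (0 : ℝ)) (Finset.range K) fun j ρ =>
    ENNReal.ofReal ((σ ^ j) ^ d) * (ℓ (σ ^ j * ρ) / ENNReal.ofReal ((σ ^ j * ρ) ^ d))).trans
      ((liminf_le_liminf hdiv).trans (liminf_add_le_of_tendsto hEt))
  rw [ENNReal.liminf_const_mul_of_ne_top hC1] at hfinal
  refine le_trans ?_ hfinal
  -- All slices have the same lower density, because dilations preserve the filter at zero; the
  -- weights `σ^(jd)` are bounded below by `σ^(Kd)`.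
  have hterm : ∀ j ∈ Finset.range K, ENNReal.ofReal (σ ^ (K * d)) * liminf (fun ρ : ℝ => ℓ ρ /
      ENNReal.ofReal (ρ ^ d)) (𝓝[>] 0) ≤ liminf (fun ρ => ENNReal.ofReal ((σ ^ j) ^ d) *
        (ℓ (σ ^ j * ρ) / ENNReal.ofReal ((σ ^ j * ρ) ^ d))) (𝓝[>] 0) := by
    intro j hj
    rw [ENNReal.liminf_const_mul_of_ne_top ENNReal.ofReal_ne_top]
    refine mul_le_mul' (ENNReal.ofReal_le_ofReal ?_) ?_
    · rw [← pow_mul]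
      exact pow_le_pow_of_le_one hσ0.le hσ1.le
        (Nat.mul_le_mul_right d (Finset.mem_range.1 hj).le)
    · conv_lhs => rw [← map_mul_left_nhdsGT_zero (pow_pos hσ0 j)]
      exact le_rfl
  refine le_trans ?_ (Finset.sum_le_sum hterm)
  rw [Finset.sum_const, Finset.card_range, nsmul_eq_mul]

/-- Lower bound of the density of the energy of approximating families. -/
theorem liminf_dirichletLiminf_le (h : IsRegularPoint ν u x g) (hd : 1 ≤ d) (hp : 1 < p)
    (hα : 0 < α) (hΩ : IsOpen Ω) (hΩb : Bornology.IsBounded Ω) {b : ℝ≥0∞} (hb : b ≠ ⊤)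
    {F : ℝ → SobolevMap Ω m p → Set (Space d) → ℝ≥0∞}
    (hF : ∀ ε ∈ Ioc (0 : ℝ) 1, CoerciveLocal α (F ε))
    (hG : ∀ ε ∈ Ioc (0 : ℝ) 1, DirichletGrowth (F ε) b ν)
    {W : ℝ → SobolevMap Ω m p} (hW : W ∈ approximatingFamilies u.val) :
    liminf (fun ρ : ℝ => dirichletLiminf F
      (affineAt x (u.val x) (u.grad x)) (openCube x ρ) / ENNReal.ofReal (ρ ^ d)) (𝓝[>] 0) ≤
      liminf (fun ρ : ℝ => liminf (fun ε => F ε (W ε) (openCube x ρ)) (𝓝[>] 0) /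
        ENNReal.ofReal (ρ ^ d)) (𝓝[>] 0) := by
  have hp0 : 0 < p := by linarith
  have hbt : b * 4 ^ p ≠ ⊤ := ENNReal.mul_ne_top hb (by simp)
  have hbt' : b * 4 ^ p * (ENNReal.ofReal α)⁻¹ ≠ ⊤ := ENNReal.mul_ne_top hbt (by simp [hα])
  have hct : g + ‖u.grad x‖ₑ ^ p ≠ ⊤ := ENNReal.add_ne_top.2 ⟨h.ne_top,
    ENNReal.rpow_ne_top_of_nonneg hp0.le (by finiteness)⟩
  have hmul := fun σ hσ0 hσ1 K => h.mul_liminf_le hd hp hα hΩ hΩb hb hF hG hW (σ := σ) hσ0 hσ1 K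
  set D := liminf (fun ρ : ℝ => dirichletLiminf F
      (affineAt x (u.val x) (u.grad x)) (openCube x ρ) / ENNReal.ofReal (ρ ^ d)) (𝓝[>] 0)
  set Λ := liminf (fun ρ : ℝ => liminf (fun ε => F ε (W ε) (openCube x ρ)) (𝓝[>] 0) /
        ENNReal.ofReal (ρ ^ d)) (𝓝[>] 0)
  by_cases hΛ : Λ = ⊤
  · rw [hΛ]; exact le_top
  have hK : ∀ K : ℕ, K * D ≤ (K + b * 4 ^ p * (ENNReal.ofReal α)⁻¹) * Λ +
      b * 4 ^ p * (g + ‖u.grad x‖ₑ ^ p) := by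
    intro K
    -- With `K` fixed, `σ → 1` removes the weight, and the right side does not involve `σ`.
    have t1 : Tendsto (fun σ : ℝ => ENNReal.ofReal (σ ^ (K * d))) (𝓝[<] 1)
        (𝓝 (ENNReal.ofReal (1 ^ (K * d)))) :=
      ((ENNReal.continuous_ofReal.comp (continuous_pow _)).tendsto 1).mono_left nhdsWithin_le_nhds
    rw [one_pow, ENNReal.ofReal_one] at t1
    have t2 := ENNReal.Tendsto.const_mul (a := (K : ℝ≥0∞))
      (ENNReal.Tendsto.mul_const (b := D) t1 (Or.inl one_ne_zero)) (Or.inr (by simp))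
    rw [one_mul] at t2
    refine le_of_tendsto t2 ?_
    filter_upwards [Ioo_mem_nhdsLT (show (0 : ℝ) < 1 by norm_num)] with σ hσ
    exact hmul σ hσ.1 hσ.2 K
  set C := b * 4 ^ p * (ENNReal.ofReal α)⁻¹ * Λ + b * 4 ^ p * (g + ‖u.grad x‖ₑ ^ p) with hC
  have hCt : C ≠ ⊤ := ENNReal.add_ne_top.2 ⟨ENNReal.mul_ne_top hbt' hΛ, ENNReal.mul_ne_top hbt hct⟩
  -- Dividing by `K` leaves an error `C / K`; here `C` is finite because `Λ` is.
  have t3 : Tendsto (fun K : ℕ => Λ + C / K) atTop (𝓝 (Λ + 0)) := by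
    refine tendsto_const_nhds.add ?_
    have := ENNReal.Tendsto.const_div (a := C) ENNReal.tendsto_nat_nhds_top (Or.inr hCt)
    rwa [ENNReal.div_top] at this
  rw [add_zero] at t3
  refine ge_of_tendsto t3 ?_
  filter_upwards [eventually_gt_atTop 0] with K hK0
  have hK0' : (K : ℝ≥0∞) ≠ 0 := by exact_mod_cast hK0.ne'
  have hKt : (K : ℝ≥0∞) ≠ ⊤ := by simp
  rw [← ENNReal.mul_le_mul_iff_right hK0' hKt, mul_add, ENNReal.mul_div_cancel hK0' hKt]
  refine (hK K).trans_eq ?_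
  rw [hC]; ring

/-- The comparison with the affine expansion bounds the upper density by `limitIntegrand`.
Conversely, (H0) bounds `limitIntegrand` by the lower density of `m₋`, hence of `m₊`, for the affine
expansion, and the reverse comparison passes to `u`. -/
theorem tendsto_dirichletLimsup_div (h : IsRegularPoint ν u x g) (hd : 1 ≤ d) (hp : 1 < p)
    (hΩ : IsOpen Ω) (hΩb : Bornology.IsBounded Ω) [IsFiniteMeasure ν] (hν : ν ≪ volume)
    {b : ℝ≥0∞} (hb : b ≠ ⊤)
    {F : ℝ → SobolevMap Ω m p → Set (Space d) → ℝ≥0∞}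
    (hF : ∀ ε ∈ Ioc (0 : ℝ) 1, CoerciveLocal α (F ε))
    (hG : ∀ ε ∈ Ioc (0 : ℝ) 1, DirichletGrowth (F ε) b ν)
    (hH : limitIntegrand F x (u.val x) (u.grad x) ≤
      liminf (fun ρ : ℝ => dirichletLiminf F (affineAt x (u.val x) (u.grad x)) (openCube x ρ) /
        ENNReal.ofReal (ρ ^ d)) (𝓝[>] (0 : ℝ))) :
    Tendsto (fun ρ : ℝ => dirichletLimsup F u.val (openCube x ρ) / ENNReal.ofReal (ρ ^ d)) (𝓝[>] 0)
      (𝓝 (limitIntegrand F x (u.val x) (u.grad x))) := by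
  have hev : ∀ᶠ ε in 𝓝[>] (0 : ℝ), ε ∈ Ioc (0 : ℝ) 1 := Ioc_mem_nhdsGT zero_lt_one
  have key : ∀ w₁ w₂ : Space d → Space m, ∀ σ ρ : ℝ, ∀ δ : ℝ≥0∞, 0 < σ → σ < 1 → 0 < ρ →
      (∀ ε ∈ Ioc (0 : ℝ) 1, dirichletInf (F ε) w₁ (openCube x ρ) ≤
        dirichletInf (F ε) w₂ (openCube x (σ * ρ)) + δ * ENNReal.ofReal (ρ ^ d)) →
      dirichletLimsup F w₁ (openCube x ρ) / ENNReal.ofReal (ρ ^ d) ≤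
        dirichletLimsup F w₂ (openCube x (σ * ρ)) / ENNReal.ofReal ((σ * ρ) ^ d) + δ := by
    intro w₁ w₂ σ ρ δ hσ0 hσ1 hρ hle
    have h1 : dirichletLimsup F w₁ (openCube x ρ) ≤ dirichletLimsup F w₂ (openCube x (σ * ρ)) +
        δ * ENNReal.ofReal (ρ ^ d) := by
      refine (limsup_le_limsup (hev.mono hle)).trans_eq ?_
      rw [limsup_add_const _ _ _ (by isBoundedDefault) (by isBoundedDefault)]
      rfl
    refine (ENNReal.div_le_div_right h1 _).trans ?_
    rw [ENNReal.add_div, mul_div_assoc, ENNReal.div_self (ofReal_pow_ne_zero hρ)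
      ENNReal.ofReal_ne_top, mul_one]
    -- As `σ < 1`, replacing `ρ^d` by `(σρ)^d` in the denominator only enlarges the quotient.
    refine add_le_add (ENNReal.div_le_div_left (ENNReal.ofReal_le_ofReal ?_) _) le_rfl
    exact pow_le_pow_left₀ (by positivity) (mul_le_of_le_one_left hρ.le hσ1.le) d
  refine tendsto_of_le_liminf_of_limsup_le ?_ ?_
  · refine hH.trans ((liminf_le_liminf (Eventually.of_forall fun ρ => ?_)).trans
      (liminf_nhdsGT_zero_le_of_dilation (f := fun ρ : ℝ => dirichletLimsup F
        (affineAt x (u.val x) (u.grad x)) (openCube x ρ) / ENNReal.ofReal (ρ ^ d)) fun δ hδ => ?_))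
    · exact ENNReal.div_le_div_right liminf_le_limsup _
    · obtain ⟨σ, hσ0, hσ1, hσ⟩ := h.exists_dilation hd hp hΩ hΩb hν hb hF hG hδ
      refine ⟨σ, hσ0, ?_⟩
      filter_upwards [hσ, self_mem_nhdsWithin] with ρ h1 hρ
      exact key _ _ σ ρ δ hσ0 hσ1 hρ fun ε hε => (h1 ε hε).1
  · refine limsup_nhdsGT_zero_le_of_dilation (g := fun ρ : ℝ => dirichletLimsup F
        (affineAt x (u.val x) (u.grad x)) (openCube x ρ) / ENNReal.ofReal (ρ ^ d)) fun δ hδ => ?_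
    obtain ⟨σ, hσ0, hσ1, hσ⟩ := h.exists_dilation hd hp hΩ hΩb hν hb hF hG hδ
    refine ⟨σ, hσ0, ?_⟩
    filter_upwards [hσ, self_mem_nhdsWithin] with ρ h1 hρ
    exact key _ _ σ ρ δ hσ0 hσ1 hρ fun ε hε => (h1 ε hε).2

end IsRegularPoint

end LowerDensity

/-! ### Measurability of the limit integrand along `u`. -/

section Measurability

variable {d m : ℕ} {Ω : Set (Space d)} {p α : ℝ} {b : ℝ≥0∞} {ν : Measure (Space d)}
  {F : ℝ → SobolevMap Ω m p → Set (Space d) → ℝ≥0∞}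

theorem eventually_mem_Ioc_zero_one : ∀ᶠ ε in 𝓝[>] (0 : ℝ), ε ∈ Ioc (0 : ℝ) 1 :=
  Ioc_mem_nhdsGT zero_lt_one

theorem DirichletGrowth.le_energyMeasure {Φ : SobolevMap Ω m p → Set (Space d) → ℝ≥0∞}
    (hG : DirichletGrowth Φ b ν) (u : SobolevMap Ω m p) {V : Set (Space d)} (hV : IsOpen V)
    (hVΩ : V ⊆ Ω) : dirichletInf Φ u.val V ≤ b * energyMeasure ν u V := by
  rw [energyMeasure_apply ν u hV.measurableSet hVΩ]
  exact hG V hV hVΩ u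

theorem dirichletLimsup_le_energyMeasure
    (hG : ∀ ε ∈ Ioc (0 : ℝ) 1, DirichletGrowth (F ε) b ν) (u : SobolevMap Ω m p)
    {V : Set (Space d)} (hV : IsOpen V) (hVΩ : V ⊆ Ω) :
    dirichletLimsup F u.val V ≤ b * energyMeasure ν u V :=
  limsup_le_of_le (by isBoundedDefault) (eventually_mem_Ioc_zero_one.mono fun ε hε =>
    (hG ε hε).le_energyMeasure u hV hVΩ)

/-- Monotonicity of `b E - m₊(u; ·)` on cubes, with `E` the energy measure, in a form without
subtraction: enlarging a cube raises `m₊` by at most `b` times the energy added. -/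
theorem dirichletLimsup_add_le (hp : 1 < p) (hΩ : IsOpen Ω) [IsFiniteMeasure (volume.restrict Ω)]
    (hF : ∀ ε ∈ Ioc (0 : ℝ) 1, CoerciveLocal α (F ε))
    (hG : ∀ ε ∈ Ioc (0 : ℝ) 1, DirichletGrowth (F ε) b ν) (u : SobolevMap Ω m p)
    {x y : Space d} {r s : ℝ} (hr : 0 ≤ r) (hsub : openCube y r ⊆ openCube x s) :
    dirichletLimsup F u.val (openCube x s ∩ Ω) + b * energyMeasure ν u (openCube y r ∩ Ω) ≤
      dirichletLimsup F u.val (openCube y r ∩ Ω) + b * energyMeasure ν u (openCube x s ∩ Ω) := by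
  have hA : IsOpen (openCube y r ∩ Ω) := (isOpen_openCube y r).inter hΩ
  have hB : IsOpen (openCube x s ∩ Ω) := (isOpen_openCube x s).inter hΩ
  set L := (openCube x s ∩ Ω) \ closedCube y r with hL
  have hLo : IsOpen L := hB.sdiff (isClosed_closedCube y r)
  have hAB : openCube y r ∩ Ω ⊆ openCube x s ∩ Ω := inter_subset_inter_left Ω hsub
  have hLB : L ⊆ openCube x s ∩ Ω := sdiff_subset
  have hd : Disjoint (openCube y r ∩ Ω) L :=
    disjoint_left.2 fun z hz hz' => hz'.2 (openCube_subset_closedCube _ _ hz.1)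
  have h0 : volume ((openCube x s ∩ Ω) \ ((openCube y r ∩ Ω) ∪ L)) = 0 := by
    refine measure_mono_null ?_ (volume_closedCube_diff_openCube y hr)
    intro z hz
    refine ⟨?_, fun h => hz.2 (Or.inl ⟨h, hz.1.2⟩)⟩
    by_contra hc
    exact hz.2 (Or.inr ⟨hz.1, hc⟩)
  have h1 : dirichletLimsup F u.val (openCube x s ∩ Ω) ≤
      dirichletLimsup F u.val (openCube y r ∩ Ω) + b * energyMeasure ν u L := by
    refine (limsup_le_limsup (eventually_mem_Ioc_zero_one.mono fun ε hε =>
      (hG ε hε).dirichletInf_le_add_of_subset hp hΩ (hF ε hε) u hA hLo hB hAB hLB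
        inter_subset_right hd h0)).trans_eq ?_
    rw [← energyMeasure_apply ν u hLo.measurableSet (hLB.trans inter_subset_right),
      limsup_add_const _ _ _ (by isBoundedDefault) (by isBoundedDefault)]
    rfl
  refine (add_le_add h1 le_rfl).trans ?_
  rw [add_assoc, ← mul_add, add_comm (energyMeasure ν u L),
    ← measure_union hd hLo.measurableSet]
  exact add_le_add le_rfl (mul_le_mul' le_rfl (measure_mono (union_subset hAB hLB)))

/-- The gap between the energy bound and the asymptotic Dirichlet infimum on a cube. -/
noncomputable def dirichletGap (F : ℝ → SobolevMap Ω m p → Set (Space d) → ℝ≥0∞) (b : ℝ≥0∞)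
    (ν : Measure (Space d)) (u : SobolevMap Ω m p) (x : Space d) (ρ : ℝ) : ℝ≥0∞ :=
  b * energyMeasure ν u (openCube x ρ ∩ Ω) - dirichletLimsup F u.val (openCube x ρ ∩ Ω)

theorem dirichletGap_mono (hp : 1 < p) (hΩ : IsOpen Ω) [IsFiniteMeasure (volume.restrict Ω)]
    [IsFiniteMeasure ν] (hb : b ≠ ⊤)
    (hF : ∀ ε ∈ Ioc (0 : ℝ) 1, CoerciveLocal α (F ε))
    (hG : ∀ ε ∈ Ioc (0 : ℝ) 1, DirichletGrowth (F ε) b ν) (u : SobolevMap Ω m p)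
    {x y : Space d} {r s : ℝ} (hr : 0 ≤ r) (hsub : openCube y r ⊆ openCube x s) :
    dirichletGap F b ν u y r ≤ dirichletGap F b ν u x s := by
  have hfin := isFiniteMeasure_energyMeasure hp ν u
  have h1 := dirichletLimsup_add_le hp hΩ hF hG u hr hsub
  have h2 := dirichletLimsup_le_energyMeasure hG u ((isOpen_openCube x s).inter hΩ) inter_subset_right
  have h3 : dirichletLimsup F u.val (openCube x s ∩ Ω) ≠ ⊤ :=
    ne_top_of_le_ne_top (ENNReal.mul_ne_top hb (measure_ne_top _ _)) h2
  unfold dirichletGap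
  refine tsub_le_iff_right.2 ?_
  rw [← ENNReal.add_le_add_iff_left h3]
  refine h1.trans_eq ?_
  rw [← add_assoc, add_tsub_cancel_of_le h2, add_comm]

/-- The function is upper semicontinuous. If the gap at `x` and radius `r > ρ` is below `a`, a cube
of edge `s` between `ρ` and `r` centred near `x` still lies in `Q_r(x)`, and monotonicity applies.
The infimum over larger radii provides this room. -/
theorem measurable_iInf_dirichletGap (hp : 1 < p) (hΩ : IsOpen Ω)
    [IsFiniteMeasure (volume.restrict Ω)] [IsFiniteMeasure ν] (hb : b ≠ ⊤)
    (hF : ∀ ε ∈ Ioc (0 : ℝ) 1, CoerciveLocal α (F ε))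
    (hG : ∀ ε ∈ Ioc (0 : ℝ) 1, DirichletGrowth (F ε) b ν) (u : SobolevMap Ω m p)
    {ρ : ℝ} (hρ : 0 ≤ ρ) :
    Measurable fun x => ⨅ r ∈ Ioi ρ, dirichletGap F b ν u x r := by
  refine measurable_of_Iio fun a => IsOpen.measurableSet ?_
  rw [Metric.isOpen_iff]
  intro x hx
  simp only [mem_preimage, mem_Iio, iInf_lt_iff] at hx
  obtain ⟨r, hr, hlt⟩ := hx
  have hr : ρ < r := hr
  obtain ⟨s, hs1, hs2⟩ := exists_between hr
  refine ⟨(r - s) / 2, by linarith, fun y hy => ?_⟩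
  simp only [mem_preimage, mem_Iio, iInf_lt_iff]
  refine ⟨s, hs1, (dirichletGap_mono hp hΩ hb hF hG u (by linarith) ?_).trans_lt hlt⟩
  refine openCube_subset_openCube_of_dist ?_
  rw [Metric.mem_ball] at hy
  linarith

theorem IsRegularPoint.tendsto_dirichletGap {u : SobolevMap Ω m p} {x : Space d} {g : ℝ≥0∞}
    (h : IsRegularPoint ν u x g) (hd : 1 ≤ d) (hΩ : IsOpen Ω) (hb : b ≠ ⊤) {c : ℝ≥0∞}
    (hc : Tendsto (fun ρ : ℝ => dirichletLimsup F u.val (openCube x ρ) / ENNReal.ofReal (ρ ^ d))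
      (𝓝[>] 0) (𝓝 c)) :
    Tendsto (fun ρ : ℝ => dirichletGap F b ν u x ρ / ENNReal.ofReal (ρ ^ d)) (𝓝[>] 0)
      (𝓝 (b * g - c)) := by
  have h1 := ENNReal.Tendsto.const_mul h.tendsto_density (Or.inr hb)
  refine (ENNReal.Tendsto.sub h1 hc (Or.inl (ENNReal.mul_ne_top hb h.ne_top))).congr' ?_
  filter_upwards [eventually_openCube_subset hd hΩ h.mem, self_mem_nhdsWithin] with ρ hρΩ hρ
  have hρ : 0 < ρ := hρ
  have hs := (openCube_subset_closedCube x ρ).trans hρΩ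
  rw [dirichletGap, inter_eq_left.2 hs, ENNReal.div_eq_inv_mul, ENNReal.div_eq_inv_mul,
    ENNReal.div_eq_inv_mul, ENNReal.mul_sub fun _ _ => ENNReal.inv_ne_top.2 (ofReal_pow_ne_zero hρ),
    mul_left_comm]

/-- The infimum lies between the gaps at `ρ` and at `(1 + ρ) ρ`, and the volume ratio `(1 + ρ)^d` of
these cubes tends to one; the density is unchanged. -/
theorem IsRegularPoint.tendsto_iInf_dirichletGap (hp : 1 < p)
    [IsFiniteMeasure (volume.restrict Ω)] [IsFiniteMeasure ν]
    (hF : ∀ ε ∈ Ioc (0 : ℝ) 1, CoerciveLocal α (F ε))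
    (hG : ∀ ε ∈ Ioc (0 : ℝ) 1, DirichletGrowth (F ε) b ν)
    {u : SobolevMap Ω m p} {x : Space d} {g : ℝ≥0∞}
    (h : IsRegularPoint ν u x g) (hd : 1 ≤ d) (hΩ : IsOpen Ω) (hb : b ≠ ⊤) {c : ℝ≥0∞}
    (hc : Tendsto (fun ρ : ℝ => dirichletLimsup F u.val (openCube x ρ) / ENNReal.ofReal (ρ ^ d))
      (𝓝[>] 0) (𝓝 c)) :
    Tendsto (fun ρ : ℝ => (⨅ r ∈ Ioi ρ, dirichletGap F b ν u x r) / ENNReal.ofReal (ρ ^ d))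
      (𝓝[>] 0) (𝓝 (b * g - c)) := by
  have h1 := h.tendsto_dirichletGap hd hΩ hb hc
  have hcont : Tendsto (fun ρ : ℝ => (1 + ρ) * ρ) (𝓝[>] 0) (𝓝[>] 0) := by
    refine tendsto_nhdsWithin_iff.2 ⟨?_, ?_⟩
    · have : Continuous fun ρ : ℝ => (1 + ρ) * ρ := by fun_prop
      have := (this.tendsto 0).mono_left (nhdsWithin_le_nhds (s := Ioi 0))
      simpa using this
    · filter_upwards [self_mem_nhdsWithin] with ρ hρ
      have hρ : 0 < ρ := hρ
      exact show 0 < (1 + ρ) * ρ by positivity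
  have hone : Tendsto (fun ρ : ℝ => ENNReal.ofReal ((1 + ρ) ^ d)) (𝓝[>] 0) (𝓝 1) := by
    have : Continuous fun ρ : ℝ => ENNReal.ofReal ((1 + ρ) ^ d) :=
      ENNReal.continuous_ofReal.comp (by fun_prop)
    have := (this.tendsto 0).mono_left (nhdsWithin_le_nhds (s := Ioi 0))
    simpa using this
  have hbg : b * g - c ≠ ⊤ := ENNReal.sub_ne_top (ENNReal.mul_ne_top hb h.ne_top)
  have h2 := ENNReal.Tendsto.mul hone (Or.inl one_ne_zero) (h1.comp hcont) (Or.inr (by simp))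
  rw [one_mul] at h2
  refine tendsto_of_tendsto_of_tendsto_of_le_of_le' h1 h2 ?_ ?_
  · filter_upwards [self_mem_nhdsWithin] with ρ hρ
    have hρ : 0 < ρ := hρ
    refine ENNReal.div_le_div_right (le_iInf₂ fun r hr => ?_) _
    exact dirichletGap_mono hp hΩ hb hF hG u hρ.le (openCube_mono (le_of_lt hr))
  · filter_upwards [self_mem_nhdsWithin] with ρ hρ
    have hρ : 0 < ρ := hρ
    simp only [Function.comp]
    rw [← div_ofReal_pow_eq (show 0 < 1 + ρ by linarith)]
    refine ENNReal.div_le_div_right (iInf₂_le _ ?_) _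
    exact show ρ < (1 + ρ) * ρ by nlinarith

theorem IsRegularPoint.le_mul_density {u : SobolevMap Ω m p} {x : Space d} {g : ℝ≥0∞}
    (h : IsRegularPoint ν u x g) (hd : 1 ≤ d) (hΩ : IsOpen Ω) (hb : b ≠ ⊤) {c : ℝ≥0∞}
    (hG : ∀ ε ∈ Ioc (0 : ℝ) 1, DirichletGrowth (F ε) b ν)
    (hc : Tendsto (fun ρ : ℝ => dirichletLimsup F u.val (openCube x ρ) / ENNReal.ofReal (ρ ^ d))
      (𝓝[>] 0) (𝓝 c)) : c ≤ b * g := by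
  refine le_of_tendsto_of_tendsto hc (ENNReal.Tendsto.const_mul h.tendsto_density (Or.inr hb)) ?_
  filter_upwards [eventually_openCube_subset hd hΩ h.mem] with ρ hρΩ
  rw [← mul_div_assoc]
  exact ENNReal.div_le_div_right (dirichletLimsup_le_energyMeasure hG u (isOpen_openCube x ρ)
    ((openCube_subset_closedCube x ρ).trans hρΩ)) _

/-- A density of the asymptotic Dirichlet infima is measurable. -/
theorem aemeasurable_of_tendsto_dirichletLimsup_div (hd : 1 ≤ d) (hp : 1 < p) (hΩ : IsOpen Ω)
    [IsFiniteMeasure (volume.restrict Ω)] [IsFiniteMeasure ν] (hν : ν ≪ volume) (hb : b ≠ ⊤)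
    (hF : ∀ ε ∈ Ioc (0 : ℝ) 1, CoerciveLocal α (F ε))
    (hG : ∀ ε ∈ Ioc (0 : ℝ) 1, DirichletGrowth (F ε) b ν) (u : SobolevMap Ω m p)
    {O : Set (Space d)} (hOΩ : O ⊆ Ω) {f : Space d → ℝ≥0∞}
    (hf : ∀ᵐ x ∂volume.restrict O, Tendsto (fun ρ : ℝ => dirichletLimsup F u.val (openCube x ρ) /
      ENNReal.ofReal (ρ ^ d)) (𝓝[>] 0) (𝓝 (f x))) :
    AEMeasurable f (volume.restrict O) ∧
      ∀ᵐ x ∂volume.restrict O, f x ≤ b * (energyMeasure ν u).rnDeriv volume x ∧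
        b * (energyMeasure ν u).rnDeriv volume x ≠ ⊤ := by
  set g := (energyMeasure ν u).rnDeriv volume with hg
  have hreg := ae_restrict_of_ae_restrict_of_subset hOΩ (ae_isRegularPoint hd hp hΩ hν u)
  have hle : ∀ᵐ x ∂volume.restrict O, f x ≤ b * g x ∧ b * g x ≠ ⊤ := by
    filter_upwards [hreg, hf] with x h1 h2
    exact ⟨h1.le_mul_density hd hΩ hb hG h2, ENNReal.mul_ne_top hb h1.ne_top⟩
  refine ⟨?_, hle⟩
  have hgm : AEMeasurable (fun x => b * g x) (volume.restrict O) :=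
    ((Measure.measurable_rnDeriv _ _).const_mul b).aemeasurable
  have hseq : Tendsto (fun n : ℕ => 1 / ((n : ℝ) + 1)) atTop (𝓝[>] 0) :=
    tendsto_nhdsWithin_iff.2 ⟨tendsto_one_div_add_atTop_nhds_zero_nat,
      Eventually.of_forall fun n => show (0 : ℝ) < 1 / ((n : ℝ) + 1) by positivity⟩
  have hgap : AEMeasurable (fun x => b * g x - f x) (volume.restrict O) := by
    refine aemeasurable_of_tendsto_metrizable_ae atTop (f := fun (n : ℕ) x =>
      (⨅ r ∈ Ioi (1 / ((n : ℝ) + 1)), dirichletGap F b ν u x r) /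
        ENNReal.ofReal ((1 / ((n : ℝ) + 1)) ^ d)) (fun n => ?_) ?_
    · exact ((measurable_iInf_dirichletGap hp hΩ hb hF hG u (by positivity)).div_const _).aemeasurable
    · filter_upwards [hreg, hf] with x h1 h2
      exact (h1.tendsto_iInf_dirichletGap hp hF hG hd hΩ hb h2).comp hseq
  -- The density `f` is recovered as `b g - (b g - f)`, which is legitimate because `f ≤ b g < ∞`
  -- almost everywhere.
  refine (hgm.sub hgap).congr ?_
  filter_upwards [hle] with x hx
  exact ENNReal.sub_sub_cancel hx.2 hx.1

theorem lintegral_density_ne_top (hp : 1 < p) [IsFiniteMeasure ν] (hν : ν ≪ volume) (hb : b ≠ ⊤)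
    (u : SobolevMap Ω m p) {O : Set (Space d)} {f : Space d → ℝ≥0∞}
    (hle : ∀ᵐ x ∂volume.restrict O, f x ≤ b * (energyMeasure ν u).rnDeriv volume x) :
    ∫⁻ x in O, f x ≠ ⊤ := by
  have hfin := isFiniteMeasure_energyMeasure hp ν u
  refine ne_top_of_le_ne_top (ENNReal.mul_ne_top hb (measure_ne_top (energyMeasure ν u) O))
    ((lintegral_mono_ae hle).trans_eq ?_)
  rw [lintegral_const_mul _ (Measure.measurable_rnDeriv _ _),
    Measure.setLIntegral_rnDeriv (energyMeasure_absolutelyContinuous hν u)]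

end Measurability

/-! ### The liminf inequality by Vitali covering. -/

section LowerBound

variable {d m : ℕ} {Ω : Set (Space d)} {p α : ℝ}
  {F : ℝ → SobolevMap Ω m p → Set (Space d) → ℝ≥0∞}

theorem ae_tendsto_setLIntegral_openCube_div (hd : 1 ≤ d) {O : Set (Space d)} (hO : IsOpen O)
    {f : Space d → ℝ≥0∞} (hf : AEMeasurable f (volume.restrict O)) (hfi : ∫⁻ x in O, f x ≠ ⊤) :
    ∀ᵐ x ∂volume.restrict O, Tendsto (fun ρ : ℝ => (∫⁻ y in openCube x ρ, f y) /
      ENNReal.ofReal (ρ ^ d)) (𝓝[>] 0) (𝓝 (f x)) := by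
  have h1 : AEMeasurable (O.indicator f) := (aemeasurable_indicator_iff hO.measurableSet).2 hf
  have h2 : ∫⁻ x, O.indicator f x ≠ ⊤ := by rwa [lintegral_indicator hO.measurableSet]
  filter_upwards [ae_restrict_of_ae (ae_tendsto_lintegral_openCube_div h1 h2),
    ae_restrict_mem hO.measurableSet] with x hx hxO
  rw [indicator_of_mem hxO] at hx
  refine hx.congr' ?_
  filter_upwards [eventually_openCube_subset hd hO hxO] with ρ hρ
  congr 1
  refine setLIntegral_congr_fun (isOpen_openCube x ρ).measurableSet fun y hy => ?_
  exact indicator_of_mem (hρ (openCube_subset_closedCube _ _ hy)) f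

theorem setLIntegral_eq_tsum_of_covering {X ι : Type*} [MeasurableSpace X] [Countable ι]
    {μ : Measure X} {O : Set X} {Q : ι → Set X} (hQ : ∀ i, MeasurableSet (Q i))
    (hQO : ∀ i, Q i ⊆ O) (hd : Pairwise (Function.onFun Disjoint Q))
    (h0 : μ (O \ ⋃ i, Q i) = 0) (f : X → ℝ≥0∞) :
    ∫⁻ x in O, f x ∂μ = ∑' i, ∫⁻ x in Q i, f x ∂μ := by
  rw [← lintegral_iUnion hQ hd]
  refine (setLIntegral_congr (((iUnion_subset hQO : (⋃ i, Q i) ≤ O).eventuallyLE).antisymm ?_)).symm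
  exact ae_le_set.2 h0

/-- The liminf inequality, for a density of the energy of an approximating family. -/
theorem lintegral_le_liminf (hd : 1 ≤ d) (hΩb : Bornology.IsBounded Ω)
    (hF : ∀ ε ∈ Ioc (0 : ℝ) 1, CoerciveLocal α (F ε)) {O : Set (Space d)} (hO : IsOpen O)
    (hOΩ : O ⊆ Ω) {f : Space d → ℝ≥0∞} (hf : AEMeasurable f (volume.restrict O))
    (hfi : ∫⁻ x in O, f x ≠ ⊤) (hft : ∀ᵐ x ∂volume.restrict O, f x ≠ ⊤)
    (W : ℝ → SobolevMap Ω m p) (hW : ∀ᵐ x ∂volume.restrict O,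
      f x ≤ liminf (fun ρ : ℝ => liminf (fun ε => F ε (W ε) (openCube x ρ)) (𝓝[>] 0) /
        ENNReal.ofReal (ρ ^ d)) (𝓝[>] 0)) :
    ∫⁻ x in O, f x ≤ liminf (fun ε => F ε (W ε) O) (𝓝[>] 0) := by
  have hvO : volume O ≠ ⊤ := (hΩb.subset hOΩ).measure_lt_top.ne
  -- One `δ` comes from Lebesgue differentiation of `f`, the other from the lower density of the
  -- energies.
  have key : ∀ δ : ℝ≥0∞, 0 < δ → ∫⁻ x in O, f x ≤
      liminf (fun ε => F ε (W ε) O) (𝓝[>] 0) + (δ + δ) * volume O := by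
    intro δ hδ
    have hP : ∀ᵐ x ∂volume.restrict O, ∀ᶠ ρ in 𝓝[>] (0 : ℝ), ∫⁻ y in openCube x ρ, f y ≤
        liminf (fun ε => F ε (W ε) (openCube x ρ)) (𝓝[>] 0) + (δ + δ) * volume (openCube x ρ) := by
      filter_upwards [ae_tendsto_setLIntegral_openCube_div hd hO hf hfi, hft, hW] with x h1 h2 h3
      have h4 : ∀ᶠ ρ in 𝓝[>] (0 : ℝ), f x ≤
          liminf (fun ε => F ε (W ε) (openCube x ρ)) (𝓝[>] 0) / ENNReal.ofReal (ρ ^ d) + δ := by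
        rcases eq_or_ne (f x) 0 with h0 | h0
        · simp [h0]
        · filter_upwards [eventually_lt_of_lt_liminf ((ENNReal.sub_lt_self h2 h0 hδ.ne').trans_le h3)]
            with ρ hρ using tsub_le_iff_right.1 hρ.le
      filter_upwards [h1.eventually_lt_const (ENNReal.lt_add_right h2 hδ.ne'), h4,
        self_mem_nhdsWithin] with ρ h5 h6 hρ
      have hρ : 0 < ρ := hρ
      have h7 := h5.le.trans (add_le_add h6 le_rfl)
      rw [ENNReal.div_le_iff (ofReal_pow_ne_zero hρ) ENNReal.ofReal_ne_top, add_assoc, add_mul,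
        ENNReal.div_mul_cancel (ofReal_pow_ne_zero hρ) ENNReal.ofReal_ne_top] at h7
      rwa [volume_openCube x hρ.le]
    obtain ⟨t, htc, ht, htd, ht0⟩ := exists_disjoint_openCube_covering hO (P := fun x ρ =>
      ∫⁻ y in openCube x ρ, f y ≤ liminf (fun ε => F ε (W ε) (openCube x ρ)) (𝓝[>] 0) +
        (δ + δ) * volume (openCube x ρ)) hP one_pos
    have hle : ∀ c : t, ∫⁻ y in openCube c.1.1 c.1.2, f y ≤
        liminf (fun ε => F ε (W ε) (openCube c.1.1 c.1.2)) (𝓝[>] 0) +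
          (δ + δ) * volume (openCube c.1.1 c.1.2) := fun c => (ht c.1 c.2).2.2.2
    have := htc.to_subtype
    have hQO : ∀ c : t, openCube c.1.1 c.1.2 ⊆ O := fun c =>
      (openCube_subset_closedCube _ _).trans (ht c.1 c.2).2.2.1
    have hQm : ∀ c : t, MeasurableSet (openCube c.1.1 c.1.2) := fun c =>
      (isOpen_openCube _ _).measurableSet
    refine (setLIntegral_eq_tsum_of_covering (Q := fun c : t => openCube c.1.1 c.1.2) hQm hQO htd
      ht0 f).trans_le ?_
    refine (ENNReal.tsum_le_tsum hle).trans ?_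
    rw [ENNReal.tsum_add, ENNReal.tsum_mul_left, ← measure_iUnion htd hQm]
    refine add_le_add ?_ (mul_le_mul' le_rfl (measure_mono (iUnion_subset hQO)))
    -- Superadditivity of the lower limit is used for finite subfamilies of cubes; each partial sum
    -- of energies is then at most the energy on `O`.
    rw [ENNReal.tsum_eq_iSup_sum]
    refine iSup_le fun s => (sum_liminf_le s _).trans (liminf_le_liminf
      (eventually_mem_Ioc_zero_one.mono fun ε hε => ?_))
    exact (ENNReal.sum_le_tsum s).trans ((hF ε hε).tsum_le (W ε) hO hOΩ
      (fun c => isOpen_openCube _ _) hQO htd)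
  have ht : Tendsto (fun δ : ℝ≥0∞ => liminf (fun ε => F ε (W ε) O) (𝓝[>] 0) + (δ + δ) * volume O)
      (𝓝[>] 0) (𝓝 (liminf (fun ε => F ε (W ε) O) (𝓝[>] 0) + (0 + 0) * volume O)) := by
    have h0 : Tendsto (fun δ : ℝ≥0∞ => δ) (𝓝[>] 0) (𝓝 0) := nhdsWithin_le_nhds
    exact tendsto_const_nhds.add (ENNReal.Tendsto.mul_const (h0.add h0) (Or.inr hvO))
  rw [add_zero, zero_mul, add_zero] at ht
  refine ge_of_tendsto ht ?_
  filter_upwards [self_mem_nhdsWithin] with δ hδ using key δ hδ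

end LowerBound

/-- Reverse Fatou lemma for series: the summable majorant makes tails uniformly small and reduces
the claim to finite sums. -/
theorem limsup_tsum_le {ι κ : Type*} {l : Filter ι} [l.NeBot] {f : κ → ι → ℝ≥0∞} {g : κ → ℝ≥0∞}
    (hfg : ∀ᶠ i in l, ∀ k, f k i ≤ g k) (hg : ∑' k, g k ≠ ⊤) :
    limsup (fun i => ∑' k, f k i) l ≤ ∑' k, limsup (f k) l := by
  refine ENNReal.le_of_forall_pos_le_add fun δ hδ _ => ?_
  have hδ' : (0 : ℝ≥0∞) < δ := by exact_mod_cast hδ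
  classical
  obtain ⟨s, hs⟩ : ∃ s : Finset κ, ∑' k, g k < ∑ k ∈ s, g k + δ := by
    have h0 : Tendsto (fun s : Finset κ => ∑ k ∈ s, g k + δ) atTop (𝓝 (∑' k, g k + δ)) :=
      Tendsto.add (ENNReal.summable (f := g)).hasSum tendsto_const_nhds
    exact (h0.eventually_const_lt (ENNReal.lt_add_right hg hδ'.ne')).exists
  have hst : ∑ k ∈ s, g k ≠ ⊤ := ne_top_of_le_ne_top hg (ENNReal.sum_le_tsum s)
  have h1 : ∀ᶠ i in l, ∑' k, f k i ≤ ∑ k ∈ s, f k i + δ := by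
    filter_upwards [hfg] with i hi
    rw [ENNReal.tsum_eq_iSup_sum]
    refine iSup_le fun t => ?_
    have h2 : ∑ k ∈ t \ s, g k ≤ δ := by
      rw [← ENNReal.add_le_add_iff_left hst, ← Finset.sum_union Finset.disjoint_sdiff]
      exact (ENNReal.sum_le_tsum _).trans hs.le
    calc ∑ k ∈ t, f k i ≤ ∑ k ∈ s ∪ (t \ s), f k i :=
          Finset.sum_le_sum_of_subset (by rw [Finset.union_sdiff_self_eq_union]; exact Finset.subset_union_right)
      _ = ∑ k ∈ s, f k i + ∑ k ∈ t \ s, f k i := Finset.sum_union Finset.disjoint_sdiff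
      _ ≤ _ := add_le_add le_rfl ((Finset.sum_le_sum fun k _ => hi k).trans h2)
  refine (limsup_le_limsup h1).trans ?_
  rw [limsup_add_const _ _ _ (by isBoundedDefault) (by isBoundedDefault)]
  exact add_le_add ((limsup_sum_le s f).trans (ENNReal.sum_le_tsum s)) le_rfl

theorem lintegral_enorm_sub_rpow_le {X E : Type*} [MeasurableSpace X] [NormedAddCommGroup E]
    {μ : Measure X} {p : ℝ} (hp : 1 < p) {f g : X → E}
    (hf : AEMeasurable (fun x => ‖f x‖ₑ ^ p) μ) :
    ∫⁻ x, ‖f x - g x‖ₑ ^ p ∂μ ≤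
      2 ^ (p - 1) * ((∫⁻ x, ‖f x‖ₑ ^ p ∂μ) + ∫⁻ x, ‖g x‖ₑ ^ p ∂μ) := by
  rw [← lintegral_add_left' hf, ← lintegral_const_mul' _ _ (by simp : (2 : ℝ≥0∞) ^ (p - 1) ≠ ⊤)]
  refine lintegral_mono fun x => ?_
  have := enorm_add_rpow_le hp (f x) (-g x)
  rwa [enorm_neg, ← sub_eq_add_neg] at this

/-- A diagonal selection along a filter. -/
theorem exists_tendsto_zero_of_eventually_exists {ι X : Type*} [Nonempty X] {l : Filter ι} [l.NeBot]
    {r : ι → ℝ≥0∞} (hr : Tendsto r l (𝓝 0)) (hr0 : ∀ᶠ i in l, 0 < r i) {φ ψ : ι → X → ℝ≥0∞}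
    {c : ℝ≥0∞} (h : ∀ t : ℝ≥0∞, 0 < t → ∀ᶠ i in l, ∃ x, φ i x ≤ t ∧ ψ i x ≤ c + t) :
    ∃ W : ι → X, Tendsto (fun i => φ i (W i)) l (𝓝 0) ∧ limsup (fun i => ψ i (W i)) l ≤ c := by
  classical
  -- A single quantity measures both defects, and its infimum over `x` tends to zero. The slack `r
  -- i` is positive so that a near minimizer exists, and vanishes so that the choice is still good
  -- in the limit.
  set θ : ι → X → ℝ≥0∞ := fun i x => max (φ i x) (ψ i x - c) with hθ
  have hne : ∀ i, ∃ x, 0 < r i → (⨅ y, θ i y) ≠ ⊤ → θ i x < (⨅ y, θ i y) + r i := by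
    intro i
    by_cases hi : 0 < r i ∧ (⨅ y, θ i y) ≠ ⊤
    · obtain ⟨x, hx⟩ := iInf_lt_iff.1 (ENNReal.lt_add_right hi.2 hi.1.ne')
      exact ⟨x, fun _ _ => hx⟩
    · exact ⟨Classical.arbitrary X, fun h1 h2 => absurd ⟨h1, h2⟩ hi⟩
  choose W hW using hne
  have hlim : Tendsto (fun i => θ i (W i)) l (𝓝 0) := by
    refine ENNReal.tendsto_nhds_zero.2 fun t ht => ?_
    rcases eq_or_ne t ⊤ with rfl | htt
    · exact Eventually.of_forall fun _ => le_top
    have ht2 : 0 < t / 2 := ENNReal.half_pos ht.ne'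
    filter_upwards [h (t / 2) ht2, hr.eventually_lt_const ht2, hr0] with i hi h1 h2
    obtain ⟨x, hx1, hx2⟩ := hi
    have h3 : ⨅ y, θ i y ≤ t / 2 := (iInf_le _ x).trans
      (max_le hx1 (tsub_le_iff_left.2 hx2))
    refine (hW i h2 (ne_top_of_le_ne_top (ENNReal.div_ne_top htt (by simp)) h3)).le.trans ?_
    exact (add_le_add h3 h1.le).trans_eq (ENNReal.add_halves t)
  refine ⟨W, tendsto_of_tendsto_of_tendsto_of_le_of_le tendsto_const_nhds hlim
    (fun _ => zero_le) fun i => le_max_left _ _, ?_⟩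
  have h1 : limsup (fun i => ψ i (W i)) l ≤ limsup (fun i => θ i (W i) + c) l :=
    limsup_le_limsup (Eventually.of_forall fun i => tsub_le_iff_right.1 (le_max_right _ _))
  refine h1.trans_eq ?_
  rw [limsup_add_const _ _ _ (by isBoundedDefault) (by isBoundedDefault), hlim.limsup_eq, zero_add]

/-! ### Recovery families from patched almost minimizers. -/

section UpperBound

variable {d m : ℕ} {Ω : Set (Space d)} {p α : ℝ} {b : ℝ≥0∞} {ν : Measure (Space d)}

/-- Almost minimizers of the Dirichlet problem on a cube, with the Poincaré estimate. -/
theorem DirichletGrowth.exists_almost_minimizer {Φ : SobolevMap Ω m p → Set (Space d) → ℝ≥0∞}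
    (hd : 1 ≤ d) (hp : 1 < p) (hα : 0 < α) (hΩ : IsOpen Ω) [IsFiniteMeasure (volume.restrict Ω)]
    [IsFiniteMeasure ν] (hb : b ≠ ⊤) (h : CoerciveLocal α Φ) (hG : DirichletGrowth Φ b ν)
    (u : SobolevMap Ω m p) {x : Space d} {ρ T : ℝ} (hρ : 0 < ρ) (hT : d * ρ < T)
    (hQ : closedCube x ρ ⊆ Ω) {δ : ℝ≥0∞} (hδ : 0 < δ) :
    ∃ v : SobolevMap Ω m p, (∀ᵐ y ∂volume.restrict (Ω \ openCube x ρ), v.val y = u.val y) ∧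
      (∀ᵐ y ∂volume.restrict (Ω \ openCube x ρ), v.grad y = u.grad y) ∧
      Φ v (openCube x ρ) ≤ dirichletInf Φ u.val (openCube x ρ) + δ ∧
      (∫⁻ y in openCube x ρ, ‖v.grad y - u.grad y‖ₑ ^ p) ≤ 2 ^ (p - 1) *
        ((ENNReal.ofReal α)⁻¹ * (b * energyMeasure ν u (openCube x ρ) + δ) +
          energyMeasure ν u (openCube x ρ)) ∧
      (∫⁻ y in openCube x ρ, ‖v.val y - u.val y‖ₑ ^ p) ≤
        ENNReal.ofReal T ^ p * ∫⁻ y in openCube x ρ, ‖v.grad y - u.grad y‖ₑ ^ p := by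
  have hfin := isFiniteMeasure_energyMeasure hp ν u
  have hQo := (openCube_subset_closedCube x ρ).trans hQ
  have hle := hG.le_energyMeasure u (isOpen_openCube x ρ) hQo
  have hbE : b * energyMeasure ν u (openCube x ρ) ≠ ⊤ := ENNReal.mul_ne_top hb (measure_ne_top _ _)
  have hfinite : dirichletInf Φ u.val (openCube x ρ) ≠ ⊤ := ne_top_of_le_ne_top hbE hle
  obtain ⟨v, hv, hΦ⟩ := exists_lt_of_dirichletInf_lt (ENNReal.lt_add_right hfinite hδ.ne')
  have hcl : ∀ᵐ y ∂volume.restrict (Ω \ closedCube x ρ), v.val y = u.val y :=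
    ae_restrict_of_ae_restrict_of_subset
      (sdiff_subset_sdiff_right (openCube_subset_closedCube x ρ)) hv
  -- Equality of gradients is available on open sets only, hence off the closed cube; the missing
  -- boundary is null.
  have hgcl := v.grad_ae_eq hp hΩ u (hΩ.sdiff (isClosed_closedCube x ρ)) sdiff_subset hcl
  have hset : (Ω \ openCube x ρ : Set (Space d)) =ᵐ[volume] (Ω \ closedCube x ρ : Set (Space d)) :=
    (ae_eq_refl _).diff (openCube_ae_eq_closedCube x hρ.le)
  have hg : ∀ᵐ y ∂volume.restrict (Ω \ openCube x ρ), v.grad y = u.grad y := by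
    rwa [Measure.restrict_congr_set hset]
  refine ⟨v, hv, hg, hΦ.le, ?_, ?_⟩
  · refine (lintegral_enorm_sub_rpow_le hp (v.aemeasurable_enorm_rpow_grad hQo)).trans
      (mul_le_mul' le_rfl (add_le_add ?_ ?_))
    · have h1 := h.coercive _ (isOpen_openCube x ρ) hQo v (hΦ.trans_le le_top)
      refine le_trans ?_ (mul_le_mul' le_rfl (hΦ.le.trans (add_le_add hle le_rfl)))
      rw [← ENNReal.div_eq_inv_mul, ENNReal.le_div_iff_mul_le (by simp [hα]) (by simp), mul_comm]
      exact h1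
    · rw [energyMeasure_apply ν u (isOpen_openCube x ρ).measurableSet hQo]
      exact le_add_self
  · have hw := v.hasWeakGradient.sub u.hasWeakGradient (v.integrableOn_val hp)
      (v.integrableOn_grad hp) (u.integrableOn_val hp) (u.integrableOn_grad hp)
    -- The closed cube has diameter at most `dρ`, which is the quantity required to be below `T`.
    have := hw.poincare hd hp hΩ (isCompact_closedCube x hρ.le) hQ
      ((v.integrableOn_val hp).sub (u.integrableOn_val hp))
      ((v.integrableOn_grad hp).sub (u.integrableOn_grad hp))
      (by filter_upwards [hcl] with y hy; exact sub_eq_zero.2 hy)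
      (by filter_upwards [hgcl] with y hy; exact sub_eq_zero.2 hy)
      (show 0 ≤ d * ρ by positivity) hT fun y hy z hz => by
        have h1 := dist_le_of_mem_closedCube hρ.le hy
        have h2 := dist_le_of_mem_closedCube hρ.le hz
        have h3 := dist_triangle_right y z x
        linarith
    rwa [← Measure.restrict_congr_set (openCube_ae_eq_closedCube x hρ.le)] at this

/-- Patching almost minimizers over a covering by disjoint cubes. -/
theorem DirichletGrowth.exists_patching {Φ : SobolevMap Ω m p → Set (Space d) → ℝ≥0∞}
    (hd : 1 ≤ d) (hp : 1 < p) (hα : 0 < α) (hΩ : IsOpen Ω) [IsFiniteMeasure (volume.restrict Ω)]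
    [IsFiniteMeasure ν] (hb : b ≠ ⊤) (h : CoerciveLocal α Φ) (hG : DirichletGrowth Φ b ν)
    (u : SobolevMap Ω m p) {O : Set (Space d)} (hO : IsOpen O) (hOΩ : O ⊆ Ω)
    {ι : Type*} [Countable ι] {x : ι → Space d} {ρ : ι → ℝ} {η : ℝ} (hρ : ∀ i, 0 < ρ i)
    (hη : ∀ i, ρ i < η) (hQ : ∀ i, closedCube (x i) (ρ i) ⊆ O)
    (hdisj : Pairwise (Function.onFun Disjoint fun i => openCube (x i) (ρ i)))
    (h0 : volume (O \ ⋃ i, openCube (x i) (ρ i)) = 0) {δ : ℝ≥0∞} (hδ : 0 < δ) (hδ1 : δ ≤ 1) :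
    ∃ w : SobolevMap Ω m p, Φ w O ≤ ∑' i, dirichletInf Φ u.val (openCube (x i) (ρ i)) + δ ∧
      ∫⁻ y in Ω, ‖w.val y - u.val y‖ₑ ^ p ≤ ENNReal.ofReal (d * η) ^ p * (2 ^ (p - 1) *
        ((ENNReal.ofReal α)⁻¹ * (b * energyMeasure ν u O + 1) + energyMeasure ν u O)) := by
  have hfin := isFiniteMeasure_energyMeasure hp ν u
  have hd0 : (0 : ℝ) < d := by exact_mod_cast hd
  have hp0 : 0 < p := by linarith
  -- The minimization errors are summable over the cubes with total below `δ`, and `δ ≤ 1` accounts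
  -- for the constant `1` in the gradient bound.
  obtain ⟨δ', hδ', hsum⟩ := ENNReal.exists_pos_sum_of_countable' hδ.ne' ι
  choose v hv hg hΦ hgr hpo using fun i => hG.exists_almost_minimizer hd hp hα hΩ hb h u (hρ i)
    (mul_lt_mul_of_pos_left (hη i) hd0) ((hQ i).trans hOΩ) (hδ' i)
  set Q : ι → Set (Space d) := fun i => openCube (x i) (ρ i) with hQdef
  have hQO : ∀ i, Q i ⊆ O := fun i => (openCube_subset_closedCube _ _).trans (hQ i)
  have hQm : ∀ i, MeasurableSet (Q i) := fun i => (isOpen_openCube _ _).measurableSet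
  have hE : ∑' i, energyMeasure ν u (Q i) ≤ energyMeasure ν u O := by
    rw [← measure_iUnion hdisj hQm]
    exact measure_mono (iUnion_subset hQO)
  have hgsum : ∑' i, ∫⁻ y in Q i, ‖(v i).grad y - u.grad y‖ₑ ^ p ≤ 2 ^ (p - 1) *
      ((ENNReal.ofReal α)⁻¹ * (b * energyMeasure ν u O + 1) + energyMeasure ν u O) := by
    refine (ENNReal.tsum_le_tsum hgr).trans ?_
    rw [ENNReal.tsum_mul_left, ENNReal.tsum_add, ENNReal.tsum_mul_left, ENNReal.tsum_add,
      ENNReal.tsum_mul_left]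
    have := hsum.le.trans hδ1
    gcongr
  have hgt : (2 : ℝ≥0∞) ^ (p - 1) * ((ENNReal.ofReal α)⁻¹ * (b * energyMeasure ν u O + 1) +
      energyMeasure ν u O) ≠ ⊤ := by
    refine ENNReal.mul_ne_top (by simp) (ENNReal.add_ne_top.2 ⟨ENNReal.mul_ne_top (by simp [hα])
      (ENNReal.add_ne_top.2 ⟨ENNReal.mul_ne_top hb (measure_ne_top _ _), by simp⟩),
      measure_ne_top _ _⟩)
  have hvsum : ∑' i, ∫⁻ y in Q i, ‖(v i).val y - u.val y‖ₑ ^ p ≤ ENNReal.ofReal (d * η) ^ p *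
      (2 ^ (p - 1) * ((ENNReal.ofReal α)⁻¹ * (b * energyMeasure ν u O + 1) +
        energyMeasure ν u O)) := by
    refine (ENNReal.tsum_le_tsum hpo).trans ?_
    rw [ENNReal.tsum_mul_left]
    exact mul_le_mul' le_rfl hgsum
  obtain ⟨w, hw1, -, hw3⟩ := SobolevMap.exists_glue hp hΩ.measurableSet u v hdisj hQm
    (fun i => (hQO i).trans hOΩ) hv hg
    (hvsum.trans_lt (ENNReal.mul_ne_top (ENNReal.rpow_ne_top_of_nonneg hp0.le ENNReal.ofReal_ne_top)
      hgt).lt_top) (hgsum.trans_lt hgt.lt_top)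
  refine ⟨w, ?_, hw3.trans_le hvsum⟩
  rw [h.eq_tsum w hO hOΩ (fun i => isOpen_openCube _ _) hQO hdisj h0]
  calc ∑' i, Φ w (Q i) = ∑' i, Φ (v i) (Q i) := tsum_congr fun i =>
        h.isLocal _ (isOpen_openCube _ _) ((hQO i).trans hOΩ) _ _ (hw1 i)
    _ ≤ ∑' i, (dirichletInf Φ u.val (Q i) + δ' i) := ENNReal.tsum_le_tsum hΦ
    _ ≤ _ := by rw [ENNReal.tsum_add]; exact add_le_add le_rfl hsum.le

variable {F : ℝ → SobolevMap Ω m p → Set (Space d) → ℝ≥0∞}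

/-- Approximate recovery sequences. -/
theorem eventually_exists_recovery (hd : 1 ≤ d) (hp : 1 < p) (hα : 0 < α) (hΩ : IsOpen Ω)
    (hΩb : Bornology.IsBounded Ω) [IsFiniteMeasure ν] (hb : b ≠ ⊤)
    (hF : ∀ ε ∈ Ioc (0 : ℝ) 1, CoerciveLocal α (F ε))
    (hG : ∀ ε ∈ Ioc (0 : ℝ) 1, DirichletGrowth (F ε) b ν) (u : SobolevMap Ω m p)
    {O : Set (Space d)} (hO : IsOpen O) (hOΩ : O ⊆ Ω) {f : Space d → ℝ≥0∞}
    (hf : AEMeasurable f (volume.restrict O)) (hfi : ∫⁻ x in O, f x ≠ ⊤)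
    (hft : ∀ᵐ x ∂volume.restrict O, f x ≠ ⊤)
    (hlim : ∀ᵐ x ∂volume.restrict O, Tendsto (fun ρ : ℝ => dirichletLimsup F u.val (openCube x ρ) /
      ENNReal.ofReal (ρ ^ d)) (𝓝[>] 0) (𝓝 (f x))) {τ : ℝ≥0∞} (hτ : 0 < τ) :
    ∀ᶠ ε in 𝓝[>] (0 : ℝ), ∃ w : SobolevMap Ω m p,
      ∫⁻ y in Ω, ‖w.val y - u.val y‖ₑ ^ p ≤ τ ∧ F ε w O ≤ (∫⁻ x in O, f x) + τ := by
  have : IsFiniteMeasure (volume.restrict Ω) := ⟨by simpa using hΩb.measure_lt_top⟩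
  have hfin := isFiniteMeasure_energyMeasure hp ν u
  have hp0 : 0 < p := by linarith
  have hvO : volume O ≠ ⊤ := (hΩb.subset hOΩ).measure_lt_top.ne
  -- The multiple of the volume is the loss in the covering; the two single `δ` pay for replacing an
  -- upper limit by the values at small `ε`, and for the almost minimization.
  obtain ⟨δ, hδ, hδ1, hδτ⟩ : ∃ δ : ℝ≥0∞, 0 < δ ∧ δ < 1 ∧ (δ + δ) * volume O + δ + δ < τ := by
    have h0 : Tendsto (fun δ : ℝ≥0∞ => δ) (𝓝[>] 0) (𝓝 0) := nhdsWithin_le_nhds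
    have ht := ((ENNReal.Tendsto.mul_const (b := volume O) (h0.add h0) (Or.inr hvO)).add h0).add h0
    simp only [add_zero, zero_mul] at ht
    obtain ⟨δ, h1, h2, h3⟩ := ((ht.eventually_lt_const hτ).and
      (Ioo_mem_nhdsGT (show (0 : ℝ≥0∞) < 1 by simp))).exists
    exact ⟨δ, h2, h3, h1⟩
  set G : ℝ≥0∞ := 2 ^ (p - 1) * ((ENNReal.ofReal α)⁻¹ * (b * energyMeasure ν u O + 1) +
      energyMeasure ν u O) with hGdef
  have hGt : G ≠ ⊤ :=
    ENNReal.mul_ne_top (by simp) (ENNReal.add_ne_top.2 ⟨ENNReal.mul_ne_top (by simp [hα])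
      (ENNReal.add_ne_top.2 ⟨ENNReal.mul_ne_top hb (measure_ne_top _ _), by simp⟩),
      measure_ne_top _ _⟩)
  -- The bound `G` on the gradients does not depend on the covering, so small cubes force closeness
  -- to `u` in `Lᵖ` through Poincaré's inequality.
  obtain ⟨η, hη, hητ⟩ : ∃ η : ℝ, 0 < η ∧ ENNReal.ofReal (d * η) ^ p * G < τ := by
    have hc : Continuous fun η : ℝ => ENNReal.ofReal (d * η) ^ p :=
      ENNReal.continuous_rpow_const.comp (ENNReal.continuous_ofReal.comp (by fun_prop))
    have ht := ENNReal.Tendsto.mul_const (b := G)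
      ((hc.tendsto 0).mono_left (nhdsWithin_le_nhds (s := Ioi 0))) (Or.inr hGt)
    simp only [mul_zero, ENNReal.ofReal_zero, ENNReal.zero_rpow_of_pos hp0, zero_mul] at ht
    obtain ⟨η, h1, h2⟩ := ((ht.eventually_lt_const hτ).and self_mem_nhdsWithin).exists
    exact ⟨η, h2, h1⟩
  have hP : ∀ᵐ x ∂volume.restrict O, ∀ᶠ ρ in 𝓝[>] (0 : ℝ),
      dirichletLimsup F u.val (openCube x ρ) ≤
        (∫⁻ y in openCube x ρ, f y) + (δ + δ) * volume (openCube x ρ) := by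
    filter_upwards [ae_tendsto_setLIntegral_openCube_div hd hO hf hfi, hft, hlim] with x h1 h2 h3
    have h4 : ∀ᶠ ρ in 𝓝[>] (0 : ℝ), f x ≤
        (∫⁻ y in openCube x ρ, f y) / ENNReal.ofReal (ρ ^ d) + δ := by
      rcases eq_or_ne (f x) 0 with h0 | h0
      · simp [h0]
      · filter_upwards [h1.eventually_const_lt (ENNReal.sub_lt_self h2 h0 hδ.ne')]
          with ρ hρ using tsub_le_iff_right.1 hρ.le
    filter_upwards [h3.eventually_lt_const (ENNReal.lt_add_right h2 hδ.ne'), h4,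
      self_mem_nhdsWithin] with ρ h5 h6 hρ
    have hρ : 0 < ρ := hρ
    have h7 := h5.le.trans (add_le_add h6 le_rfl)
    rw [ENNReal.div_le_iff (ofReal_pow_ne_zero hρ) ENNReal.ofReal_ne_top, add_assoc, add_mul,
      ENNReal.div_mul_cancel (ofReal_pow_ne_zero hρ) ENNReal.ofReal_ne_top] at h7
    rwa [volume_openCube x hρ.le]
  obtain ⟨t, htc, ht, htd, ht0⟩ := exists_disjoint_openCube_covering hO (P := fun x ρ =>
    dirichletLimsup F u.val (openCube x ρ) ≤
        (∫⁻ y in openCube x ρ, f y) + (δ + δ) * volume (openCube x ρ)) hP hη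
  have hle : ∀ c : t, dirichletLimsup F u.val (openCube c.1.1 c.1.2) ≤
      (∫⁻ y in openCube c.1.1 c.1.2, f y) + (δ + δ) * volume (openCube c.1.1 c.1.2) :=
    fun c => (ht c.1 c.2).2.2.2
  have := htc.to_subtype
  have hQO : ∀ c : t, openCube c.1.1 c.1.2 ⊆ O := fun c =>
    (openCube_subset_closedCube _ _).trans (ht c.1 c.2).2.2.1
  have hQm : ∀ c : t, MeasurableSet (openCube c.1.1 c.1.2) := fun c =>
    (isOpen_openCube _ _).measurableSet
  have hEsum : ∑' c : t, b * energyMeasure ν u (openCube c.1.1 c.1.2) ≠ ⊤ := by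
    rw [ENNReal.tsum_mul_left, ← measure_iUnion htd hQm]
    exact ENNReal.mul_ne_top hb (measure_ne_top _ _)
  have hlimsup : limsup (fun ε => ∑' c : t, dirichletInf (F ε) u.val (openCube c.1.1 c.1.2))
      (𝓝[>] (0 : ℝ)) ≤ (∫⁻ x in O, f x) + (δ + δ) * volume O := by
    -- The growth condition supplies the summable majorant, `b` times the energy measure of each
    -- cube.
    refine (limsup_tsum_le (f := fun (c : t) ε => dirichletInf (F ε) u.val (openCube c.1.1 c.1.2))
      (eventually_mem_Ioc_zero_one.mono fun ε hε c => (hG ε hε).le_energyMeasure u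
        (isOpen_openCube _ _) ((hQO c).trans hOΩ)) hEsum).trans ?_
    refine (ENNReal.tsum_le_tsum hle).trans ?_
    rw [ENNReal.tsum_add, ENNReal.tsum_mul_left, ← measure_iUnion htd hQm]
    have e := setLIntegral_eq_tsum_of_covering (μ := volume)
      (Q := fun c : t => openCube c.1.1 c.1.2) hQm hQO htd ht0 f
    exact add_le_add e.symm.le (mul_le_mul' le_rfl (measure_mono (iUnion_subset hQO)))
  have hlt : limsup (fun ε => ∑' c : t, dirichletInf (F ε) u.val (openCube c.1.1 c.1.2))
      (𝓝[>] (0 : ℝ)) < (∫⁻ x in O, f x) + (δ + δ) * volume O + δ := by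
    refine hlimsup.trans_lt (ENNReal.lt_add_right (ENNReal.add_ne_top.2 ⟨hfi, ?_⟩) hδ.ne')
    have hδt : δ ≠ ⊤ := hδ1.ne_top
    exact ENNReal.mul_ne_top (ENNReal.add_ne_top.2 ⟨hδt, hδt⟩) hvO
  filter_upwards [eventually_lt_of_limsup_lt hlt, eventually_mem_Ioc_zero_one] with ε h1 hε
  obtain ⟨w, hw1, hw2⟩ := (hG ε hε).exists_patching hd hp hα hΩ hb (hF ε hε) u hO hOΩ
    (x := fun c : t => c.1.1) (ρ := fun c : t => c.1.2) (fun c => (ht c.1 c.2).1)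
    (fun c => (ht c.1 c.2).2.1) (fun c => (ht c.1 c.2).2.2.1) htd ht0 hδ hδ1.le
  refine ⟨w, hw2.trans hητ.le, hw1.trans ((add_le_add h1.le le_rfl).trans ?_)⟩
  rw [add_assoc, add_assoc]
  refine add_le_add le_rfl ?_
  rw [← add_assoc]
  exact hδτ.le

end UpperBound

/-! ### Conclusion: `Γ`-convergence at `u`. -/

theorem mainTheorem3 {d m : ℕ} (hd : 1 ≤ d) (hm : 1 ≤ m) {p α : ℝ} (hp : 1 < p) (hα : 0 < α)
    {Ω : Set (Space d)} (hΩ : IsOpen Ω) (hΩb : Bornology.IsBounded Ω)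
    (F : ℝ → SobolevMap Ω m p → Set (Space d) → ℝ≥0∞)
    (hF : ∀ ε ∈ Ioc (0 : ℝ) 1, CoerciveLocal α (F ε))
    (hG1 : GrowthBoundG1 F)
    (u : SobolevMap Ω m p) (O : Set (Space d)) (hO : IsOpen O) (hOΩ : O ⊆ Ω)
    (hH0 : LocalConditionH0 F u O) :
    AEMeasurable (fun x => limitIntegrand F x (u.val x) (u.grad x)) (volume.restrict O) ∧
      GammaConvergesAt F u O (∫⁻ x in O, limitIntegrand F x (u.val x) (u.grad x)) := by
  have : IsFiniteMeasure (volume.restrict Ω) := ⟨by simpa using hΩb.measure_lt_top⟩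
  have hp0 : 0 < p := by linarith
  obtain ⟨b, ν, hb, hνf, hν, hG⟩ := hG1.exists_dirichletGrowth hΩb hF
  have hreg := ae_restrict_of_ae_restrict_of_subset hOΩ (ae_isRegularPoint hd hp hΩ hν u)
  have hlim : ∀ᵐ x ∂volume.restrict O, Tendsto (fun ρ : ℝ =>
      dirichletLimsup F u.val (openCube x ρ) / ENNReal.ofReal (ρ ^ d)) (𝓝[>] 0)
      (𝓝 (limitIntegrand F x (u.val x) (u.grad x))) := by
    filter_upwards [hreg, hH0] with x h1 h2
    exact h1.tendsto_dirichletLimsup_div hd hp hΩ hΩb hν hb hF hG h2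
  obtain ⟨hmeas, hle⟩ :=
    aemeasurable_of_tendsto_dirichletLimsup_div hd hp hΩ hν hb hF hG u hOΩ hlim
  have hfi := lintegral_density_ne_top hp hν hb u (hle.mono fun x hx => hx.1)
  have hft : ∀ᵐ x ∂volume.restrict O, limitIntegrand F x (u.val x) (u.grad x) ≠ ⊤ :=
    hle.mono fun x hx => ne_top_of_le_ne_top hx.2 hx.1
  have hlow : ∫⁻ x in O, limitIntegrand F x (u.val x) (u.grad x) ≤ gammaLiminf F u.val O := by
    refine le_iInf₂ fun W hW => lintegral_le_liminf hd hΩb hF hO hOΩ hmeas hfi hft W ?_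
    filter_upwards [hreg, hH0] with x h1 h2
    exact h2.trans (h1.liminf_dirichletLiminf_le hd hp hα hΩ hΩb hb hF hG hW)
  have hmid : gammaLiminf F u.val O ≤ gammaLimsup F u.val O :=
    iInf₂_mono fun W _ => liminf_le_limsup
  have hup : gammaLimsup F u.val O ≤ ∫⁻ x in O, limitIntegrand F x (u.val x) (u.grad x) := by
    have : Nonempty (SobolevMap Ω m p) := ⟨u⟩
    have hr : Tendsto (fun ε : ℝ => ENNReal.ofReal ε) (𝓝[>] 0) (𝓝 0) := by
      have := (ENNReal.continuous_ofReal.tendsto 0).mono_left (nhdsWithin_le_nhds (s := Ioi 0))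
      rwa [ENNReal.ofReal_zero] at this
    have hr0 : ∀ᶠ ε in 𝓝[>] (0 : ℝ), 0 < ENNReal.ofReal ε := by
      filter_upwards [self_mem_nhdsWithin] with ε hε using ENNReal.ofReal_pos.2 hε
    obtain ⟨W, hW, hWle⟩ := exists_tendsto_zero_of_eventually_exists hr hr0
      (φ := fun _ (w : SobolevMap Ω m p) => ∫⁻ y in Ω, ‖w.val y - u.val y‖ₑ ^ p)
      (ψ := fun ε w => F ε w O) fun t ht =>
        eventually_exists_recovery hd hp hα hΩ hΩb hb hF hG u hO hOΩ hmeas hfi hft hlim ht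
    refine (iInf₂_le W ?_).trans hWle
    -- The selection controls the integral of the `p`-th power; its `p`-th root is the `Lᵖ` norm in
    -- the definition of approximating families.
    have h1 := (ENNReal.continuous_rpow_const (y := 1 / p)).continuousAt.tendsto.comp hW
    rw [ENNReal.zero_rpow_of_pos (by positivity)] at h1
    refine Tendsto.congr (fun ε => ?_) h1
    exact (eLpNorm_ofReal_eq hp _).symm
  exact ⟨hmeas, le_antisymm (hmid.trans hup) hlow, le_antisymm hup (hlow.trans hmid)⟩
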